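/- Let $k>0$, $c>3k$, $\nu_0:=\sqrt{\frac{c-3k}{c-k}}\in(0,1)$ and $\nu\in(0,\nu_0)$. Let $L^2_\nu$ be the (complex) Hilbert space of functions $f$ with $e^{\nu x}f\in L^2(\mathbb R)$, and on it put $J:=\partial_x(1-\partial_x^2)^{-1}$, $(\partial_x^{-1}f)(x):=\int_{+\infty}^x f(x')\,dx'$ and $L_0:=c-3k-(c-k)\partial_x^2$. For a function $\phi$ put $L:=c-3\phi+\phi''-\partial_x(c-\phi)\partial_x$. The operators $J(L_0+\eta^2\partial_x^{-2})$ and $J(L+\eta^2\partial_x^{-2})$, $\eta\in\mathbb R$, are considered in $L^2_\nu$ on their natural domain $H^1_\nu=\{v\in L^2_\nu:\ v'\in L^2_\nu\}$. (a) For every $\eta\in\mathbb R$ there is $b_0>0$ such that every point $\lambda$ of the spectrum of $J(L_0+\eta^2\partial_x^{-2})$ in $L^2_\nu$ satisfies $\mathrm{Re}\,\lambda\le -b_0$. (b) Let $\phi\in C^\infty(\mathbb R)$ be the profile of any smooth solitary wave $u=\phi(x-ct)$ of the Camassa–Holm equation $u_t-u_{txx}+3uu_x=2u_xu_{xx}+uu_{xxx}$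 on the background $k$, that is, a non-constant solution of $-c(\phi'-\phi''')+3\phi\phi'-2\phi'\phi''-\phi\phi'''=0$ with $\phi(x)\to k$ as $x\to\pm\infty$. Then $0$ is an isolated eigenvalue of $JL$ in $L^2_\nu$ of algebraic multiplicity two, with eigenspace spanned by $\phi'$. There are $\eta_0>0$ and continuous functions $\lambda_\pm:(-\eta_0,\eta_0)\to\mathbb C$ with $\lambda_+(0)=\lambda_-(0)=0$ such that for every $\eta\in(-\eta_0,\eta_0)$, $\eta\ne0$, the numbers $\lambda_+(\eta)$ and $\lambda_-(\eta)$ are simple eigenvalues (isolated points of the spectrum, of algebraic multiplicity one) of $J(L+\eta^2\partial_x^{-2})$ in $L^2_\nu$, and $$\mathrm{Re}\,\lambda_+(\eta)=\mathrm{Re}\,\lambda_-(\eta)<0,\qquad \mathrm{Im}\,\lambda_+(\eta)=-\mathrm{Im}\,\lambda_-(\eta)>0 .$$ -/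

import Mathlib

open MeasureTheory Set Filter Topology
open scoped ContDiff

noncomputable section

namespace CHKP

/-! ## Smooth solitary waves of the Camassa–Holm equation -/

/-- `φ` is the profile of a smooth solitary wave `u(x, t) = φ(x - c t)` of the Camassa–Holm equation
`u_t - u_txx + 3 u u_x = 2 u_x u_xx + u u_xxx` on the constant background `k`: a smooth non-constant
solution of the travelling wave equation which tends to `k` at both ends of the line. -/
structure IsSolitaryWave (k c : ℝ) (φ : ℝ → ℝ) : Prop where
  smooth : ContDiff ℝ ∞ φ
  travelling : ∀ x, -c * (deriv φ x - iteratedDeriv 3 φ x) + 3 * φ x * deriv φ x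
    - 2 * deriv φ x * iteratedDeriv 2 φ x - φ x * iteratedDeriv 3 φ x = 0
  tendsto_atTop : Tendsto φ atTop (𝓝 k)
  tendsto_atBot : Tendsto φ atBot (𝓝 k)
  nonconstant : ∃ x, φ x ≠ k

/-! ## Spectral notions for unbounded operators

An unbounded operator `A` in a complex Banach space `E` is described by its graph:
`A v w` says that `v` belongs to the domain of `A` and that `A v = w`. -/

section Spectral

variable {E : Type*} [NormedAddCommGroup E] [NormedSpace ℂ E]

/-- The resolvent set: `z - A` is a bijection of the domain of `A` onto `E` with a bounded inverse
`R`. (`A v (z • v - f)` says that `v` is in the domain and `(z - A) v = f`.) -/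
def resolventSet (A : E → E → Prop) : Set ℂ :=
  {z | ∃ R : E →L[ℂ] E, ∀ f v : E, R f = v ↔ A v (z • v - f)}

/-- The spectrum: the complement of the resolvent set. -/
def spectrum (A : E → E → Prop) : Set ℂ := (resolventSet A)ᶜ

/-- The kernel of `(A - z) ^ n`. -/
def genKer (A : E → E → Prop) (z : ℂ) : ℕ → Set E
  | 0 => {0}
  | n + 1 => {v | ∃ w, A v w ∧ w - z • v ∈ genKer A z n}

/-- `z` is an isolated point of the spectrum and an eigenvalue of algebraic multiplicity `m ≥ 1`:
the generalized eigenvectors at `z` form a space of dimension `m`. -/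
def HasAlgMultiplicity (A : E → E → Prop) (z : ℂ) (m : ℕ) : Prop :=
  (∃ r > 0, spectrum A ∩ Metric.ball z r = {z}) ∧
  0 < m ∧ ∃ V : Submodule ℂ E, (V : Set E) = ⋃ n, genKer A z n ∧ Module.finrank ℂ V = m

/-- A simple eigenvalue. -/
def IsSimpleEigenvalue (A : E → E → Prop) (z : ℂ) : Prop := HasAlgMultiplicity A z 1

end Spectral

/-! ## The weighted space and the linearized operator -/

/-- The measure `exp (2 ν x) dx`. -/
def expWeight (ν : ℝ) : Measure ℝ :=
  volume.withDensity fun x => ENNReal.ofReal (Real.exp (2 * ν * x))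

/-- The (complex) exponentially weighted space `L²_ν` of all `f` with `exp (ν x) f ∈ L²(ℝ)`, with
the norm `‖exp (ν x) f‖` of `L²(ℝ)`. -/
abbrev WeightedL2 (ν : ℝ) : Type := Lp ℂ 2 (expWeight ν)

/-- Smooth compactly supported test functions. -/
def IsTest (χ : ℝ → ℂ) : Prop := ContDiff ℝ ∞ χ ∧ HasCompactSupport χ

/-- `g` is the weak derivative of `f`. -/
def IsWeakDeriv (f g : ℝ → ℂ) : Prop :=
  ∀ χ, IsTest χ → ∫ x, f x * deriv χ x = -∫ x, g x * χ x

/-- The antiderivative `(∂ₓ⁻¹ f)(x) = ∫_{+∞}^x f`. -/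
def invDeriv (f : ℝ → ℂ) (x : ℝ) : ℂ := -∫ y in Ioi x, f y

/-- The Sturm–Liouville expression `L v = a v - ∂ₓ (b ∂ₓ v)` as a distribution, paired with the test
function `θ`; here `v'` is the weak derivative of `v`. -/
def slPairing (a b : ℝ → ℝ) (v v' θ : ℝ → ℂ) : ℂ :=
  (∫ x, (a x : ℂ) * v x * θ x) + ∫ x, (b x : ℂ) * v' x * deriv θ x

/-- The graph of the operator `J (L + η² ∂ₓ⁻²)` in `L²_ν` (for `0 < ν < 1`), where
`J = ∂ₓ (1 - ∂ₓ²)⁻¹` and `L = a - ∂ₓ b ∂ₓ`, on the domain `H¹_ν`: `v` and its weak derivative are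
in `L²_ν`, and `w` is the element of `L²_ν` with
`(1 - ∂ₓ²) w = ∂ₓ (L v + η² ∂ₓ⁻² v)` in the sense of distributions. For `0 < ν < 1` there is at most
one such `w`, because no nonzero combination of `exp x` and `exp (-x)` is in `L²_ν`. -/
def linOp (ν η : ℝ) (a b : ℝ → ℝ) (v w : WeightedL2 ν) : Prop :=
  ∃ v' : WeightedL2 ν, IsWeakDeriv v v' ∧
    ∀ χ, IsTest χ →
      ∫ x, w x * (χ x - deriv (deriv χ) x) =
        -(slPairing a b v v' (deriv χ)
          + (η : ℂ) ^ 2 * ∫ x, invDeriv (invDeriv v) x * deriv χ x)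

/-- `J (L₀ + η² ∂ₓ⁻²)` with `L₀ = c - 3 k - (c - k) ∂ₓ²`. -/
def backgroundOp (k c ν η : ℝ) : WeightedL2 ν → WeightedL2 ν → Prop :=
  linOp ν η (fun _ => c - 3 * k) (fun _ => c - k)

/-- `J (L + η² ∂ₓ⁻²)` with `L = c - 3 φ + φ'' - ∂ₓ (c - φ) ∂ₓ`. -/
def waveOp (c ν η : ℝ) (φ : ℝ → ℝ) : WeightedL2 ν → WeightedL2 ν → Prop :=
  linOp ν η (fun x => c - 3 * φ x + iteratedDeriv 2 φ x) (fun x => c - φ x)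

end CHKP

end

/-! The proof works with bounded operators only. Since functions in `L²_ν` are integrable at `+∞`,
the antiderivative `S = ∂ₓ⁻¹` is a bounded injective operator whose range is the domain `H¹_ν`.
Writing `v = S g` and applying `-S²` to `(1 - ∂ₓ²) w = ∂ₓ (L v + η² ∂ₓ⁻² v)` turns `J (L + η² ∂ₓ⁻²)
v = w` into `(1 - S²) w = (P₀ - ε M) g`, where `ε = η²`, `M = S⁴` and `P₀ = b - S a S` if `L = a -
∂ₓ b ∂ₓ` (`linOp_iff`). The weight makes `1 - S²` invertible, because `1 - μ S` is invertible for
`Re μ ≠ -ν` (`isUnit_one_sub_smul_antideriv`; the inverse is an integral operator with an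
exponential kernel) and `0 < ν < 1`. So the spectral problem is that of the pencil `P₀ - ε M - z N`
with `N = (1 - S²) S` (`isEncodedBy_linOp`).

For the background operator the pencil is a polynomial in `S`, whose spectrum lies on the circle
formed by `0` and the `μ⁻¹` with `Re μ = -ν`. By spectral mapping `z` satisfies the dispersion
relation for some such `μ`, and on this line its real part is negative, uniformly, exactly because
`ν < ν₀` (`dispersion_re_le`).

For a solitary wave, put `h = c - 3 k` and `s = φ - k`. Two integrations of the profile equation
give `(h + 2 k - s) s'² = s² (h - s)`. In terms of `s`, `r = -s' / s` and the phase `q = ∫ dx / (c -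
φ)` all functions that are needed are explicit (`IsSolitaryWave.exists_chart`): the kernel `φ'` of
`L`, the generalized eigenfunction `gen`, which solves `L v = s - s''` and comes from varying the
speed, and a second solution `sol` of `L v = 0`, which grows like `1 / s` at both ends. The rate of
decay of `s` is `n = ν₀`, so that `φ'`, `gen` and their derivatives lie in `L²_ν` and in its dual.
If `P₀ g = 0`, the Wronskian of `v = S g` with `φ'` is constant and integrable, hence zero, so that
`g` is a multiple of `φ''` (`IsWaveChart.exists_eq_smul_of_pencilOp_eq_zero`). Variation of
constants, bounded by an exponential kernel, shows that the range of `P₀` is the annihilator of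
`φ''` (`IsWaveChart.exists_pencilOp_eq`). Thus the pencil has the Jordan chain `φ'', gen'` at the
origin, and, as `S` is skew for the pairing `∫ f g`, the transposed pencil has the chain `φ'',
-gen'`.

The rest is perturbation of a double eigenvalue (`BifurcationData.exists_branches`). Bordering the
pencil by a rank one operator makes it invertible near the origin and reduces the question to the
zeros of an analytic function `H z ε = -(A₀ ε + B₀ z² + A₁ ε z + B₁ z³) + ⋯`, up to the addition of
a multiple of `(A₀, B₀)` to `(A₁, B₁)`, which does not change `A₁ B₀ - A₀ B₁`. Its zero at the
origin for `ε = 0` is double, and simple zeros of `H` are simple eigenvalues. With `z = η ζ` and `ε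
= η²`, the function `H / η²` is analytic in `(η, ζ)` and equals `-(A₀ + B₀ ζ²)` at `η = 0`. The
implicit function theorem at `ζ = i μ`, `μ² = A₀ / B₀`, gives `z = i μ |η| - (A₁ B₀ - A₀ B₁) / (2
B₀²) η² + ⋯`, and complex conjugation gives the other branch. Up to a common factor, `A₀ = ∫ s²`,
`B₀ = 2 h / n`, `A₁ = (2 / n) ∫ s` and `B₁ = 2 / n²`; they come from `∫ gen = -2 / n` and `∫ gen
(φ'' - s) = 2 h / n`, integrals of exact derivatives. Since `0 < s ≤ h`, one has `∫ s² ≤ h ∫ s < 2 h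
∫ s`, that is, `A₀ B₁ < A₁ B₀`, and the real parts are negative. -/

noncomputable section

namespace CHKP

section

/-! ### Spectra of operators given by a bounded pencil -/

section Pencil

variable {E : Type*} [NormedAddCommGroup E] [NormedSpace ℂ E]

/-- The unbounded operator `A` is *encoded* by bounded operators `S`, `T`, `K` if its domain is the
range of the injective operator `S`, and `A (S g) = T⁻¹ (K g)`. Then `z - A` is invertible exactly
if the bounded operator `K - z • (T * S)` is. -/
structure IsEncodedBy (A : E → E → Prop) (S T K : E →L[ℂ] E) : Prop where
  isUnit : IsUnit T
  injective : Function.Injective S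
  iff : ∀ v w, A v w ↔ ∃ g, v = S g ∧ T w = K g

namespace IsEncodedBy

variable {A : E → E → Prop} {S T K : E →L[ℂ] E}

lemma apply_smul_add_iff (h : IsEncodedBy A S T K) (z : ℂ) (v u : E) :
    A v (z • v + u) ↔ ∃ g, v = S g ∧ (K - z • (T * S)) g = T u := by
  rw [h.iff]
  refine exists_congr fun g => and_congr_right fun hv => ?_
  subst hv
  simp only [map_add, map_smul, sub_apply, smul_apply,
    mul_apply_eq_comp]
  constructor
  · intro h; rw [← h]; abel
  · intro h; rw [← h]; abel

lemma isUnit_bijective {U : E →L[ℂ] E} (hU : IsUnit U) : Function.Bijective U := by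
  obtain ⟨u, rfl⟩ := hU
  refine ⟨fun x y hxy => ?_, fun y => ⟨(↑u⁻¹ : E →L[ℂ] E) y, ?_⟩⟩
  · have := congrArg (↑u⁻¹ : E →L[ℂ] E) hxy
    simpa only [← mul_apply_eq_comp, Units.inv_mul,
      one_apply_eq_self] using this
  · rw [← mul_apply_eq_comp, Units.mul_inv, one_apply_eq_self]

lemma mem_resolventSet (h : IsEncodedBy A S T K) {z : ℂ} (hz : IsUnit (K - z • (T * S))) :
    z ∈ resolventSet A := by
  obtain ⟨u, hu⟩ := hz
  refine ⟨-(S * (↑u⁻¹ : E →L[ℂ] E) * T), fun f v => ?_⟩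
  rw [sub_eq_add_neg, h.apply_smul_add_iff, ← hu]
  simp only [neg_apply, mul_apply_eq_comp, map_neg]
  constructor
  · rintro rfl
    refine ⟨-((↑u⁻¹ : E →L[ℂ] E) (T f)), by simp, ?_⟩
    rw [map_neg, ← mul_apply_eq_comp, Units.mul_inv, one_apply_eq_self]
  · rintro ⟨g, rfl, hg⟩
    have := congrArg (↑u⁻¹ : E →L[ℂ] E) hg
    rw [← mul_apply_eq_comp, Units.inv_mul, one_apply_eq_self,
      map_neg] at this
    rw [this, map_neg]

lemma mem_spectrum (h : IsEncodedBy A S T K) {z : ℂ} {g : E} (hg : g ≠ 0)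
    (hz : (K - z • (T * S)) g = 0) : z ∈ spectrum A := by
  rintro ⟨R, hR⟩
  have h1 : R 0 = S g := by
    rw [hR, sub_eq_add_neg, h.apply_smul_add_iff]
    exact ⟨g, rfl, by simp [hz]⟩
  rw [map_zero] at h1
  exact hg (h.injective (by rw [← h1, map_zero]))

lemma mem_genKer_succ (h : IsEncodedBy A S T K) (z : ℂ) (n : ℕ) (v : E) :
    v ∈ genKer A z (n + 1) ↔ ∃ u ∈ genKer A z n, ∃ g, v = S g ∧ (K - z • (T * S)) g = T u := by
  constructor
  · rintro ⟨w, hw, hw'⟩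
    refine ⟨_, hw', ?_⟩
    rw [← h.apply_smul_add_iff]
    simpa using hw
  · rintro ⟨u, hu, hg⟩
    rw [← h.apply_smul_add_iff] at hg
    exact ⟨_, hg, by simpa using hu⟩

lemma mem_genKer_one (h : IsEncodedBy A S T K) (z : ℂ) (v : E) :
    v ∈ genKer A z 1 ↔ ∃ g, v = S g ∧ (K - z • (T * S)) g = 0 := by
  rw [h.mem_genKer_succ]
  simp [genKer]

/-- A simple zero of a scalar function `D` for which `(K - z T S) (G z) = D z • g₀` is a simple
eigenvalue: differentiating this identity shows that a Jordan chain of length two would put `g₀`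
into the range of `K - z₀ T S`. -/
lemma isSimpleEigenvalue (h : IsEncodedBy A S T K) {z₀ D' : ℂ} {G : ℂ → E} {G' g₀ : E} {D : ℂ → ℂ}
    (hGD : ∀ᶠ z in 𝓝 z₀, (K - z • (T * S)) (G z) = D z • g₀)
    (hU : ∀ᶠ z in 𝓝 z₀, D z ≠ 0 → IsUnit (K - z • (T * S)))
    (hG : HasDerivAt G G' z₀) (hD : HasDerivAt D D' z₀) (hD' : D' ≠ 0) (hD0 : D z₀ = 0)
    (hG0 : G z₀ ≠ 0) (hker : ∀ g, (K - z₀ • (T * S)) g = 0 → ∃ α : ℂ, g = α • G z₀)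
    (hran : ∀ g, (K - z₀ • (T * S)) g ≠ g₀) : IsSimpleEigenvalue A z₀ := by
  have hPG : (K - z₀ • (T * S)) (G z₀) = 0 := by rw [hGD.self_of_nhds, hD0, zero_smul]
  -- the derivative of the identity `hGD`
  have hderiv : (K - z₀ • (T * S)) G' - T (S (G z₀)) = D' • g₀ := by
    have h1 : HasDerivAt (fun z => (K - z • (T * S)) (G z))
        ((-((1 : ℂ) • (T * S))) (G z₀) + (K - z₀ • (T * S)) G') z₀ :=
      (((hasDerivAt_id z₀).smul_const (T * S)).const_sub K).clm_apply hG
    have h2 := (hD.smul_const g₀).congr_of_eventuallyEq hGD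
    rw [← h1.unique h2]
    simp only [one_smul, neg_apply, mul_apply_eq_comp]
    abel
  have hSG : S (G z₀) ≠ 0 := fun h0 => hG0 (h.injective (by rw [h0, map_zero]))
  have h1 : ∀ v, v ∈ genKer A z₀ 1 ↔ v ∈ Submodule.span ℂ {S (G z₀)} := by
    intro v
    rw [h.mem_genKer_one, Submodule.mem_span_singleton]
    constructor
    · rintro ⟨g, rfl, hg⟩
      obtain ⟨α, rfl⟩ := hker g hg
      exact ⟨α, by rw [map_smul]⟩
    · rintro ⟨α, rfl⟩
      exact ⟨α • G z₀, by rw [map_smul], by rw [map_smul, hPG, smul_zero]⟩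
  have hn : ∀ n v, v ∈ genKer A z₀ (n + 1) ↔ v ∈ Submodule.span ℂ {S (G z₀)} := by
    intro n
    induction n with
    | zero => exact h1
    | succ n ih =>
      intro v
      rw [h.mem_genKer_succ]
      constructor
      · rintro ⟨u, hu, g, rfl, hg⟩
        rw [ih, Submodule.mem_span_singleton] at hu
        obtain ⟨α, rfl⟩ := hu
        have h3 : (K - z₀ • (T * S)) (g - α • G') = -(α * D') • g₀ := by
          rw [map_sub, hg, map_smul, map_smul, neg_smul, mul_smul, ← hderiv]
          module
        have hα : α = 0 := by
          by_contra hα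
          refine hran ((-(α * D'))⁻¹ • (g - α • G')) ?_
          rw [map_smul, h3, smul_smul, inv_mul_cancel₀ (by simp [hα, hD']), one_smul]
        rw [hα, zero_smul, map_zero] at hg
        obtain ⟨β, rfl⟩ := hker g hg
        exact Submodule.mem_span_singleton.2 ⟨β, by rw [map_smul]⟩
      · intro hv
        refine ⟨0, (ih 0).2 (Submodule.zero_mem _), ?_⟩
        simpa [h.mem_genKer_one] using (h1 v).2 hv
  refine ⟨?_, one_pos, Submodule.span ℂ {S (G z₀)}, ?_, finrank_span_singleton hSG⟩
  · have hne : ∀ᶠ z in 𝓝[≠] z₀, D z ≠ 0 := hD.eventually_ne hD'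
    rw [eventually_nhdsWithin_iff] at hne
    obtain ⟨r, hr, hball⟩ := Metric.eventually_nhds_iff_ball.1 (hne.and hU)
    refine ⟨r, hr, Set.eq_singleton_iff_unique_mem.2
      ⟨⟨h.mem_spectrum hG0 hPG, Metric.mem_ball_self hr⟩, ?_⟩⟩
    rintro z ⟨hz, hzr⟩
    by_contra hzz
    exact hz (h.mem_resolventSet ((hball z hzr).2 ((hball z hzr).1 hzz)))
  · ext v
    simp only [SetLike.mem_coe, mem_iUnion]
    constructor
    · intro hv
      exact ⟨1, (hn 0 v).2 hv⟩
    · rintro ⟨n, hv⟩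
      cases n with
      | zero =>
        have : v = 0 := by simpa [genKer] using hv
        rw [this]; exact Submodule.zero_mem _
      | succ n => exact (hn n v).1 hv

/-- An isolated eigenvalue `0` with a Jordan chain of length exactly two. -/
lemma hasAlgMultiplicity_two (h : IsEncodedBy A S T K) {g₀ g₁ : E}
    (hiso : ∀ᶠ z in 𝓝[≠] (0 : ℂ), IsUnit (K - z • (T * S))) (hg₀ : g₀ ≠ 0) (h₀ : K g₀ = 0)
    (h₁ : K g₁ = T (S g₀)) (hker : ∀ g, K g = 0 → ∃ α : ℂ, g = α • g₀)
    (hran : ∀ g (α β : ℂ), K g = T (S (α • g₁ + β • g₀)) → α = 0) :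
    HasAlgMultiplicity A 0 2 := by
  have hT := isUnit_bijective h.isUnit
  have key0 : ∀ n v, v ∈ genKer A 0 (n + 1) ↔ ∃ u ∈ genKer A 0 n, ∃ g, v = S g ∧ K g = T u := by
    intro n v; simpa using h.mem_genKer_succ 0 n v
  have h1 : ∀ v, v ∈ genKer A 0 1 ↔ ∃ α : ℂ, v = S (α • g₀) := by
    intro v
    rw [key0]
    constructor
    · rintro ⟨u, hu, g, rfl, hg⟩
      have : u = 0 := by simpa [genKer] using hu
      rw [this, map_zero] at hg
      obtain ⟨α, rfl⟩ := hker g hg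
      exact ⟨α, rfl⟩
    · rintro ⟨α, rfl⟩
      exact ⟨0, by simp [genKer], α • g₀, rfl, by simp [h₀]⟩
  have h2 : ∀ v, v ∈ genKer A 0 2 ↔ ∃ α β : ℂ, v = S (α • g₁ + β • g₀) := by
    intro v
    rw [key0]
    constructor
    · rintro ⟨u, hu, g, rfl, hg⟩
      obtain ⟨α, rfl⟩ := (h1 u).1 hu
      obtain ⟨β, hβ⟩ := hker (g - α • g₁) (by simp [hg, h₁])
      exact ⟨α, β, by rw [← hβ]; congr 1; abel⟩
    · rintro ⟨α, β, rfl⟩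
      exact ⟨S (α • g₀), (h1 _).2 ⟨α, rfl⟩, _, rfl, by simp [h₀, h₁]⟩
  have hn : ∀ n v, v ∈ genKer A 0 (n + 2) ↔ ∃ α β : ℂ, v = S (α • g₁ + β • g₀) := by
    intro n
    induction n with
    | zero => exact h2
    | succ n ih =>
      intro v
      rw [key0]
      constructor
      · rintro ⟨u, hu, g, rfl, hg⟩
        obtain ⟨α, β, rfl⟩ := (ih u).1 hu
        have hα := hran g α β hg
        refine (h2 _).1 ((key0 1 _).2 ⟨S (β • g₀), (h1 _).2 ⟨β, rfl⟩, g, rfl, ?_⟩)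
        rw [hg, hα, zero_smul, zero_add]
      · rintro ⟨α, β, rfl⟩
        exact ⟨S (α • g₀), (ih _).2 ⟨0, α, by simp⟩, _, rfl, by simp [h₀, h₁]⟩
  have hli : LinearIndependent ℂ ![S g₁, S g₀] := by
    rw [LinearIndependent.pair_iff]
    intro α β hαβ
    have h3 : α • g₁ + β • g₀ = 0 := h.injective (by simpa using hαβ)
    have h4 : α = 0 := by
      have := congrArg K h3
      simp only [map_add, map_smul, h₁, h₀, smul_zero, add_zero, map_zero] at this
      rcases smul_eq_zero.1 this with h5 | h5
      · exact h5
      · exact absurd (h.injective (hT.1 (by simpa using h5) : S g₀ = S 0)) hg₀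
    rw [h4, zero_smul, zero_add] at h3
    exact ⟨h4, (smul_eq_zero.1 h3).resolve_right hg₀⟩
  refine ⟨?_, two_pos, Submodule.span ℂ (Set.range ![S g₁, S g₀]), ?_, ?_⟩
  · rw [eventually_nhdsWithin_iff] at hiso
    obtain ⟨r, hr, hball⟩ := Metric.eventually_nhds_iff_ball.1 hiso
    refine ⟨r, hr, Set.eq_singleton_iff_unique_mem.2
      ⟨⟨h.mem_spectrum hg₀ (by simpa using h₀), Metric.mem_ball_self hr⟩, ?_⟩⟩
    rintro z ⟨hz, hzr⟩
    by_contra hzz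
    exact hz (h.mem_resolventSet (hball z hzr hzz))
  · have hspan : ∀ v, v ∈ Submodule.span ℂ (Set.range ![S g₁, S g₀]) ↔
        ∃ α β : ℂ, v = S (α • g₁ + β • g₀) := by
      intro v
      rw [Matrix.range_cons, Matrix.range_cons, Matrix.range_empty, union_empty,
        Set.singleton_union, Submodule.mem_span_pair]
      simp only [map_add, map_smul, eq_comm]
    ext v
    simp only [SetLike.mem_coe, mem_iUnion]
    rw [hspan]
    constructor
    · intro hv
      exact ⟨2, (hn 0 v).2 hv⟩
    · rintro ⟨n, hv⟩
      match n, hv with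
      | 0, hv =>
        have : v = 0 := by simpa [genKer] using hv
        exact ⟨0, 0, by simp [this]⟩
      | 1, hv =>
        obtain ⟨α, rfl⟩ := (h1 v).1 hv
        exact ⟨0, α, by simp⟩
      | n + 2, hv => exact (hn n v).1 hv
  · rw [finrank_span_eq_card hli]; rfl

end IsEncodedBy

end Pencil

end

section

/-! ### Splitting of a double eigenvalue -/

section Bifurcation

variable {E : Type*} [NormedAddCommGroup E] [NormedSpace ℂ E]

/-- The data of a pencil `P₀ - z N - ε M` whose value at `z = ε = 0` is a Fredholm operator with
one-dimensional kernel spanned by `g₀` and range the kernel of the functional `l₀`, and has a Jordan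
chain `g₀, g₁` with respect to `N`, together with a Jordan chain `l₀, l₁` of the transposed
pencil. -/
structure BifurcationData (E : Type*) [NormedAddCommGroup E] [NormedSpace ℂ E] where
  P₀ : E →L[ℂ] E
  N : E →L[ℂ] E
  M : E →L[ℂ] E
  g₀ : E
  g₁ : E
  l₀ : E →L[ℂ] ℂ
  l₁ : E →L[ℂ] ℂ
  map_g₀ : P₀ g₀ = 0
  map_g₁ : P₀ g₁ = N g₀
  ker : ∀ g, P₀ g = 0 → ∃ α : ℂ, g = α • g₀
  range : ∀ f, l₀ f = 0 → ∃ g, P₀ g = f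
  l₀_map : ∀ g, l₀ (P₀ g) = 0
  l₁_map : ∀ g, l₁ (P₀ g) = l₀ (N g)
  l₀_g₀ : l₀ g₀ = 1

namespace BifurcationData

variable (d : BifurcationData E)

/-- The pencil. -/
def P (z ε : ℂ) : E →L[ℂ] E := d.P₀ - ε • d.M - z • d.N

/-- The pencil bordered by the rank one operator `l₀ ⊗ g₀`, which is invertible near the origin. -/
def Q (z ε : ℂ) : E →L[ℂ] E := d.P z ε + d.l₀.smulRight d.g₀

/-- The solution `G` of `Q G = g₀`. -/
def G (z ε : ℂ) : E := Ring.inverse (d.Q z ε) d.g₀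

/-- The scalar function (a regularized determinant) whose zeros are those of the pencil. -/
def D (z ε : ℂ) : ℂ := 1 - d.l₀ (d.G z ε)

/-- A function with the same zeros as `D`, written by means of the Jordan chain of functionals. -/
def H (z ε : ℂ) : ℂ :=
  -(ε * d.l₀ (d.M (d.G z ε))) - z ^ 2 * d.l₁ (d.N (d.G z ε)) - z * ε * d.l₁ (d.M (d.G z ε))

/-- `H` in the scaled variables `z = η ζ`, `ε = η²`, divided by `η²`. -/
def F (q : ℂ × ℂ) : ℂ :=
  -(d.l₀ (d.M (d.G (q.1 * q.2) (q.1 ^ 2)))) - q.2 ^ 2 * d.l₁ (d.N (d.G (q.1 * q.2) (q.1 ^ 2)))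
    - q.1 * q.2 * d.l₁ (d.M (d.G (q.1 * q.2) (q.1 ^ 2)))

lemma H_eq_F (η ζ : ℂ) : d.H (η * ζ) (η ^ 2) = η ^ 2 * d.F (η, ζ) := by
  simp only [H, F]; ring

lemma Q_apply (z ε : ℂ) (g : E) : d.Q z ε g = d.P z ε g + d.l₀ g • d.g₀ := by
  simp [Q]

lemma P_apply (z ε : ℂ) (g : E) : d.P z ε g = d.P₀ g - ε • d.M g - z • d.N g := by
  simp [P]

lemma g₀_ne_zero : d.g₀ ≠ 0 := fun h => by
  have := d.l₀_g₀
  rw [h, map_zero] at this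
  exact zero_ne_one this

lemma isUnit_Q_zero [CompleteSpace E] : IsUnit (d.Q 0 0) := by
  have hQ : ∀ g, d.Q 0 0 g = d.P₀ g + d.l₀ g • d.g₀ := fun g => by simp [Q_apply, P_apply]
  rw [ContinuousLinearMap.isUnit_iff_bijective]
  constructor
  · rw [injective_iff_map_eq_zero]
    intro g hg
    rw [hQ] at hg
    have h1 : d.l₀ g = 0 := by
      have := congrArg d.l₀ hg
      simpa [d.l₀_map, d.l₀_g₀] using this
    rw [h1, zero_smul, add_zero] at hg
    obtain ⟨α, rfl⟩ := d.ker g hg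
    have h2 : α = 0 := by simpa [d.l₀_g₀] using h1
    rw [h2, zero_smul]
  · intro f
    obtain ⟨g, hg⟩ := d.range (f - d.l₀ f • d.g₀) (by simp [d.l₀_g₀])
    refine ⟨g - d.l₀ g • d.g₀ + d.l₀ f • d.g₀, ?_⟩
    rw [hQ]
    simp [d.map_g₀, hg, d.l₀_g₀]

section Unit

variable {d} {z ε : ℂ}

lemma Q_G (hQ : IsUnit (d.Q z ε)) : d.Q z ε (d.G z ε) = d.g₀ := by
  rw [G, ← mul_apply_eq_comp, Ring.mul_inverse_cancel _ hQ, one_apply_eq_self]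

lemma Q_eq_iff (hQ : IsUnit (d.Q z ε)) {g : E} {α : ℂ} :
    d.Q z ε g = α • d.g₀ ↔ g = α • d.G z ε := by
  constructor
  · intro h
    exact (IsEncodedBy.isUnit_bijective hQ).1 (by rw [h, map_smul, Q_G hQ])
  · rintro rfl
    rw [map_smul, Q_G hQ]

lemma P_G (hQ : IsUnit (d.Q z ε)) : d.P z ε (d.G z ε) = d.D z ε • d.g₀ := by
  have h := Q_G hQ
  rw [Q_apply] at h
  rw [D, sub_smul, one_smul]
  exact eq_sub_of_add_eq h

lemma G_ne_zero (hQ : IsUnit (d.Q z ε)) : d.G z ε ≠ 0 := fun h => by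
  have := Q_G hQ
  rw [h, map_zero] at this
  exact d.g₀_ne_zero this.symm

lemma exists_eq_smul_G (hQ : IsUnit (d.Q z ε)) {g : E} (hg : d.P z ε g = 0) :
    ∃ α : ℂ, g = α • d.G z ε :=
  ⟨d.l₀ g, (Q_eq_iff hQ).1 (by rw [Q_apply, hg, zero_add])⟩

lemma P_apply_ne (hQ : IsUnit (d.Q z ε)) (hD : d.D z ε = 0) (g : E) : d.P z ε g ≠ d.g₀ := by
  intro hg
  have h1 : d.Q z ε g = (1 + d.l₀ g) • d.g₀ := by rw [Q_apply, hg, add_smul, one_smul]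
  have h2 := congrArg d.l₀ ((Q_eq_iff hQ).1 h1)
  have h3 : d.l₀ (d.G z ε) = 1 := by rw [D, sub_eq_zero] at hD; exact hD.symm
  rw [map_smul, h3, smul_eq_mul, mul_one] at h2
  exact one_ne_zero (by linear_combination -h2 : (1 : ℂ) = 0)

lemma isUnit_P [CompleteSpace E] (hQ : IsUnit (d.Q z ε)) (hD : d.D z ε ≠ 0) :
    IsUnit (d.P z ε) := by
  rw [ContinuousLinearMap.isUnit_iff_bijective]
  constructor
  · rw [injective_iff_map_eq_zero]
    intro g hg
    obtain ⟨α, rfl⟩ := exists_eq_smul_G hQ hg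
    rw [map_smul, P_G hQ, smul_smul] at hg
    have : α = 0 := by simpa [hD, d.g₀_ne_zero] using hg
    rw [this, zero_smul]
  · intro f
    obtain ⟨g, hg⟩ := (IsEncodedBy.isUnit_bijective hQ).2 f
    refine ⟨g + (d.l₀ g * (d.D z ε)⁻¹) • d.G z ε, ?_⟩
    rw [map_add, map_smul, P_G hQ, smul_smul, mul_assoc, inv_mul_cancel₀ hD, mul_one, ← hg,
      Q_apply]

/-- Applying `l₀ + z l₁` to `P G = D g₀` gives a formula for `D` without its terms of lowest
order. -/
lemma D_mul (hQ : IsUnit (d.Q z ε)) : d.D z ε * (1 + z * d.l₁ d.g₀) = d.H z ε := by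
  have h0 := congrArg d.l₀ (P_G hQ)
  have h1 := congrArg d.l₁ (P_G hQ)
  simp only [P_apply, map_sub, map_smul, smul_eq_mul, d.l₀_map, d.l₁_map, d.l₀_g₀] at h0 h1
  rw [H]
  linear_combination -h0 - z * h1

end Unit

lemma contDiff_Q : ContDiff ℂ ω fun q : ℂ × ℂ => d.Q q.1 q.2 := by
  unfold Q P
  fun_prop

lemma contDiffAt_G [CompleteSpace E] {q : ℂ × ℂ} (hQ : IsUnit (d.Q q.1 q.2)) :
    ContDiffAt ℂ ω (fun q : ℂ × ℂ => d.G q.1 q.2) q := by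
  have h1 : ContDiffAt ℂ ω (fun q : ℂ × ℂ => Ring.inverse (d.Q q.1 q.2)) q := by
    obtain ⟨u, hu⟩ := hQ
    have h2 := contDiffAt_ringInverse ℂ (n := ω) u
    rw [hu] at h2
    exact ContDiffAt.comp q h2 d.contDiff_Q.contDiffAt
  exact h1.clm_apply contDiffAt_const

lemma eventually_isUnit_Q [CompleteSpace E] {q : ℂ × ℂ} (hQ : IsUnit (d.Q q.1 q.2)) :
    ∀ᶠ q' in 𝓝 q, IsUnit (d.Q q'.1 q'.2) :=
  d.contDiff_Q.continuous.continuousAt.eventually (Units.isOpen.mem_nhds hQ)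

lemma G_zero [CompleteSpace E] : d.G 0 0 = d.g₀ := by
  have := (Q_eq_iff d.isUnit_Q_zero (g := d.g₀) (α := 1)).1
    (by simp [Q_apply, P_apply, d.map_g₀, d.l₀_g₀])
  rw [one_smul] at this
  exact this.symm

lemma contDiffAt_G_scaled [CompleteSpace E] {q : ℂ × ℂ}
    (hQ : IsUnit (d.Q (q.1 * q.2) (q.1 ^ 2))) :
    ContDiffAt ℂ ω (fun q : ℂ × ℂ => d.G (q.1 * q.2) (q.1 ^ 2)) q :=
  ContDiffAt.comp (g := fun q : ℂ × ℂ => d.G q.1 q.2) (f := fun q : ℂ × ℂ => (q.1 * q.2, q.1 ^ 2))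
    q (d.contDiffAt_G (q := (q.1 * q.2, q.1 ^ 2)) hQ) (by fun_prop)

lemma contDiffAt_F [CompleteSpace E] {q : ℂ × ℂ} (hQ : IsUnit (d.Q (q.1 * q.2) (q.1 ^ 2))) :
    ContDiffAt ℂ ω d.F q := by
  have h := d.contDiffAt_G_scaled hQ
  unfold F
  fun_prop

/-- The derivative of `G` in direction `z` at the origin. -/
lemma hasDerivAt_G_scaled [CompleteSpace E] (ζ : ℂ) :
    HasDerivAt (fun η : ℂ => d.G (η * ζ) (η ^ 2)) (ζ • (d.g₁ - d.l₀ d.g₁ • d.g₀)) 0 := by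
  have hQ : IsUnit (d.Q (0 * ζ) (0 ^ 2)) := by simpa using d.isUnit_Q_zero
  have hdiff : DifferentiableAt ℂ (fun η : ℂ => d.G (η * ζ) (η ^ 2)) 0 := by
    have h1 : ContDiffAt ℂ ω (fun η : ℂ => d.G (η * ζ) (η ^ 2)) 0 :=
      ContDiffAt.comp (g := fun q : ℂ × ℂ => d.G q.1 q.2) (f := fun η : ℂ => (η * ζ, η ^ 2))
        0 (d.contDiffAt_G (q := (0 * ζ, 0 ^ 2)) hQ) (by fun_prop)
    exact h1.differentiableAt (by simp)
  have hev : ∀ᶠ η in 𝓝 (0 : ℂ), IsUnit (d.Q (η * ζ) (η ^ 2)) := by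
    have hc : ContinuousAt (fun η : ℂ => (η * ζ, η ^ 2)) 0 := by fun_prop
    exact hc.eventually (d.eventually_isUnit_Q (q := (0 * ζ, 0 ^ 2)) hQ)
  have hQ' : HasDerivAt (fun η : ℂ => d.Q (η * ζ) (η ^ 2)) (-(ζ • d.N)) 0 := by
    have h1 : HasDerivAt (fun η : ℂ => η * ζ) ζ 0 := by
      simpa using (hasDerivAt_id (0 : ℂ)).mul_const ζ
    have h2 : HasDerivAt (fun η : ℂ => η ^ 2) 0 0 := by
      simpa using hasDerivAt_pow 2 (0 : ℂ)
    have h3 := (((h2.smul_const d.M).const_sub d.P₀).sub (h1.smul_const d.N)).add_const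
      (d.l₀.smulRight d.g₀)
    have h4 : (-((0 : ℂ) • d.M)) - ζ • d.N = -(ζ • d.N) := by simp
    rw [← h4]
    exact h3
  have h5 := hQ'.clm_apply hdiff.hasDerivAt
  have h6 : HasDerivAt (fun η : ℂ => d.Q (η * ζ) (η ^ 2) (d.G (η * ζ) (η ^ 2))) 0 0 :=
    (hasDerivAt_const (0 : ℂ) d.g₀).congr_of_eventuallyEq (hev.mono fun η hη => Q_G hη)
  have h7 := h5.unique h6
  set G' := deriv (fun η : ℂ => d.G (η * ζ) (η ^ 2)) 0
  have h8 : G' = ζ • (d.g₁ - d.l₀ d.g₁ • d.g₀) := by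
    refine (IsEncodedBy.isUnit_bijective d.isUnit_Q_zero).1 ?_
    have h9 : d.Q 0 0 G' = ζ • d.N d.g₀ := by
      simp only [zero_mul, ne_eq, OfNat.ofNat_ne_zero, not_false_eq_true, zero_pow, d.G_zero,
        neg_apply, smul_apply] at h7
      rw [neg_add_eq_zero] at h7
      exact h7.symm
    rw [h9, map_smul, Q_apply]
    congr 1
    simp [P_apply, d.map_g₁, d.map_g₀, d.l₀_g₀]
  rw [← h8]
  exact hdiff.hasDerivAt

end BifurcationData

end Bifurcation

end

section

section Branches

open scoped ComplexConjugate

variable {E : Type*} [NormedAddCommGroup E] [NormedSpace ℂ E]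

namespace BifurcationData

variable (d : BifurcationData E)

lemma F_zero_left [CompleteSpace E] (ζ : ℂ) :
    d.F (0, ζ) = -d.l₀ (d.M d.g₀) - ζ ^ 2 * d.l₁ (d.N d.g₀) := by
  simp [F, d.G_zero]

lemma hasDerivAt_F_right [CompleteSpace E] (ζ : ℂ) :
    HasDerivAt (fun ζ => d.F (0, ζ)) (-(2 * ζ * d.l₁ (d.N d.g₀))) ζ := by
  simp only [F_zero_left]
  have h := ((hasDerivAt_pow 2 ζ).mul_const (d.l₁ (d.N d.g₀))).const_sub (-d.l₀ (d.M d.g₀))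
  simpa using h

lemma hasDerivAt_F_left [CompleteSpace E] (ζ : ℂ) :
    HasDerivAt (fun η => d.F (η, ζ))
      (-(ζ * (d.l₀ (d.M (d.g₁ - d.l₀ d.g₁ • d.g₀)) + d.l₁ (d.M d.g₀)
        + ζ ^ 2 * d.l₁ (d.N (d.g₁ - d.l₀ d.g₁ • d.g₀))))) 0 := by
  have hG := d.hasDerivAt_G_scaled ζ
  have hlin : ∀ l : E →L[ℂ] ℂ, HasDerivAt (fun η : ℂ => l (d.G (η * ζ) (η ^ 2)))
      (l (ζ • (d.g₁ - d.l₀ d.g₁ • d.g₀))) 0 := fun l => l.hasFDerivAt.comp_hasDerivAt 0 hG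
  have h1 := hlin (d.l₀ ∘L d.M)
  have h2 := hlin (d.l₁ ∘L d.N)
  have h3 := hlin (d.l₁ ∘L d.M)
  have h4 : HasDerivAt (fun η : ℂ => η * ζ) ζ 0 := by
    simpa using (hasDerivAt_id (0 : ℂ)).mul_const ζ
  have h5 := (h1.neg.sub (h2.const_mul (ζ ^ 2))).sub (h4.mul h3)
  refine h5.congr_deriv ?_
  simp [d.G_zero]
  ring

variable {A : E → E → Prop} {S T : E →L[ℂ] E} {ε : ℂ}

/-- A simple zero of `H` is a simple eigenvalue. -/
lemma isSimpleEigenvalue [CompleteSpace E] (hA : IsEncodedBy A S T (d.P₀ - ε • d.M))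
    (hN : d.N = T * S) {z₀ H' : ℂ} (hQ : IsUnit (d.Q z₀ ε)) (h1 : 1 + z₀ * d.l₁ d.g₀ ≠ 0)
    (hH : d.H z₀ ε = 0) (hH' : HasDerivAt (fun z => d.H z ε) H' z₀) (hne : H' ≠ 0) :
    IsSimpleEigenvalue A z₀ := by
  have hP : ∀ z, d.P₀ - ε • d.M - z • (T * S) = d.P z ε := fun z => by rw [P, hN]
  have hc : ContinuousAt (fun z : ℂ => (z, ε)) z₀ := by fun_prop
  have hQev : ∀ᶠ z in 𝓝 z₀, IsUnit (d.Q z ε) :=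
    hc.eventually (d.eventually_isUnit_Q (q := (z₀, ε)) hQ)
  have hne1 : ∀ᶠ z in 𝓝 z₀, 1 + z * d.l₁ d.g₀ ≠ 0 := by
    have : ContinuousAt (fun z : ℂ => 1 + z * d.l₁ d.g₀) z₀ := by fun_prop
    exact this.eventually_ne h1
  have hD0 : d.D z₀ ε = 0 := by
    have := D_mul hQ
    rw [hH] at this
    exact (mul_eq_zero.1 this).resolve_right h1
  have hGdiff : DifferentiableAt ℂ (fun z => d.G z ε) z₀ := by
    have h2 : ContDiffAt ℂ ω (fun z => d.G z ε) z₀ :=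
      ContDiffAt.comp (g := fun q : ℂ × ℂ => d.G q.1 q.2) (f := fun z : ℂ => (z, ε))
        z₀ (d.contDiffAt_G (q := (z₀, ε)) hQ) (by fun_prop)
    exact h2.differentiableAt (by simp)
  have hG' : DifferentiableAt ℂ (fun z => (1 + z * d.l₁ d.g₀) • d.G z ε) z₀ := by fun_prop
  refine hA.isSimpleEigenvalue (G := fun z => (1 + z * d.l₁ d.g₀) • d.G z ε)
    (D := fun z => d.H z ε) (g₀ := d.g₀) ?_ ?_ hG'.hasDerivAt hH' hne hH ?_ ?_ ?_
  · filter_upwards [hQev] with z hz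
    rw [hP, map_smul, P_G hz, smul_smul, ← D_mul hz, mul_comm]
  · filter_upwards [hQev] with z hz hHz
    rw [hP]
    refine isUnit_P hz fun h0 => hHz ?_
    rw [← D_mul hz, h0, zero_mul]
  · exact smul_ne_zero h1 (G_ne_zero hQ)
  · intro g hg
    rw [hP] at hg
    obtain ⟨α, rfl⟩ := exists_eq_smul_G hQ hg
    exact ⟨α * (1 + z₀ * d.l₁ d.g₀)⁻¹, by rw [smul_smul, mul_assoc, inv_mul_cancel₀ h1, mul_one]⟩
  · intro g
    rw [hP]
    exact P_apply_ne hQ hD0 g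

/-- The data are real with respect to the antilinear map `C`. -/
structure IsReal (d : BifurcationData E) (C : E →ₛₗ[starRingEnd ℂ] E) : Prop where
  map_P₀ : ∀ g, d.P₀ (C g) = C (d.P₀ g)
  map_N : ∀ g, d.N (C g) = C (d.N g)
  map_M : ∀ g, d.M (C g) = C (d.M g)
  map_l₀ : ∀ g, d.l₀ (C g) = conj (d.l₀ g)
  map_l₁ : ∀ g, d.l₁ (C g) = conj (d.l₁ g)
  map_g₀ : C d.g₀ = d.g₀

variable {d} in
lemma IsReal.H_conj {C : E →ₛₗ[starRingEnd ℂ] E} (hC : d.IsReal C) {z ε : ℂ}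
    (hε : conj ε = ε) (hQ : IsUnit (d.Q z ε)) (hQ' : IsUnit (d.Q (conj z) ε)) :
    d.H (conj z) ε = conj (d.H z ε) := by
  have hG : d.G (conj z) ε = C (d.G z ε) := by
    have h := (Q_eq_iff hQ' (g := C (d.G z ε)) (α := 1)).1
    rw [one_smul, one_smul] at h
    refine (h ?_).symm
    conv_rhs => rw [← hC.map_g₀, ← Q_G hQ]
    simp only [Q_apply, P_apply, map_add, map_sub, map_smulₛₗ, hC.map_P₀, hC.map_N, hC.map_M,
      hC.map_l₀, hC.map_g₀, hε]
  simp only [H, hG, hC.map_N, hC.map_M, hC.map_l₀, hC.map_l₁, map_sub, map_mul, map_neg, map_pow,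
    hε]

/-- The eigenvalue `0` is isolated because `H (z, 0)` is `-z²` times a function with a nonzero limit
at `0`. -/
lemma hasAlgMultiplicity_two [CompleteSpace E] (hA : IsEncodedBy A S T d.P₀) (hN : d.N = T * S)
    (hB₀' : d.l₁ (d.N d.g₀) ≠ 0) : HasAlgMultiplicity A 0 2 := by
  have hl₀Ng₁ : d.l₀ (d.N d.g₁) = d.l₁ (d.N d.g₀) := by rw [← d.l₁_map, d.map_g₁]
  have hl₀Ng₀ : d.l₀ (d.N d.g₀) = 0 := by rw [← d.map_g₁, d.l₀_map]
  refine hA.hasAlgMultiplicity_two (g₁ := d.g₁) ?_ d.g₀_ne_zero d.map_g₀ ?_ d.ker ?_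
  · have hP : ∀ z, d.P₀ - z • (T * S) = d.P z 0 := fun z => by rw [P, hN, zero_smul, sub_zero]
    have hc : ContinuousAt (fun z : ℂ => (z, (0 : ℂ))) 0 := by fun_prop
    have hQev : ∀ᶠ z in 𝓝 (0 : ℂ), IsUnit (d.Q z 0) :=
      hc.eventually (d.eventually_isUnit_Q (q := (0, 0)) d.isUnit_Q_zero)
    have hGc : ContinuousAt (fun z : ℂ => d.l₁ (d.N (d.G z 0))) 0 := by
      have h1 : ContinuousAt (fun q : ℂ × ℂ => d.G q.1 q.2) (0, 0) :=
        (d.contDiffAt_G (q := (0, 0)) d.isUnit_Q_zero).continuousAt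
      have h2 := ContinuousAt.comp (g := fun q : ℂ × ℂ => d.G q.1 q.2)
        (f := fun z : ℂ => (z, (0 : ℂ))) (x := (0 : ℂ)) h1 hc
      exact (d.l₁ ∘L d.N).continuous.continuousAt.comp h2
    have hne : ∀ᶠ z in 𝓝 (0 : ℂ), d.l₁ (d.N (d.G z 0)) ≠ 0 :=
      hGc.eventually_ne (by rw [d.G_zero]; exact hB₀')
    filter_upwards [hQev.filter_mono nhdsWithin_le_nhds, hne.filter_mono nhdsWithin_le_nhds,
      self_mem_nhdsWithin] with z hz hz' hz0
    rw [hP]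
    refine isUnit_P hz fun h0 => ?_
    have h3 := D_mul hz
    rw [h0, zero_mul, H] at h3
    have h4 : z ^ 2 * d.l₁ (d.N (d.G z 0)) = 0 := by linear_combination h3
    rcases mul_eq_zero.1 h4 with h5 | h5
    · exact hz0 (pow_eq_zero_iff two_ne_zero |>.1 h5)
    · exact hz' h5
  · rw [d.map_g₁, hN, mul_apply_eq_comp]
  · intro g α β hg
    have h1 := congrArg d.l₀ hg
    rw [← mul_apply_eq_comp, ← hN, d.l₀_map, map_add, map_smul, map_smul, map_add, map_smul,
      map_smul, hl₀Ng₁, hl₀Ng₀] at h1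
    simpa [hB₀'] using h1.symm

/-- The implicit function theorem for `F` at `η = 0`, `ζ = i μ`. -/
lemma exists_implicit_function [CompleteSpace E] {A₀ B₀ A₁ B₁ μ : ℝ} (hA₀ : d.l₀ (d.M d.g₀) = A₀)
    (hB₀ : d.l₁ (d.N d.g₀) = B₀) (hA₁ : d.l₀ (d.M d.g₁) + d.l₁ (d.M d.g₀) = A₁)
    (hB₁ : d.l₁ (d.N d.g₁) = B₁) (B₀_pos : 0 < B₀) (hμ_pos : 0 < μ) (hμ_sq : μ ^ 2 * B₀ = A₀) :
    ∃ ψ : ℂ → ℂ, ψ 0 = μ * Complex.I ∧ (∀ᶠ η in 𝓝 (0 : ℂ), d.F (η, ψ η) = 0) ∧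
      ContDiffAt ℂ ω ψ 0 ∧ HasDerivAt ψ (-((A₁ - μ ^ 2 * B₁) / (2 * B₀))) 0 ∧
      ContDiffAt ℂ ω d.F (0, ψ 0) ∧ fderiv ℂ d.F (0, ψ 0) (0, 1) ≠ 0 := by
  have hB₀' : (B₀ : ℂ) ≠ 0 := by exact_mod_cast B₀_pos.ne'
  have hμ_sq' : (μ : ℂ) ^ 2 * B₀ = A₀ := by exact_mod_cast hμ_sq
  set ζ₀ : ℂ := μ * Complex.I with hζ₀
  have hζ₀_sq : ζ₀ ^ 2 = -(μ : ℂ) ^ 2 := by rw [hζ₀, mul_pow, Complex.I_sq]; ring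
  have hQ0 : IsUnit (d.Q (0 * ζ₀) (0 ^ 2)) := by simpa using d.isUnit_Q_zero
  have cdf : ContDiffAt ℂ ω d.F (0, ζ₀) := d.contDiffAt_F (q := (0, ζ₀)) hQ0
  have hdF : HasFDerivAt d.F (fderiv ℂ d.F (0, ζ₀)) (0, ζ₀) :=
    (cdf.differentiableAt (by simp)).hasFDerivAt
  have hF0 : d.F (0, ζ₀) = 0 := by
    rw [F_zero_left, hA₀, hB₀, hζ₀_sq]; linear_combination hμ_sq'
  have hFζ : fderiv ℂ d.F (0, ζ₀) (0, 1) = -(2 * ζ₀ * B₀) := by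
    have h1 : HasDerivAt (fun ζ : ℂ => ((0 : ℂ), ζ)) ((0 : ℂ), (1 : ℂ)) ζ₀ :=
      (hasDerivAt_const ζ₀ (0 : ℂ)).prodMk (hasDerivAt_id ζ₀)
    have h2 := HasFDerivAt.comp_hasDerivAt ζ₀ hdF h1
    rw [← hB₀]
    exact h2.unique (d.hasDerivAt_F_right ζ₀)
  have hFη : fderiv ℂ d.F (0, ζ₀) (1, 0) = -(ζ₀ * (A₁ - μ ^ 2 * B₁)) := by
    have h1 : HasDerivAt (fun η : ℂ => (η, ζ₀)) ((1 : ℂ), (0 : ℂ)) 0 :=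
      (hasDerivAt_id (0 : ℂ)).prodMk (hasDerivAt_const 0 ζ₀)
    have h2 := HasFDerivAt.comp_hasDerivAt (0 : ℂ) hdF h1
    rw [h2.unique (d.hasDerivAt_F_left ζ₀)]
    simp only [map_sub, map_smul, smul_eq_mul, hA₀, hB₀, hB₁, hζ₀_sq]
    linear_combination -ζ₀ * hA₁ - ζ₀ * d.l₀ d.g₁ * hμ_sq'
  have hζ₀_ne : ζ₀ ≠ 0 := by
    rw [hζ₀]; exact mul_ne_zero (by exact_mod_cast hμ_pos.ne') Complex.I_ne_zero
  have hFζ_ne : fderiv ℂ d.F (0, ζ₀) (0, 1) ≠ 0 := by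
    rw [hFζ]; exact neg_ne_zero.2 (mul_ne_zero (mul_ne_zero two_ne_zero hζ₀_ne) hB₀')
  have if₂ : (fderiv ℂ d.F (0, ζ₀) ∘L .inr ℂ ℂ ℂ).IsInvertible := by
    refine ⟨ContinuousLinearEquiv.unitsEquivAut ℂ (Units.mk0 _ hFζ_ne), ?_⟩
    ext
    simp
  set ψ := cdf.implicitFunction (by simp) if₂ with hψ
  have hψ0 : ψ 0 = ζ₀ := cdf.implicitFunction_apply_self (by simp) if₂
  have hψF : ∀ᶠ η in 𝓝 (0 : ℂ), d.F (η, ψ η) = 0 := by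
    have := cdf.eventually_apply_implicitFunction (by simp) if₂
    rwa [hF0] at this
  have hψc : ContDiffAt ℂ ω ψ 0 := cdf.contDiffAt_implicitFunction (by simp) if₂
  have hψ' : HasDerivAt ψ (-((A₁ - μ ^ 2 * B₁) / (2 * B₀))) 0 := by
    have h1 : HasDerivAt ψ (deriv ψ 0) 0 := (hψc.differentiableAt (by simp)).hasDerivAt
    have h2 : HasDerivAt (fun η : ℂ => (η, ψ η)) ((1 : ℂ), deriv ψ 0) 0 :=
      (hasDerivAt_id (0 : ℂ)).prodMk h1
    have h3 := HasFDerivAt.comp_hasDerivAt (0 : ℂ) (f := fun η : ℂ => (η, ψ η))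
      (by rw [hψ0]; exact hdF) h2
    have h4 := h3.unique ((hasDerivAt_const (0 : ℂ) (0 : ℂ)).congr_of_eventuallyEq hψF)
    have h5 : ((1 : ℂ), deriv ψ 0) = (1, 0) + deriv ψ 0 • ((0 : ℂ), (1 : ℂ)) := by simp
    rw [h5, map_add, map_smul, hFη, hFζ, smul_eq_mul] at h4
    have h6 : deriv ψ 0 = -((A₁ - μ ^ 2 * B₁) / (2 * B₀)) := by
      field_simp
      refine mul_left_cancel₀ hζ₀_ne ?_
      linear_combination -h4
    rw [← h6]; exact h1
  refine ⟨ψ, hψ0, hψF, hψc, hψ', ?_, ?_⟩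
  · rw [hψ0]; exact cdf
  · rw [hψ0]; exact hFζ_ne

set_option maxHeartbeats 800000 in
/-- The double eigenvalue splits into two branches `± i μ |η| + β η² + o(η²)` with `β < 0`, where
`μ² = A₀ / B₀` and `2 β = -(A₁ - μ² B₁) / B₀`. They are found by applying the implicit function
theorem to the scaled function `F`, at `η = 0` and `ζ = ± i μ`. -/
theorem exists_branches [CompleteSpace E] {A : ℝ → E → E → Prop} {C : E →ₛₗ[starRingEnd ℂ] E}
    (hA : ∀ η : ℝ, IsEncodedBy (A η) S T (d.P₀ - ((η : ℂ) ^ 2) • d.M)) (hN : d.N = T * S)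
    (hC : d.IsReal C) {A₀ B₀ A₁ B₁ : ℝ} (hA₀ : d.l₀ (d.M d.g₀) = A₀)
    (hB₀ : d.l₁ (d.N d.g₀) = B₀) (hA₁ : d.l₀ (d.M d.g₁) + d.l₁ (d.M d.g₀) = A₁)
    (hB₁ : d.l₁ (d.N d.g₁) = B₁) (A₀_pos : 0 < A₀) (B₀_pos : 0 < B₀)
    (hlt : A₀ * B₁ < A₁ * B₀) :
    HasAlgMultiplicity (A 0) 0 2 ∧
      ∃ η₀ : ℝ, 0 < η₀ ∧ ∃ zp zm : ℝ → ℂ,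
        ContinuousOn zp (Set.Ioo (-η₀) η₀) ∧ ContinuousOn zm (Set.Ioo (-η₀) η₀) ∧
        zp 0 = 0 ∧ zm 0 = 0 ∧
        ∀ η ∈ Set.Ioo (-η₀) η₀, η ≠ 0 →
          IsSimpleEigenvalue (A η) (zp η) ∧ IsSimpleEigenvalue (A η) (zm η) ∧
          (zp η).re = (zm η).re ∧ (zp η).re < 0 ∧
          (zp η).im = -(zm η).im ∧ 0 < (zp η).im := by
  have hB₀' : (B₀ : ℂ) ≠ 0 := by exact_mod_cast B₀_pos.ne'
  constructor
  · have hA0 := hA 0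
    simp only [Complex.ofReal_zero, ne_eq, OfNat.ofNat_ne_zero, not_false_eq_true, zero_pow,
      zero_smul, sub_zero] at hA0
    exact d.hasAlgMultiplicity_two hA0 hN (by rwa [hB₀])
  set μ : ℝ := Real.sqrt (A₀ / B₀) with hμ
  have hμ_pos : 0 < μ := Real.sqrt_pos.2 (div_pos A₀_pos B₀_pos)
  have hμ_sq : μ ^ 2 * B₀ = A₀ := by
    rw [hμ, Real.sq_sqrt (div_pos A₀_pos B₀_pos).le]; field_simp
  obtain ⟨ψ, hψ0, hψF, hψc, hψ', cdf, hFζ_ne⟩ :=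
    d.exists_implicit_function hA₀ hB₀ hA₁ hB₁ B₀_pos hμ_pos hμ_sq
  rw [hψ0] at cdf hFζ_ne
  set ζ₀ : ℂ := μ * Complex.I with hζ₀
  have hQ0 : IsUnit (d.Q (0 * ζ₀) (0 ^ 2)) := by simpa using d.isUnit_Q_zero
  -- points near `(0, ζ₀)`
  have hgood : ∀ᶠ q in 𝓝 ((0 : ℂ), ζ₀), IsUnit (d.Q (q.1 * q.2) (q.1 ^ 2)) ∧
      IsUnit (d.Q (conj (q.1 * q.2)) (q.1 ^ 2)) ∧ 1 + q.1 * q.2 * d.l₁ d.g₀ ≠ 0 ∧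
      1 + conj (q.1 * q.2) * d.l₁ d.g₀ ≠ 0 ∧ fderiv ℂ d.F q (0, 1) ≠ 0 := by
    have h1 : ContinuousAt (fun q : ℂ × ℂ => d.Q (q.1 * q.2) (q.1 ^ 2)) (0, ζ₀) :=
      (d.contDiff_Q.continuous.comp
        (by fun_prop : Continuous fun q : ℂ × ℂ => (q.1 * q.2, q.1 ^ 2))).continuousAt
    have h2 : ContinuousAt (fun q : ℂ × ℂ => d.Q (conj (q.1 * q.2)) (q.1 ^ 2)) (0, ζ₀) :=
      (d.contDiff_Q.continuous.comp ((Complex.continuous_conj.comp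
        (by fun_prop : Continuous fun q : ℂ × ℂ => q.1 * q.2)).prodMk
        (by fun_prop : Continuous fun q : ℂ × ℂ => q.1 ^ 2))).continuousAt
    have h3 : ContinuousAt (fun q : ℂ × ℂ => 1 + q.1 * q.2 * d.l₁ d.g₀) (0, ζ₀) := by fun_prop
    have h4 : ContinuousAt (fun q : ℂ × ℂ => 1 + conj (q.1 * q.2) * d.l₁ d.g₀) (0, ζ₀) :=
      (continuous_const.add ((Complex.continuous_conj.comp
        (by fun_prop : Continuous fun q : ℂ × ℂ => q.1 * q.2)).mul
        continuous_const)).continuousAt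
    have h5 : ContinuousAt (fun q : ℂ × ℂ => fderiv ℂ d.F q (0, 1)) (0, ζ₀) :=
      ((cdf.fderiv_right (m := 0) (by simp)).continuousAt).clm_apply continuousAt_const
    refine (h1.eventually (Units.isOpen.mem_nhds ?_)).and ((h2.eventually
      (Units.isOpen.mem_nhds ?_)).and ((h3.eventually_ne ?_).and ((h4.eventually_ne ?_).and
      (h5.eventually_ne hFζ_ne))))
    · exact hQ0
    · simpa using d.isUnit_Q_zero
    · simp
    · simp
  have hψgood : ∀ᶠ η in 𝓝 (0 : ℂ), IsUnit (d.Q (η * ψ η) (η ^ 2)) ∧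
      IsUnit (d.Q (conj (η * ψ η)) (η ^ 2)) ∧ 1 + η * ψ η * d.l₁ d.g₀ ≠ 0 ∧
      1 + conj (η * ψ η) * d.l₁ d.g₀ ≠ 0 ∧ fderiv ℂ d.F (η, ψ η) (0, 1) ≠ 0 := by
    have hc : ContinuousAt (fun η : ℂ => (η, ψ η)) 0 :=
      continuousAt_id.prodMk hψc.continuousAt
    rw [← hψ0] at hgood
    exact hc.eventually hgood
  have hψcont : ∀ᶠ η in 𝓝 (0 : ℂ), ContinuousAt ψ η :=
    (hψc.eventually (by simp)).mono fun η hη => hη.continuousAt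
  have hre : ∀ᶠ t : ℝ in 𝓝[>] (0 : ℝ), (ψ (t : ℂ)).re < 0 := by
    have h1 : HasDerivAt (fun t : ℝ => (ψ t).re) (-((A₁ - μ ^ 2 * B₁) / (2 * B₀))) 0 := by
      have h2 := (show HasDerivAt ψ (-((A₁ - μ ^ 2 * B₁) / (2 * B₀))) ((0 : ℝ) : ℂ) by
        simpa using hψ').real_of_complex
      refine h2.congr_deriv ?_
      have : (-(((A₁ : ℂ) - μ ^ 2 * B₁) / (2 * B₀))) =
          ((-((A₁ - μ ^ 2 * B₁) / (2 * B₀)) : ℝ) : ℂ) := by push_cast; ring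
      rw [this, Complex.ofReal_re]
    have hneg : -((A₁ - μ ^ 2 * B₁) / (2 * B₀)) < 0 := by
      refine neg_lt_zero.2 (div_pos ?_ (by positivity))
      refine pos_of_mul_pos_left ?_ B₀_pos.le
      calc (0 : ℝ) < A₁ * B₀ - A₀ * B₁ := by linarith
        _ = (A₁ - μ ^ 2 * B₁) * B₀ := by rw [← hμ_sq]; ring
    have h3 := h1.tendsto_slope_zero_right
    have h4 := h3.eventually (gt_mem_nhds hneg)
    filter_upwards [h4, self_mem_nhdsWithin] with t ht ht0
    have h5 : (ψ ((0 : ℝ) : ℂ)).re = 0 := by simp [hψ0, hζ₀]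
    rw [h5, zero_add, sub_zero, smul_eq_mul] at ht
    by_contra h6
    exact absurd ht (not_lt.2 (mul_nonneg (inv_nonneg.2 (le_of_lt ht0)) (not_lt.1 h6)))
  have him : ∀ᶠ η in 𝓝 (0 : ℂ), 0 < (ψ η).im := by
    have hc : ContinuousAt (fun η => (ψ η).im) 0 :=
      Complex.continuous_im.continuousAt.comp hψc.continuousAt
    exact hc.eventually (lt_mem_nhds (by simpa [hψ0, hζ₀] using hμ_pos))
  obtain ⟨r, hr, hball⟩ := Metric.eventually_nhds_iff_ball.1
    (hψF.and (hψgood.and (hψcont.and him)))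
  obtain ⟨r', hr', hIoo⟩ := mem_nhdsGT_iff_exists_Ioo_subset.1 hre
  rw [mem_Ioi] at hr'
  refine ⟨min r r', lt_min hr hr', fun η => (|η| : ℝ) * ψ (|η| : ℝ),
    fun η => conj ((|η| : ℝ) * ψ (|η| : ℝ)), ?_⟩
  have hcont : ContinuousOn (fun η : ℝ => ((|η| : ℝ) : ℂ) * ψ (|η| : ℝ))
      (Set.Ioo (-(min r r')) (min r r')) := by
    intro η hη
    have hη' : |η| < min r r' := abs_lt.2 hη
    have h1 : ContinuousAt ψ (|η| : ℝ) :=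
      (hball (|η| : ℝ) (by simpa using lt_of_lt_of_le hη' (min_le_left _ _))).2.2.1
    have h2 : ContinuousAt (fun η : ℝ => ((|η| : ℝ) : ℂ)) η :=
      (Complex.continuous_ofReal.comp continuous_abs).continuousAt
    exact (h2.mul (ContinuousAt.comp (g := ψ) h1 h2)).continuousWithinAt
  refine ⟨hcont, Complex.continuous_conj.comp_continuousOn hcont, by simp, by simp, ?_⟩
  intro η hη hη0
  have ht_lt : |η| < min r r' := abs_lt.2 hη
  have ht_pos : 0 < |η| := abs_pos.2 hη0
  have hsq : ((η : ℂ)) ^ 2 = ((|η| : ℝ) : ℂ) ^ 2 := by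
    rw [← Complex.ofReal_pow, ← Complex.ofReal_pow, sq_abs]
  have hAη := hA η
  rw [hsq] at hAη
  beta_reduce
  generalize |η| = t at *
  have ht0 : (t : ℂ) ≠ 0 := by exact_mod_cast ht_pos.ne'
  obtain ⟨hFt, hgt, -, himt⟩ := hball (t : ℂ) (by
    simpa [abs_of_pos ht_pos] using lt_of_lt_of_le ht_lt (min_le_left _ _))
  have hret : (ψ t).re < 0 := hIoo ⟨ht_pos, lt_of_lt_of_le ht_lt (min_le_right _ _)⟩
  obtain ⟨hQ1, hQ2, hne1, hne2, hFne⟩ := hgt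
  have hH0 : d.H (t * ψ t) (t ^ 2) = 0 := by rw [H_eq_F, hFt, mul_zero]
  have hHd : HasDerivAt (fun z => d.H z ((t : ℂ) ^ 2)) (t * fderiv ℂ d.F (t, ψ t) (0, 1))
      (t * ψ t) := by
    have h1 : HasFDerivAt d.F (fderiv ℂ d.F (t, ψ t)) (t, ψ t) :=
      ((d.contDiffAt_F (q := (t, ψ t)) hQ1).differentiableAt (by simp)).hasFDerivAt
    have h2 : HasDerivAt (fun z : ℂ => ((t : ℂ), z / t)) ((0 : ℂ), 1 / (t : ℂ)) (t * ψ t) :=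
      (hasDerivAt_const _ _).prodMk ((hasDerivAt_id _).div_const _)
    have h3 := (HasFDerivAt.comp_hasDerivAt (t * ψ t : ℂ) (f := fun z : ℂ => ((t : ℂ), z / t))
      (by rw [mul_div_cancel_left₀ _ ht0]; exact h1) h2).const_mul ((t : ℂ) ^ 2)
    have h4 : ((0 : ℂ), 1 / (t : ℂ)) = (t : ℂ)⁻¹ • ((0 : ℂ), (1 : ℂ)) := by simp
    rw [h4, map_smul, smul_eq_mul, ← mul_assoc, pow_two, mul_assoc (t : ℂ) t,
      mul_inv_cancel₀ ht0, mul_one] at h3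
    refine h3.congr_of_eventuallyEq (Eventually.of_forall fun z => ?_)
    have h5 := d.H_eq_F t (z / t)
    rw [mul_div_cancel₀ _ ht0] at h5
    simp only [h5, Function.comp_apply, ← pow_two]
  have hconj_t : conj ((t : ℂ) ^ 2) = (t : ℂ) ^ 2 := by
    rw [map_pow, Complex.conj_ofReal]
  refine ⟨d.isSimpleEigenvalue hAη hN hQ1 hne1 hH0 hHd (mul_ne_zero ht0 hFne), ?_, ?_⟩
  · have hH0' : d.H (conj (t * ψ t)) (t ^ 2) = 0 := by
      rw [hC.H_conj hconj_t hQ1 hQ2, hH0, map_zero]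
    have hHd' : HasDerivAt (fun z => d.H z ((t : ℂ) ^ 2))
        (conj (t * fderiv ℂ d.F (t, ψ t) (0, 1))) (conj (t * ψ t)) := by
      have h1 := hHd.conj_conj
      refine h1.congr_of_eventuallyEq ?_
      have hc1 : ContinuousAt (fun z : ℂ => (z, (t : ℂ) ^ 2)) (conj (t * ψ t)) := by fun_prop
      have hc2 : ContinuousAt (fun z : ℂ => (conj z, (t : ℂ) ^ 2)) (conj (t * ψ t)) :=
        (Complex.continuous_conj.prodMk continuous_const).continuousAt
      filter_upwards [hc1.eventually (d.eventually_isUnit_Q (q := (_, _)) hQ2),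
        hc2.eventually (d.eventually_isUnit_Q (q := (conj (conj (t * ψ t)), (t : ℂ) ^ 2))
          (by simpa using hQ1))] with z hz1 hz2
      have := hC.H_conj hconj_t hz2 (by simpa using hz1)
      simpa using this
    exact d.isSimpleEigenvalue hAη hN hQ2 hne2 hH0' hHd'
      (by simpa using mul_ne_zero ht0 hFne)
  · simp only [Complex.conj_re, Complex.conj_im, Complex.re_ofReal_mul, Complex.im_ofReal_mul,
      neg_neg, true_and]
    exact ⟨mul_neg_of_pos_of_neg ht_pos hret, mul_pos ht_pos himt⟩

end BifurcationData

end Branches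

end

section

/-! ### Primitives and weak derivatives -/

/-- `F` is a primitive of the locally integrable function `f`: it is locally absolutely continuous
with derivative `f`. -/
structure IsPrimitive (F f : ℝ → ℂ) : Prop where
  intervalIntegrable : ∀ a b, IntervalIntegrable f volume a b
  sub_eq : ∀ a b, F b - F a = ∫ y in a..b, f y

lemma intervalIntegral_absolutelyContinuous {f : ℝ → ℂ} {a b : ℝ}
    (hf : IntervalIntegrable f volume a b) :
    AbsolutelyContinuousOnInterval (fun x => ∫ y in a..x, f y) a b := by
  have hre : IntervalIntegrable (fun x => (f x).re) volume a b :=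
    ⟨hf.1.re, hf.2.re⟩
  have him : IntervalIntegrable (fun x => (f x).im) volume a b :=
    ⟨hf.1.im, hf.2.im⟩
  have h1 := hre.absolutelyContinuousOnInterval_intervalIntegral (c := a) (by simp)
  have h2 := him.absolutelyContinuousOnInterval_intervalIntegral (c := a) (by simp)
  have hc : ∀ z : ℂ, AbsolutelyContinuousOnInterval (fun _ : ℝ => z) a b := fun z =>
    ((LipschitzWith.const z).lipschitzOnWith (s := uIcc a b)).absolutelyContinuousOnInterval
  have h3 := (h1.fun_smul (hc 1)).fun_add (h2.fun_smul (hc Complex.I))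
  have key : ∀ x ∈ uIcc a b, (∫ y in a..x, f y) =
      (∫ y in a..x, (f y).re) • (1 : ℂ) + (∫ y in a..x, (f y).im) • Complex.I := by
    intro x hx
    have hfx : IntervalIntegrable f volume a x :=
      hf.mono_set (uIcc_subset_uIcc_left hx)
    have e1 : ∫ y in a..x, (f y).re = (∫ y in a..x, f y).re :=
      (Complex.reCLM.intervalIntegral_comp_comm hfx)
    have e2 : ∫ y in a..x, (f y).im = (∫ y in a..x, f y).im :=
      (Complex.imCLM.intervalIntegral_comp_comm hfx)
    rw [e1, e2, Complex.real_smul, Complex.real_smul, mul_one, Complex.re_add_im]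
  rw [absolutelyContinuousOnInterval_iff] at h3 ⊢
  intro ε hε
  obtain ⟨δ, hδ, h4⟩ := h3 ε hε
  refine ⟨δ, hδ, fun E hE hE' => ?_⟩
  have h5 := h4 E hE hE'
  refine lt_of_eq_of_lt (Finset.sum_congr rfl fun i hi => ?_) h5
  have := hE.1 i hi
  rw [key _ this.1, key _ this.2]

namespace IsPrimitive

variable {F G f g : ℝ → ℂ}

lemma eq_add (h : IsPrimitive F f) (a : ℝ) : F = fun x => F a + ∫ y in a..x, f y := by
  funext x; rw [← h.sub_eq a x]; ring

lemma continuous (h : IsPrimitive F f) : Continuous F := by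
  rw [h.eq_add 0]
  exact continuous_const.add (intervalIntegral.continuous_primitive h.intervalIntegrable 0)

lemma absolutelyContinuousOnInterval (h : IsPrimitive F f) (a b : ℝ) :
    AbsolutelyContinuousOnInterval F a b := by
  rw [h.eq_add a]
  exact (((LipschitzWith.const (F a)).lipschitzOnWith
    (s := uIcc a b)).absolutelyContinuousOnInterval).fun_add
    (intervalIntegral_absolutelyContinuous (h.intervalIntegrable a b))

lemma locallyIntegrable (h : IsPrimitive F f) : LocallyIntegrable f := by
  intro x
  refine ⟨Ioo (x - 1) (x + 1), Ioo_mem_nhds (by linarith) (by linarith), ?_⟩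
  exact ((intervalIntegrable_iff_integrableOn_Ioo_of_le (by linarith)).1
    (h.intervalIntegrable (x - 1) (x + 1)))

lemma ae_hasDerivAt (h : IsPrimitive F f) : ∀ᵐ x, HasDerivAt F (f x) x := by
  filter_upwards [_root_.LocallyIntegrable.ae_hasDerivAt_integral h.locallyIntegrable] with x hx
  rw [h.eq_add 0]
  exact (hx 0).const_add (F 0)

lemma of_hasDerivAt (h : ∀ x, HasDerivAt F (f x) x) (hf : Continuous f) : IsPrimitive F f :=
  ⟨fun _ _ => hf.intervalIntegrable _ _, fun _ _ =>
    (intervalIntegral.integral_eq_sub_of_hasDerivAt (fun x _ => h x)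
      (hf.intervalIntegrable _ _)).symm⟩

lemma hasDerivAt (h : IsPrimitive F f) (hf : Continuous f) (x : ℝ) : HasDerivAt F (f x) x := by
  rw [h.eq_add 0]
  exact (intervalIntegral.integral_hasDerivAt_right (hf.intervalIntegrable _ _)
    (hf.stronglyMeasurableAtFilter _ _) hf.continuousAt).const_add _

lemma congr (h : IsPrimitive F f) (hfg : f =ᵐ[volume] g) : IsPrimitive F g :=
  ⟨fun a b => (h.intervalIntegrable a b).congr_ae (ae_restrict_of_ae hfg), fun a b => by
    rw [h.sub_eq]
    exact intervalIntegral.integral_congr_ae (hfg.mono fun x hx _ => hx)⟩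

lemma add (hF : IsPrimitive F f) (hG : IsPrimitive G g) :
    IsPrimitive (fun x => F x + G x) (fun x => f x + g x) :=
  ⟨fun a b => (hF.intervalIntegrable a b).add (hG.intervalIntegrable a b), fun a b => by
    rw [intervalIntegral.integral_add (hF.intervalIntegrable a b) (hG.intervalIntegrable a b),
      ← hF.sub_eq, ← hG.sub_eq]; ring⟩

lemma mul (hF : IsPrimitive F f) (hG : IsPrimitive G g) :
    IsPrimitive (fun x => F x * G x) (fun x => f x * G x + F x * g x) := by
  have hint : ∀ a b, IntervalIntegrable (fun x => f x * G x + F x * g x) volume a b := fun a b =>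
    ((hF.intervalIntegrable a b).mul_continuousOn hG.continuous.continuousOn).add
      ((hG.intervalIntegrable a b).continuousOn_mul hF.continuous.continuousOn)
  refine ⟨hint, fun a b => ?_⟩
  have hac : AbsolutelyContinuousOnInterval
      (fun x => F x * G x - ∫ y in a..x, (f y * G y + F y * g y)) a b :=
    ((hF.absolutelyContinuousOnInterval a b).fun_smul
      (hG.absolutelyContinuousOnInterval a b)).fun_sub
      (intervalIntegral_absolutelyContinuous (hint a b))
  have hprim : IsPrimitive (fun x => ∫ y in a..x, (f y * G y + F y * g y))
      (fun x => f x * G x + F x * g x) :=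
    ⟨hint, fun c e => intervalIntegral.integral_interval_sub_left (hint _ _) (hint _ _)⟩
  obtain ⟨c, hc⟩ := hac.const_of_ae_hasDerivAt_zero (by
    filter_upwards [hF.ae_hasDerivAt, hG.ae_hasDerivAt, hprim.ae_hasDerivAt] with x h1 h2 h3 _
    have h4 := (h1.mul h2).sub h3
    rw [sub_self] at h4
    exact h4)
  have ha := hc a left_mem_uIcc
  have hb := hc b right_mem_uIcc
  simp only [intervalIntegral.integral_same, sub_zero] at ha
  rw [← ha] at hb
  linear_combination hb

lemma of_isTest {χ : ℝ → ℂ} (hχ : IsTest χ) : IsPrimitive χ (deriv χ) :=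
  of_hasDerivAt (fun x => (hχ.1.differentiable (by simp) x).hasDerivAt)
    (hχ.1.continuous_deriv (by simp))

end IsPrimitive

lemma isTest_deriv {χ : ℝ → ℂ} (hχ : IsTest χ) : IsTest (deriv χ) :=
  ⟨(contDiff_infty_iff_deriv.1 hχ.1).2, hχ.2.deriv⟩

lemma integrable_mul_of_isTest {f χ : ℝ → ℂ} (hf : LocallyIntegrable f) (hχ : Continuous χ)
    (hχ' : HasCompactSupport χ) : Integrable (fun x => f x * χ x) := by
  have := hf.integrable_smul_right_of_hasCompactSupport hχ hχ'
  simpa using this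

/-- A primitive with compact support integrates its derivative to zero. -/
lemma IsPrimitive.integral_eq_zero {F f : ℝ → ℂ} (h : IsPrimitive F f) (hF : HasCompactSupport F)
    (hf : Integrable f) : ∫ x, f x = 0 := by
  have h1 := intervalIntegral_tendsto_integral hf tendsto_neg_atTop_atBot tendsto_id
  have h2 : ∀ᶠ r : ℝ in atTop, ∫ x in (-r)..id r, f x = 0 := by
    obtain ⟨R, hR⟩ := hF.isCompact.isBounded.subset_closedBall (0 : ℝ)
    filter_upwards [eventually_gt_atTop R, eventually_gt_atTop 0] with r hr hr0
    have h0 : ∀ x, R < |x| → F x = 0 := by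
      intro x hx
      by_contra hne
      have := hR (subset_tsupport F hne)
      rw [Metric.mem_closedBall, dist_zero_right, Real.norm_eq_abs] at this
      linarith
    rw [← h.sub_eq, id, h0 r (by rwa [abs_of_pos hr0]), h0 (-r) (by rwa [abs_neg, abs_of_pos hr0]),
      sub_zero]
  exact tendsto_nhds_unique h1 (tendsto_const_nhds.congr' (h2.mono fun r hr => hr.symm))

lemma IsPrimitive.isWeakDeriv {F f : ℝ → ℂ} (h : IsPrimitive F f) : IsWeakDeriv F f := by
  intro χ hχ
  have h1 := h.mul (IsPrimitive.of_isTest hχ)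
  have i1 := integrable_mul_of_isTest h.locallyIntegrable hχ.1.continuous hχ.2
  have i2 := integrable_mul_of_isTest h.continuous.locallyIntegrable (isTest_deriv hχ).1.continuous
    (isTest_deriv hχ).2
  have h2 := h1.integral_eq_zero hχ.2.mul_left (i1.add i2)
  rw [integral_add i1 i2] at h2
  exact eq_neg_of_add_eq_zero_right h2

/-- Averages of a test function are test functions. -/
lemma IsTest.integral_window {θ : ℝ → ℂ} (hθ : IsTest θ) (t : ℝ) :
    ∃ χ, IsTest χ ∧ ∀ x, deriv χ x = θ x - θ (x - t) := by
  have hc := hθ.1.continuous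
  have hd : ∀ x, HasDerivAt (fun x => (∫ y in (0 : ℝ)..x, θ y) - ∫ y in (0 : ℝ)..(x - t), θ y)
      (θ x - θ (x - t)) x := by
    intro x
    have h1 : ∀ z, HasDerivAt (fun x => ∫ y in (0 : ℝ)..x, θ y) (θ z) z := fun z =>
      intervalIntegral.integral_hasDerivAt_right (hc.intervalIntegrable _ _)
        (hc.stronglyMeasurableAtFilter _ _) hc.continuousAt
    refine (h1 x).sub ?_
    have h2 := (h1 (x - t)).comp_sub_const x t
    exact h2
  refine ⟨_, ⟨?_, ?_⟩, fun x => (hd x).deriv⟩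
  · refine contDiff_infty_iff_deriv.2 ⟨fun x => (hd x).differentiableAt, ?_⟩
    have : deriv (fun x => (∫ y in (0 : ℝ)..x, θ y) - ∫ y in (0 : ℝ)..(x - t), θ y) =
        fun x => θ x - θ (x - t) := funext fun x => (hd x).deriv
    rw [this]
    exact hθ.1.sub (hθ.1.comp (contDiff_id.sub contDiff_const))
  · obtain ⟨R, hR⟩ := hθ.2.isCompact.isBounded.subset_closedBall (0 : ℝ)
    refine HasCompactSupport.intro (isCompact_closedBall (0 : ℝ) (R + |t|)) fun x hx => ?_
    rw [intervalIntegral.integral_interval_sub_left (hc.intervalIntegrable _ _)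
      (hc.intervalIntegrable _ _)]
    refine intervalIntegral.integral_zero_ae (Eventually.of_forall fun y hy => ?_)
    by_contra hne
    have h1 := hR (subset_tsupport θ hne)
    rw [Metric.mem_closedBall, dist_zero_right, Real.norm_eq_abs] at h1 hx
    have h2 : |y - x| ≤ |t| := by
      rcases le_total 0 t with ht | ht
      · rw [uIoc_of_le (by linarith)] at hy
        rw [abs_of_nonpos (by linarith [hy.2]), abs_of_nonneg ht]; linarith [hy.1]
      · rw [uIoc_of_ge (by linarith)] at hy
        rw [abs_of_nonneg (by linarith [hy.1]), abs_of_nonpos ht]; linarith [hy.2]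
    have h3 : |x| ≤ |y| + |y - x| := by
      calc |x| = |y - (y - x)| := by ring_nf
        _ ≤ |y| + |y - x| := abs_sub _ _
    linarith

/-- A functional on test functions that annihilates derivatives is invariant under translations;
so it vanishes if it tends to zero along translations to the right. -/
lemma functional_eq_zero_of_forall_deriv {Λ : (ℝ → ℂ) → ℂ}
    (hsub : ∀ θ, IsTest θ → ∀ t, Λ (fun x => θ x - θ (x - t)) = Λ θ - Λ (fun x => θ (x - t)))
    (hderiv : ∀ χ, IsTest χ → Λ (deriv χ) = 0)
    (hlim : ∀ θ, IsTest θ → Tendsto (fun t : ℝ => Λ (fun x => θ (x - t))) atTop (𝓝 0))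
    {θ : ℝ → ℂ} (hθ : IsTest θ) : Λ θ = 0 := by
  have h1 : ∀ t : ℝ, Λ (fun x => θ (x - t)) = Λ θ := by
    intro t
    obtain ⟨χ, hχ, hχ'⟩ := hθ.integral_window t
    have h2 := hderiv χ hχ
    rw [funext hχ', hsub θ hθ t, sub_eq_zero] at h2
    exact h2.symm
  have h3 := hlim θ hθ
  simp only [h1] at h3
  exact tendsto_nhds_unique tendsto_const_nhds h3

end

section

/-! ### The exponentially weighted space -/

lemma integrable_exp_neg_mul_abs {δ : ℝ} (hδ : 0 < δ) :
    Integrable fun u : ℝ => Real.exp (-(δ * |u|)) := by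
  rw [← integrableOn_univ, ← Iic_union_Ioi (a := (0 : ℝ))]
  refine IntegrableOn.union ?_ ?_
  · refine (integrableOn_exp_mul_Iic hδ 0).congr_fun (fun u hu => ?_) measurableSet_Iic
    rw [mem_Iic] at hu
    simp [abs_of_nonpos hu]
  · refine (integrableOn_exp_mul_Ioi (neg_lt_zero.2 hδ) 0).congr_fun (fun u hu => ?_)
      measurableSet_Ioi
    rw [mem_Ioi] at hu
    simp [abs_of_pos hu]

open ENNReal in
/-- The Schur test for the kernel `exp (-δ |x - y|)`. -/
lemma exists_lintegral_sq_le {δ : ℝ} (hδ : 0 < δ) : ∃ K : NNReal, ∀ f : ℝ → ℝ≥0∞,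
    AEMeasurable f → ∫⁻ x, (∫⁻ y, ENNReal.ofReal (Real.exp (-(δ * |x - y|))) * f y) ^ 2
      ≤ (K : ℝ≥0∞) ^ 2 * ∫⁻ y, f y ^ 2 := by
  have hint := integrable_exp_neg_mul_abs hδ
  set k : ℝ → ℝ≥0∞ := fun u => ENNReal.ofReal (Real.exp (-(δ * |u|))) with hk
  have hkm : Measurable k := by fun_prop
  have hfin : ∫⁻ u, k u ≠ ⊤ := by
    have := hint.hasFiniteIntegral
    rw [hasFiniteIntegral_iff_ofReal (Eventually.of_forall fun u => (Real.exp_pos _).le)] at this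
    exact this.ne
  refine ⟨(∫⁻ u, k u).toNNReal, fun f hf => ?_⟩
  rw [coe_toNNReal hfin]
  have hk1 : ∀ x, ∫⁻ y, k (x - y) = ∫⁻ u, k u := fun x =>
    lintegral_sub_left_eq_self k x
  have hk2 : ∀ y, ∫⁻ x, k (x - y) = ∫⁻ u, k u := fun y =>
    lintegral_sub_right_eq_self k y
  have hCS : ∀ x, (∫⁻ y, k (x - y) * f y) ^ 2 ≤ (∫⁻ u, k u) * ∫⁻ y, k (x - y) * f y ^ 2 := by
    intro x
    have h1 := ENNReal.lintegral_mul_norm_pow_le (μ := volume) (f := fun y => k (x - y))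
      (g := fun y => k (x - y) * f y ^ 2) (p := 1 / 2) (q := 1 / 2)
      (by fun_prop) (by fun_prop) (by norm_num) (by norm_num) (by norm_num)
    rw [hk1] at h1
    have h2 : ∀ y, k (x - y) ^ (1 / 2 : ℝ) * (k (x - y) * f y ^ 2) ^ (1 / 2 : ℝ)
        = k (x - y) * f y := by
      intro y
      rw [ENNReal.mul_rpow_of_nonneg _ _ (by norm_num), ← mul_assoc,
        ← ENNReal.rpow_add_of_nonneg _ _ (by norm_num) (by norm_num), ← ENNReal.rpow_natCast (f y),
        ← ENNReal.rpow_mul]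
      norm_num
    simp only [h2] at h1
    calc (∫⁻ y, k (x - y) * f y) ^ 2
        ≤ ((∫⁻ u, k u) ^ (1 / 2 : ℝ) * (∫⁻ y, k (x - y) * f y ^ 2) ^ (1 / 2 : ℝ)) ^ 2 := by
          gcongr
      _ = (∫⁻ u, k u) * ∫⁻ y, k (x - y) * f y ^ 2 := by
          rw [mul_pow, ← ENNReal.rpow_natCast, ← ENNReal.rpow_mul, ← ENNReal.rpow_natCast,
            ← ENNReal.rpow_mul]
          norm_num
  calc ∫⁻ x, (∫⁻ y, k (x - y) * f y) ^ 2
      ≤ ∫⁻ x, (∫⁻ u, k u) * ∫⁻ y, k (x - y) * f y ^ 2 := lintegral_mono hCS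
    _ = (∫⁻ u, k u) * ∫⁻ x, ∫⁻ y, k (x - y) * f y ^ 2 := lintegral_const_mul' _ _ hfin
    _ = (∫⁻ u, k u) * ∫⁻ y, ∫⁻ x, k (x - y) * f y ^ 2 := by
        rw [lintegral_lintegral_swap]
        refine AEMeasurable.mul (by fun_prop) ?_
        exact (hf.pow_const 2).comp_quasiMeasurePreserving Measure.quasiMeasurePreserving_snd
    _ = (∫⁻ u, k u) * ∫⁻ y, (∫⁻ u, k u) * f y ^ 2 := by
        congr 1
        refine lintegral_congr fun y => ?_
        rw [lintegral_mul_const _ (by fun_prop), hk2]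
    _ = (∫⁻ u, k u) ^ 2 * ∫⁻ y, f y ^ 2 := by
        rw [lintegral_const_mul' _ _ hfin, ← mul_assoc, sq]

section Weighted

variable {ν : ℝ}

lemma measurable_expWeight_density : Measurable fun x : ℝ => ENNReal.ofReal (Real.exp (2 * ν * x)) := by
  fun_prop

lemma expWeight_absolutelyContinuous : expWeight ν ≪ volume :=
  withDensity_absolutelyContinuous _ _

lemma absolutelyContinuous_expWeight : volume ≪ expWeight ν :=
  withDensity_absolutelyContinuous' measurable_expWeight_density.aemeasurable
    (Eventually.of_forall fun x => by simp [Real.exp_pos])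

lemma ae_expWeight_iff {p : ℝ → Prop} : (∀ᵐ x ∂(expWeight ν), p x) ↔ ∀ᵐ x, p x :=
  ⟨fun h => absolutelyContinuous_expWeight.ae_le h, fun h => expWeight_absolutelyContinuous.ae_le h⟩

lemma aestronglyMeasurable_expWeight {f : ℝ → ℂ} :
    AEStronglyMeasurable f (expWeight ν) ↔ AEStronglyMeasurable f volume :=
  ⟨fun h => h.mono_ac absolutelyContinuous_expWeight, fun h =>
    h.mono_ac expWeight_absolutelyContinuous⟩

lemma WeightedL2.aestronglyMeasurable (f : WeightedL2 ν) : AEStronglyMeasurable f volume :=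
  aestronglyMeasurable_expWeight.1 (Lp.aestronglyMeasurable f)

lemma WeightedL2.ext {f g : WeightedL2 ν} (h : f =ᵐ[volume] g) : f = g :=
  Lp.ext (ae_expWeight_iff.2 h)

lemma WeightedL2.coeFn_toLp {f : ℝ → ℂ} (hf : MemLp f 2 (expWeight ν)) :
    hf.toLp f =ᵐ[volume] f :=
  ae_expWeight_iff.1 hf.coeFn_toLp

lemma WeightedL2.coeFn_add (f g : WeightedL2 ν) : ⇑(f + g) =ᵐ[volume] fun x => f x + g x :=
  ae_expWeight_iff.1 (Lp.coeFn_add f g)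

lemma WeightedL2.coeFn_sub (f g : WeightedL2 ν) : ⇑(f - g) =ᵐ[volume] fun x => f x - g x :=
  ae_expWeight_iff.1 (Lp.coeFn_sub f g)

lemma WeightedL2.coeFn_smul (α : ℂ) (f : WeightedL2 ν) : ⇑(α • f) =ᵐ[volume] fun x => α * f x :=
  ae_expWeight_iff.1 (Lp.coeFn_smul α f)

open ENNReal in
lemma eLpNorm_expWeight (f : ℝ → ℂ) : eLpNorm f 2 (expWeight ν) =
    (∫⁻ x, (ENNReal.ofReal (Real.exp (ν * x)) * ‖f x‖ₑ) ^ 2) ^ (1 / 2 : ℝ) := by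
  rw [eLpNorm_eq_lintegral_rpow_enorm_toReal two_ne_zero ofNat_ne_top, expWeight,
    lintegral_withDensity_eq_lintegral_mul_non_measurable _ measurable_expWeight_density
      (Eventually.of_forall fun x => ofReal_lt_top)]
  simp only [toReal_ofNat]
  congr 1
  refine lintegral_congr fun x => ?_
  rw [Pi.mul_apply, mul_pow, ← ENNReal.ofReal_pow (Real.exp_pos _).le, ← Real.exp_nat_mul]
  congr 1
  · push_cast; ring_nf
  · exact ENNReal.rpow_natCast _ 2

/-- Functions dominated by an integral with kernel `exp (-δ |x - y|)` in the weighted sense. -/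
lemma exists_eLpNorm_le (ν : ℝ) {δ : ℝ} (hδ : 0 < δ) : ∃ K : NNReal, ∀ (f v : ℝ → ℂ) (c : NNReal),
    AEStronglyMeasurable f volume →
    (∀ x, ‖v x‖ₑ ≤ c * ∫⁻ y, ENNReal.ofReal (Real.exp (ν * (y - x) - δ * |x - y|)) * ‖f y‖ₑ) →
    eLpNorm v 2 (expWeight ν) ≤ c * K * eLpNorm f 2 (expWeight ν) := by
  obtain ⟨K, hK⟩ := exists_lintegral_sq_le hδ
  refine ⟨K, fun f v c hf hv => ?_⟩
  set F : ℝ → ENNReal := fun y => ENNReal.ofReal (Real.exp (ν * y)) * ‖f y‖ₑ with hF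
  have hFm : AEMeasurable F := by fun_prop
  have h1 : ∀ x, ENNReal.ofReal (Real.exp (ν * x)) * ‖v x‖ₑ ≤
      c * ∫⁻ y, ENNReal.ofReal (Real.exp (-(δ * |x - y|))) * F y := by
    intro x
    calc ENNReal.ofReal (Real.exp (ν * x)) * ‖v x‖ₑ
        ≤ ENNReal.ofReal (Real.exp (ν * x)) * (c * ∫⁻ y,
          ENNReal.ofReal (Real.exp (ν * (y - x) - δ * |x - y|)) * ‖f y‖ₑ) := by gcongr; exact hv x
      _ = c * ∫⁻ y, ENNReal.ofReal (Real.exp (-(δ * |x - y|))) * F y := by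
        rw [mul_left_comm, ← lintegral_const_mul' _ _ ENNReal.ofReal_ne_top]
        congr 1
        refine lintegral_congr fun y => ?_
        rw [hF, ← mul_assoc, ← mul_assoc, ← ENNReal.ofReal_mul (Real.exp_pos _).le,
          ← ENNReal.ofReal_mul (Real.exp_pos _).le, ← Real.exp_add, ← Real.exp_add]
        ring_nf
  rw [eLpNorm_expWeight, eLpNorm_expWeight]
  calc (∫⁻ x, (ENNReal.ofReal (Real.exp (ν * x)) * ‖v x‖ₑ) ^ 2) ^ (1 / 2 : ℝ)
      ≤ ((c : ENNReal) ^ 2 * (K ^ 2 * ∫⁻ x, F x ^ 2)) ^ (1 / 2 : ℝ) := by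
        gcongr
        calc ∫⁻ x, (ENNReal.ofReal (Real.exp (ν * x)) * ‖v x‖ₑ) ^ 2
            ≤ ∫⁻ x, (c * ∫⁻ y, ENNReal.ofReal (Real.exp (-(δ * |x - y|))) * F y) ^ 2 :=
              lintegral_mono fun x => pow_le_pow_left₀ zero_le (h1 x) 2
          _ = (c : ENNReal) ^ 2 *
              ∫⁻ x, (∫⁻ y, ENNReal.ofReal (Real.exp (-(δ * |x - y|))) * F y) ^ 2 := by
              simp_rw [mul_pow]
              rw [lintegral_const_mul' _ _ (by simp)]
          _ ≤ _ := by gcongr; exact hK F hFm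
    _ = c * K * (∫⁻ x, F x ^ 2) ^ (1 / 2 : ℝ) := by
        rw [ENNReal.mul_rpow_of_nonneg _ _ (by norm_num),
          ENNReal.mul_rpow_of_nonneg _ _ (by norm_num), ← ENNReal.rpow_natCast,
          ← ENNReal.rpow_natCast, ← ENNReal.rpow_mul, ← ENNReal.rpow_mul]
        norm_num
        rw [mul_assoc]

/-- A criterion for membership in the weighted space. -/
lemma memLp_expWeight_of_le {v : ℝ → ℂ} {C δ : ℝ} (hδ : 0 < δ)
    (hv : AEStronglyMeasurable v volume)
    (hb : ∀ x, ‖v x‖ ≤ C * Real.exp (-(ν * x) - δ * |x|)) : MemLp v 2 (expWeight ν) := by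
  refine ⟨aestronglyMeasurable_expWeight.2 hv, ?_⟩
  rw [eLpNorm_expWeight]
  refine ENNReal.rpow_lt_top_of_nonneg (by norm_num) (ne_of_lt ?_)
  have hint : Integrable fun u : ℝ => C ^ 2 * Real.exp (-(2 * δ) * |u|) := by
    refine Integrable.const_mul ?_ _
    simpa only [neg_mul] using integrable_exp_neg_mul_abs (by linarith : 0 < 2 * δ)
  have h1 := hint.hasFiniteIntegral
  rw [hasFiniteIntegral_iff_ofReal (Eventually.of_forall fun u => by positivity)] at h1
  refine lt_of_le_of_lt (lintegral_mono fun x => ?_) h1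
  rw [← ofReal_norm, ← ENNReal.ofReal_mul (Real.exp_pos _).le,
    ← ENNReal.ofReal_pow (by positivity)]
  refine ENNReal.ofReal_le_ofReal ?_
  calc (Real.exp (ν * x) * ‖v x‖) ^ 2
      ≤ (Real.exp (ν * x) * (C * Real.exp (-(ν * x) - δ * |x|))) ^ 2 := by
        gcongr; exact hb x
    _ = C ^ 2 * (Real.exp (ν * x) * Real.exp (-(ν * x) - δ * |x|)) ^ 2 := by ring
    _ = C ^ 2 * Real.exp (-(2 * δ) * |x|) := by
        rw [← Real.exp_add, ← Real.exp_nat_mul]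
        congr 2; push_cast; ring

lemma integral_expWeight (f : ℝ → ℂ) :
    ∫ x, f x ∂(expWeight ν) = ∫ x, (Real.exp (2 * ν * x) : ℂ) * f x := by
  rw [expWeight, integral_withDensity_eq_integral_toReal_smul measurable_expWeight_density
    (Eventually.of_forall fun x => ENNReal.ofReal_lt_top)]
  refine integral_congr_ae (Eventually.of_forall fun x => ?_)
  simp only [ENNReal.toReal_ofReal (Real.exp_pos _).le, Complex.real_smul]

lemma integrable_expWeight {f : ℝ → ℂ} :
    Integrable f (expWeight ν) ↔ Integrable fun x => (Real.exp (2 * ν * x) : ℂ) * f x := by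
  rw [expWeight, integrable_withDensity_iff_integrable_smul' measurable_expWeight_density
    (Eventually.of_forall fun x => ENNReal.ofReal_lt_top)]
  refine integrable_congr (Eventually.of_forall fun x => ?_)
  simp only [ENNReal.toReal_ofReal (Real.exp_pos _).le, Complex.real_smul]

/-- `ρ` is bounded by `C exp (ν x - δ |x|)` with `δ > 0`, so that it can be integrated against
elements of the weighted space. -/
structure IsDualWeight (ν : ℝ) (ρ : ℝ → ℂ) : Prop where
  aestronglyMeasurable : AEStronglyMeasurable ρ volume
  bound : ∃ C δ : ℝ, 0 < δ ∧ ∀ x, ‖ρ x‖ ≤ C * Real.exp (ν * x - δ * |x|)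

namespace IsDualWeight

variable {ρ : ℝ → ℂ}

lemma memLp (h : IsDualWeight ν ρ) :
    MemLp (fun x => (Real.exp (-(2 * ν * x)) : ℂ) * ρ x) 2 (expWeight ν) := by
  obtain ⟨C, δ, hδ, hb⟩ := h.bound
  refine memLp_expWeight_of_le (C := C) hδ
    (AEStronglyMeasurable.mul (by fun_prop) h.aestronglyMeasurable) fun x => ?_
  rw [norm_mul, Complex.norm_real, Real.norm_of_nonneg (Real.exp_pos _).le]
  calc Real.exp (-(2 * ν * x)) * ‖ρ x‖
      ≤ Real.exp (-(2 * ν * x)) * (C * Real.exp (ν * x - δ * |x|)) := by gcongr; exact hb x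
    _ = C * (Real.exp (-(2 * ν * x)) * Real.exp (ν * x - δ * |x|)) := by ring
    _ = C * Real.exp (-(ν * x) - δ * |x|) := by rw [← Real.exp_add]; ring_nf

lemma integrable_mul (h : IsDualWeight ν ρ) (f : WeightedL2 ν) :
    Integrable fun x => ρ x * f x := by
  have h1 := h.memLp.integrable_mul (Lp.memLp f)
  rw [integrable_expWeight] at h1
  refine h1.congr (Eventually.of_forall fun x => ?_)
  simp only [Pi.mul_apply, ← mul_assoc, ← Complex.ofReal_mul, ← Real.exp_add]
  simp

/-- The bounded functional `f ↦ ∫ ρ f` on the weighted space. -/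
def pairing (h : IsDualWeight ν ρ) : WeightedL2 ν →L[ℂ] ℂ :=
  innerSL ℂ (h.memLp.star.toLp _)

lemma pairing_apply (h : IsDualWeight ν ρ) (f : WeightedL2 ν) :
    h.pairing f = ∫ x, ρ x * f x := by
  rw [pairing, innerSL_apply_apply, L2.inner_def, integral_expWeight]
  refine integral_congr_ae ?_
  filter_upwards [ae_expWeight_iff.1 h.memLp.star.coeFn_toLp] with x hx
  rw [hx]
  simp only [Pi.star_apply, RCLike.inner_apply, RCLike.star_def, map_mul, Complex.conj_ofReal,
    Complex.conj_conj]
  have : (Real.exp (2 * ν * x) : ℂ) * Real.exp (-(2 * ν * x)) = 1 := by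
    rw [← Complex.ofReal_mul, ← Real.exp_add]; simp
  linear_combination (f x * ρ x) * this

end IsDualWeight

lemma isDualWeight_indicator (hν : 0 < ν) (a : ℝ) : IsDualWeight ν ((Ioi a).indicator 1) := by
  refine ⟨(aestronglyMeasurable_const (b := (1 : ℂ))).indicator measurableSet_Ioi,
    Real.exp (2 * ν * |a|), ν, hν, fun x => ?_⟩
  by_cases hx : x ∈ Ioi a
  · rw [indicator_of_mem hx, Pi.one_apply, norm_one, ← Real.exp_add, Real.one_le_exp_iff]
    rw [mem_Ioi] at hx
    have h1 : -|a| ≤ a := neg_abs_le a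
    have : |x| - x ≤ 2 * |a| := by
      rcases abs_cases x with ⟨h, _⟩ | ⟨h, _⟩ <;> rw [h] <;> linarith [abs_nonneg a]
    nlinarith
  · rw [indicator_of_notMem hx, norm_zero]; positivity

lemma WeightedL2.integrableOn_Ioi (hν : 0 < ν) (f : WeightedL2 ν) (a : ℝ) :
    IntegrableOn f (Ioi a) := by
  have h1 := (isDualWeight_indicator hν a).integrable_mul f
  rw [← integrable_indicator_iff measurableSet_Ioi]
  refine h1.congr (Eventually.of_forall fun x => ?_)
  by_cases hx : x ∈ Ioi a <;> simp [hx]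

lemma WeightedL2.isPrimitive_invDeriv (hν : 0 < ν) (f : WeightedL2 ν) :
    IsPrimitive (invDeriv f) f := by
  refine ⟨fun a b => ?_, fun a b => ?_⟩
  · rw [intervalIntegrable_iff]
    exact (f.integrableOn_Ioi hν (min a b)).mono_set Ioc_subset_Ioi_self
  · rw [invDeriv, invDeriv, ← intervalIntegral.integral_Ioi_sub_Ioi' (f.integrableOn_Ioi hν a)
      (f.integrableOn_Ioi hν b)]
    ring

lemma WeightedL2.locallyIntegrable (hν : 0 < ν) (f : WeightedL2 ν) : LocallyIntegrable f :=
  (f.isPrimitive_invDeriv hν).locallyIntegrable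

/-- A bounded operator on the weighted space given by a formula for functions. -/
def mkOp (Φ : WeightedL2 ν → ℝ → ℂ) (hm : ∀ f, AEStronglyMeasurable (Φ f) volume)
    (hadd : ∀ f g, Φ (f + g) =ᵐ[volume] fun x => Φ f x + Φ g x)
    (hsmul : ∀ (α : ℂ) f, Φ (α • f) =ᵐ[volume] fun x => α * Φ f x) (K : NNReal)
    (hK : ∀ f, eLpNorm (Φ f) 2 (expWeight ν) ≤ K * eLpNorm f 2 (expWeight ν)) :
    WeightedL2 ν →L[ℂ] WeightedL2 ν :=
  have hmem : ∀ f, MemLp (Φ f) 2 (expWeight ν) := fun f =>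
    ⟨aestronglyMeasurable_expWeight.2 (hm f),
      lt_of_le_of_lt (hK f) (ENNReal.mul_lt_top (by simp) (Lp.memLp f).2)⟩
  LinearMap.mkContinuous
    { toFun := fun f => (hmem f).toLp _
      map_add' := fun f g => WeightedL2.ext (by
        filter_upwards [WeightedL2.coeFn_toLp (hmem (f + g)), WeightedL2.coeFn_toLp (hmem f),
          WeightedL2.coeFn_toLp (hmem g), hadd f g,
          WeightedL2.coeFn_add ((hmem f).toLp _) ((hmem g).toLp _)] with x h1 h2 h3 h4 h5
        rw [h1, h4, h5, h2, h3])
      map_smul' := fun α f => WeightedL2.ext (by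
        filter_upwards [WeightedL2.coeFn_toLp (hmem (α • f)), WeightedL2.coeFn_toLp (hmem f),
          hsmul α f, WeightedL2.coeFn_smul α ((hmem f).toLp _)] with x h1 h2 h3 h4
        rw [h1, h3, RingHom.id_apply, h4, h2]) } K (fun f => by
      simp only [LinearMap.coe_mk, AddHom.coe_mk, Lp.norm_def]
      rw [eLpNorm_congr_ae (hmem f).coeFn_toLp, ← ENNReal.coe_toReal, ← ENNReal.toReal_mul]
      exact ENNReal.toReal_mono (ENNReal.mul_ne_top (by simp) (Lp.memLp f).2.ne) (hK f))

lemma mkOp_ae {Φ : WeightedL2 ν → ℝ → ℂ} {hm hadd hsmul K hK} (f : WeightedL2 ν) :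
    mkOp Φ hm hadd hsmul K hK f =ᵐ[volume] Φ f :=
  WeightedL2.coeFn_toLp (f := Φ f) ⟨aestronglyMeasurable_expWeight.2 (hm f),
    lt_of_le_of_lt (hK f) (ENNReal.mul_lt_top (by simp) (Lp.memLp f).2)⟩

end Weighted

end

section

/-! ### The antiderivative as a bounded operator -/

section Antideriv

variable {ν : ℝ}

open scoped BoundedContinuousFunction

/-- An integral over `s` against the kernel `ρ` is dominated by the integral of any `K` that exceeds
`‖ρ‖` on `s`. -/
lemma enorm_setIntegral_le {f : ℝ → ℂ} {s : Set ℝ} (hs : MeasurableSet s) {K : ℝ → ENNReal}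
    {ρ : ℝ → ℂ} (h : ∀ y ∈ s, ‖ρ y‖ₑ ≤ K y) :
    ‖∫ y in s, ρ y * f y‖ₑ ≤ ∫⁻ y, K y * ‖f y‖ₑ := by
  refine (enorm_integral_le_lintegral_enorm _).trans ?_
  refine le_trans ?_ (setLIntegral_le_lintegral s _)
  refine setLIntegral_mono' hs fun y hy => ?_
  rw [enorm_mul]
  gcongr
  exact h y hy

lemma enorm_invDeriv_le (f : ℝ → ℂ) (x : ℝ) : ‖invDeriv f x‖ₑ ≤
    ((1 : NNReal) : ENNReal) *
      ∫⁻ y, ENNReal.ofReal (Real.exp (ν * (y - x) - ν * |x - y|)) * ‖f y‖ₑ := by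
  rw [ENNReal.coe_one, one_mul, invDeriv, enorm_neg]
  have := enorm_setIntegral_le (f := f) (measurableSet_Ioi (a := x)) (ρ := fun _ => 1)
    (K := fun y => ENNReal.ofReal (Real.exp (ν * (y - x) - ν * |x - y|))) (fun y hy => by
      rw [mem_Ioi] at hy
      rw [abs_of_neg (by linarith), neg_sub, sub_self, Real.exp_zero, ENNReal.ofReal_one,
        enorm_one])
  simpa only [one_mul] using this

/-- The antiderivative `∂ₓ⁻¹` as a bounded operator on the weighted space. -/
def antideriv (hν : 0 < ν) : WeightedL2 ν →L[ℂ] WeightedL2 ν :=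
  mkOp (fun f => invDeriv f)
    (fun f => (f.isPrimitive_invDeriv hν).continuous.aestronglyMeasurable)
    (fun f g => Eventually.of_forall fun x => by
      simp only [invDeriv]
      rw [← neg_add, ← integral_add (f.integrableOn_Ioi hν x) (g.integrableOn_Ioi hν x)]
      congr 1
      exact integral_congr_ae (ae_restrict_of_ae (WeightedL2.coeFn_add f g)))
    (fun α f => Eventually.of_forall fun x => by
      simp only [invDeriv]
      rw [mul_neg, ← integral_const_mul]
      congr 1
      exact integral_congr_ae (ae_restrict_of_ae (WeightedL2.coeFn_smul α f)))
    (exists_eLpNorm_le ν hν).choose (fun f => by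
      simpa using (exists_eLpNorm_le ν hν).choose_spec f (invDeriv f) 1 f.aestronglyMeasurable
        (enorm_invDeriv_le f))

lemma antideriv_ae (hν : 0 < ν) (f : WeightedL2 ν) : antideriv hν f =ᵐ[volume] invDeriv f :=
  mkOp_ae f

lemma invDeriv_congr {f g : ℝ → ℂ} (h : f =ᵐ[volume] g) : invDeriv f = invDeriv g :=
  funext fun _ => congrArg Neg.neg (integral_congr_ae (ae_restrict_of_ae h))

/-- Multiplication by a bounded continuous function. -/
def mulOp (ν : ℝ) (b : ℝ →ᵇ ℝ) : WeightedL2 ν →L[ℂ] WeightedL2 ν :=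
  mkOp (fun f x => (b x : ℂ) * f x)
    (fun f => (Complex.continuous_ofReal.comp b.continuous).aestronglyMeasurable.mul
      f.aestronglyMeasurable)
    (fun f g => by
      filter_upwards [WeightedL2.coeFn_add f g] with x hx
      rw [hx]; ring)
    (fun α f => by
      filter_upwards [WeightedL2.coeFn_smul α f] with x hx
      rw [hx]; ring)
    ‖b‖₊ (fun f => by
      have := eLpNorm_le_nnreal_smul_eLpNorm_of_ae_le_mul (p := 2) (μ := expWeight ν) (c := ‖b‖₊)
        (f := fun x => (b x : ℂ) * f x) (g := f) (Eventually.of_forall fun x => by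
          rw [nnnorm_mul, Complex.nnnorm_real]
          gcongr
          exact b.nnnorm_coe_le_nnnorm x)
      simpa [ENNReal.smul_def] using this)

lemma mulOp_ae (b : ℝ →ᵇ ℝ) (f : WeightedL2 ν) :
    mulOp ν b f =ᵐ[volume] fun x => (b x : ℂ) * f x :=
  mkOp_ae f

lemma WeightedL2.integrable_mul_test (hν : 0 < ν) (k : WeightedL2 ν) {χ : ℝ → ℂ} (hχ : IsTest χ) :
    Integrable fun x => k x * χ x :=
  integrable_mul_of_isTest (k.locallyIntegrable hν) hχ.1.continuous hχ.2

lemma IsTest.comp_sub {θ : ℝ → ℂ} (hθ : IsTest θ) (t : ℝ) : IsTest fun x => θ (x - t) :=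
  ⟨hθ.1.comp (contDiff_id.sub contDiff_const),
    hθ.2.comp_homeomorph (Homeomorph.subRight t)⟩

/-- Translates of a test function to the right tend weakly to zero. -/
lemma WeightedL2.tendsto_translate (hν : 0 < ν) (k : WeightedL2 ν) {θ : ℝ → ℂ} (hθ : IsTest θ) :
    Tendsto (fun t : ℝ => ∫ x, k x * θ (x - t)) atTop (𝓝 0) := by
  obtain ⟨R, hR⟩ := hθ.2.isCompact.isBounded.subset_closedBall (0 : ℝ)
  obtain ⟨M, hM⟩ := hθ.2.exists_bound_of_continuous hθ.1.continuous
  have h0 : ∀ x, R < |x| → θ x = 0 := by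
    intro x hx
    by_contra hne
    have := hR (subset_tsupport θ hne)
    rw [Metric.mem_closedBall, dist_zero_right, Real.norm_eq_abs] at this
    linarith
  rw [show (0 : ℂ) = ∫ x : ℝ, (0 : ℂ) by simp]
  refine tendsto_integral_filter_of_dominated_convergence
    (fun x => (Ioi (-(R + 1))).indicator (fun x => ‖k x‖ * M) x) ?_ ?_ ?_ ?_
  · exact Eventually.of_forall fun t => (k.integrable_mul_test hν (hθ.comp_sub t)).1
  · filter_upwards [eventually_ge_atTop 0] with t ht
    refine Eventually.of_forall fun x => ?_
    by_cases hx : x ∈ Ioi (-(R + 1))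
    · rw [indicator_of_mem hx, norm_mul]
      gcongr
      exact hM _
    · rw [indicator_of_notMem hx, h0 (x - t), mul_zero, norm_zero]
      rw [mem_Ioi, not_lt] at hx
      have : -(x - t) ≤ |x - t| := neg_le_abs _
      linarith
  · rw [integrable_indicator_iff measurableSet_Ioi]
    exact (k.integrableOn_Ioi hν _).norm.mul_const M
  · refine Eventually.of_forall fun x => ?_
    refine tendsto_const_nhds.congr' ?_
    filter_upwards [eventually_gt_atTop (R + x)] with t ht
    rw [h0 (x - t), mul_zero]
    have : -(x - t) ≤ |x - t| := neg_le_abs _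
    linarith

lemma WeightedL2.eq_zero_of_forall_test (hν : 0 < ν) {k : WeightedL2 ν}
    (h : ∀ χ, IsTest χ → ∫ x, k x * χ x = 0) : k = 0 := by
  refine WeightedL2.ext ?_
  have h1 := ae_eq_zero_of_integral_contDiff_smul_eq_zero (k.locallyIntegrable hν)
    (fun g hg hg' => by
      have := h (fun x => (g x : ℂ)) ⟨Complex.ofRealCLM.contDiff.comp hg,
        hg'.comp_left (g := fun x : ℝ => (x : ℂ)) (by simp)⟩
      simpa only [Complex.real_smul, mul_comm] using this)
  filter_upwards [h1, ae_expWeight_iff.1 (Lp.coeFn_zero ℂ 2 (expWeight ν))] with x hx hx'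
  rw [hx, hx', Pi.zero_apply]

/-- An element of the weighted space with vanishing weak derivative is zero. -/
lemma WeightedL2.eq_zero_of_forall_deriv (hν : 0 < ν) {k : WeightedL2 ν}
    (h : ∀ χ, IsTest χ → ∫ x, k x * deriv χ x = 0) : k = 0 :=
  WeightedL2.eq_zero_of_forall_test hν fun _ hθ =>
    functional_eq_zero_of_forall_deriv (Λ := fun θ => ∫ x, k x * θ x)
      (fun θ hθ t => by
        simp only [mul_sub]
        exact integral_sub (k.integrable_mul_test hν hθ) (k.integrable_mul_test hν (hθ.comp_sub t)))
      h (fun _ hθ => k.tendsto_translate hν hθ) hθ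

/-- An element of the weighted space with vanishing second weak derivative is zero. -/
lemma WeightedL2.eq_zero_of_forall_deriv_deriv (hν : 0 < ν) {k : WeightedL2 ν}
    (h : ∀ χ, IsTest χ → ∫ x, k x * deriv (deriv χ) x = 0) : k = 0 := by
  have hd : ∀ (θ : ℝ → ℂ) (t x : ℝ), deriv (fun x => θ (x - t)) x = deriv θ (x - t) :=
    fun θ t x => by rw [deriv_comp_sub_const]
  refine WeightedL2.eq_zero_of_forall_deriv hν fun θ hθ =>
    functional_eq_zero_of_forall_deriv (Λ := fun θ => ∫ x, k x * deriv θ x) (fun θ hθ t => ?_) h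
      (fun θ hθ => ?_) hθ
  · have h1 : ∀ x, deriv (fun x => θ x - θ (x - t)) x = deriv θ x - deriv θ (x - t) := fun x => by
      rw [deriv_fun_sub (hθ.1.differentiable (by simp) x)
        ((hθ.comp_sub t).1.differentiable (by simp) x), hd]
    simp only [h1, mul_sub, hd]
    exact integral_sub (k.integrable_mul_test hν (isTest_deriv hθ))
      (k.integrable_mul_test hν ((isTest_deriv hθ).comp_sub t))
  · simp only [hd]
    exact k.tendsto_translate hν (isTest_deriv hθ)

lemma integral_antideriv_mul_deriv (hν : 0 < ν) (f : WeightedL2 ν) {χ : ℝ → ℂ} (hχ : IsTest χ) :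
    ∫ x, antideriv hν f x * deriv χ x = -∫ x, f x * χ x := by
  rw [← (f.isPrimitive_invDeriv hν).isWeakDeriv χ hχ]
  refine integral_congr_ae ?_
  filter_upwards [antideriv_ae hν f] with x hx
  rw [hx]

lemma integral_sub_mul_test (hν : 0 < ν) (f g : WeightedL2 ν) {χ : ℝ → ℂ} (hχ : IsTest χ) :
    ∫ x, (f - g : WeightedL2 ν) x * χ x = (∫ x, f x * χ x) - ∫ x, g x * χ x := by
  rw [← integral_sub (f.integrable_mul_test hν hχ) (g.integrable_mul_test hν hχ)]
  refine integral_congr_ae ?_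
  filter_upwards [WeightedL2.coeFn_sub f g] with x hx
  rw [hx, sub_mul]

lemma integral_smul_mul (α : ℂ) (f : WeightedL2 ν) (χ : ℝ → ℂ) :
    ∫ x, (α • f : WeightedL2 ν) x * χ x = α * ∫ x, f x * χ x := by
  rw [← integral_const_mul]
  refine integral_congr_ae ?_
  filter_upwards [WeightedL2.coeFn_smul α f] with x hx
  rw [hx, mul_assoc]

/-- For elements of the weighted space, weak differentiation inverts `antideriv`. -/
lemma isWeakDeriv_iff (hν : 0 < ν) (v g : WeightedL2 ν) :
    IsWeakDeriv v g ↔ v = antideriv hν g := by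
  constructor
  · intro h
    rw [← sub_eq_zero]
    refine WeightedL2.eq_zero_of_forall_deriv hν fun χ hχ => ?_
    rw [integral_sub_mul_test hν _ _ (isTest_deriv hχ), integral_antideriv_mul_deriv hν g hχ,
      h χ hχ, sub_self]
  · rintro rfl χ hχ
    exact integral_antideriv_mul_deriv hν g hχ

lemma antideriv_injective (hν : 0 < ν) : Function.Injective (antideriv hν) := by
  rw [injective_iff_map_eq_zero]
  intro f hf
  refine WeightedL2.eq_zero_of_forall_test hν fun χ hχ => ?_
  have h1 := integral_antideriv_mul_deriv hν f hχ
  rw [hf, integral_congr_ae (g := fun _ => (0 : ℂ)) (by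
    filter_upwards [ae_expWeight_iff.1 (Lp.coeFn_zero ℂ 2 (expWeight ν))] with x hx
    rw [hx, Pi.zero_apply, zero_mul]), integral_zero] at h1
  exact neg_eq_zero.1 h1.symm

/-- Reduction to bounded operators: with `v = S g`, `S = ∂ₓ⁻¹`, the equation
`(1 - ∂ₓ²) w = ∂ₓ (L v + η² ∂ₓ⁻² v)` becomes `(1 - S²) w = (b - S a S - η² S⁴) g` when `-S²` is
applied to it. No constant of integration appears, since the weighted space contains no nonzero
polynomial. -/
lemma linOp_iff (hν : 0 < ν) (η : ℝ) (a b : ℝ →ᵇ ℝ) (v w : WeightedL2 ν) :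
    linOp ν η a b v w ↔ ∃ g, v = antideriv hν g ∧
      (1 - antideriv hν ^ 2 : WeightedL2 ν →L[ℂ] WeightedL2 ν) w =
        (mulOp ν b - antideriv hν * mulOp ν a * antideriv hν -
          (η : ℂ) ^ 2 • antideriv hν ^ 4) g := by
  refine exists_congr fun g => ?_
  rw [isWeakDeriv_iff hν]
  refine and_congr_right fun hv => ?_
  set S := antideriv hν
  set k : WeightedL2 ν := w - S (S w) - mulOp ν b g + S (mulOp ν a v) + (η : ℂ) ^ 2 • S (S (S v))
    with hk
  have hk0 : (1 - S ^ 2 : WeightedL2 ν →L[ℂ] WeightedL2 ν) w =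
      (mulOp ν b - S * mulOp ν a * S - (η : ℂ) ^ 2 • S ^ 4) g ↔ k = 0 := by
    rw [← sub_eq_zero, hk, hv]
    simp only [sub_apply, smul_apply, mul_apply_eq_comp, one_apply_eq_self, pow_succ, pow_zero,
      one_mul]
    rw [show ∀ a b c d e : WeightedL2 ν, a - b - (c - d - e) = a - b - c + d + e from
      fun a b c d e => by abel]
  have hpair : ∀ χ, IsTest χ → ∫ x, k x * deriv (deriv χ) x =
      -((∫ x, w x * (χ x - deriv (deriv χ) x)) + (slPairing a b v g (deriv χ)
          + (η : ℂ) ^ 2 * ∫ x, invDeriv (invDeriv v) x * deriv χ x)) := by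
    intro χ hχ
    have hχ' := isTest_deriv hχ
    have hχ'' := isTest_deriv hχ'
    have e1 : k = w - S (S w) - mulOp ν b g - ((-1 : ℂ) • S (mulOp ν a v) -
        (η : ℂ) ^ 2 • S (S (S v))) := by rw [hk]; module
    have e2 : ∫ x, mulOp ν b g x * deriv (deriv χ) x = ∫ x, (b x : ℂ) * g x * deriv (deriv χ) x :=
      integral_congr_ae (by filter_upwards [mulOp_ae b g] with x hx; rw [hx])
    have e3 : ∫ x, mulOp ν a v x * deriv χ x = ∫ x, (a x : ℂ) * v x * deriv χ x :=
      integral_congr_ae (by filter_upwards [mulOp_ae a v] with x hx; rw [hx])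
    have e4 : ∫ x, S (S v) x * deriv χ x = ∫ x, invDeriv (invDeriv v) x * deriv χ x :=
      integral_congr_ae (by
        filter_upwards [antideriv_ae hν (S v)] with x hx
        rw [hx, invDeriv_congr (antideriv_ae hν v)])
    have e5 : ∫ x, w x * (χ x - deriv (deriv χ) x) =
        (∫ x, w x * χ x) - ∫ x, w x * deriv (deriv χ) x := by
      simp only [mul_sub]
      exact integral_sub (w.integrable_mul_test hν hχ) (w.integrable_mul_test hν hχ'')
    rw [e1, integral_sub_mul_test hν _ _ hχ'', integral_sub_mul_test hν _ _ hχ'',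
      integral_sub_mul_test hν _ _ hχ'', integral_sub_mul_test hν _ _ hχ'', integral_smul_mul,
      integral_smul_mul, integral_antideriv_mul_deriv hν _ hχ',
      integral_antideriv_mul_deriv hν _ hχ, integral_antideriv_mul_deriv hν _ hχ',
      integral_antideriv_mul_deriv hν _ hχ', e2, e3, e4, e5, slPairing]
    ring
  rw [hk0]
  constructor
  · intro h
    refine WeightedL2.eq_zero_of_forall_deriv_deriv hν fun χ hχ => ?_
    rw [hpair χ hχ, h χ hχ]; ring
  · intro h χ hχ
    have h1 := hpair χ hχ
    rw [h, integral_congr_ae (g := fun _ => (0 : ℂ)) (by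
      filter_upwards [ae_expWeight_iff.1 (Lp.coeFn_zero ℂ 2 (expWeight ν))] with x hx
      rw [hx, Pi.zero_apply, zero_mul]), integral_zero] at h1
    linear_combination h1

end Antideriv

end

section

/-! ### The spectrum of the antiderivative and the background operator -/

section Resolvent

variable {ν : ℝ}

open scoped BoundedContinuousFunction

/-- The function `exp (-μ y)`, cut off on the left, is a dual weight if `Re μ > -ν`. -/
lemma isDualWeight_exp_Ioi {μ : ℂ} (hμ : -ν < μ.re) (a : ℝ) :
    IsDualWeight ν ((Ioi a).indicator fun y => Complex.exp (-(μ * y))) := by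
  refine ⟨(Continuous.aestronglyMeasurable (by fun_prop)).indicator measurableSet_Ioi,
    Real.exp (2 * (μ.re + ν) * |a|), μ.re + ν, by linarith, fun y => ?_⟩
  by_cases hy : y ∈ Ioi a
  · rw [indicator_of_mem hy, Complex.norm_exp, ← Real.exp_add, Real.exp_le_exp]
    rw [mem_Ioi] at hy
    have h1 : |y| - y ≤ 2 * |a| := by
      have := neg_abs_le a
      rcases abs_cases y with ⟨h, _⟩ | ⟨h, _⟩ <;> rw [h] <;> linarith [abs_nonneg a]
    have h2 : (-(μ * y)).re = -(μ.re * y) := by simp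
    rw [h2]
    nlinarith [mul_le_mul_of_nonneg_left h1 (by linarith : 0 ≤ μ.re + ν)]
  · rw [indicator_of_notMem hy, norm_zero]; positivity

/-- The function `exp (-μ y)`, cut off on the right, is a dual weight if `Re μ < -ν`. -/
lemma isDualWeight_exp_Iic {μ : ℂ} (hμ : μ.re < -ν) (a : ℝ) :
    IsDualWeight ν ((Iic a).indicator fun y => Complex.exp (-(μ * y))) := by
  refine ⟨(Continuous.aestronglyMeasurable (by fun_prop)).indicator measurableSet_Iic,
    Real.exp (2 * (-ν - μ.re) * |a|), -ν - μ.re, by linarith, fun y => ?_⟩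
  by_cases hy : y ∈ Iic a
  · rw [indicator_of_mem hy, Complex.norm_exp, ← Real.exp_add, Real.exp_le_exp]
    rw [mem_Iic] at hy
    have h1 : |y| + y ≤ 2 * |a| := by
      have := le_abs_self a
      rcases abs_cases y with ⟨h, _⟩ | ⟨h, _⟩ <;> rw [h] <;> linarith [abs_nonneg a]
    have h2 : (-(μ * y)).re = -(μ.re * y) := by simp
    rw [h2]
    nlinarith [mul_le_mul_of_nonneg_left h1 (by linarith : 0 ≤ -ν - μ.re)]
  · rw [indicator_of_notMem hy, norm_zero]; positivity

lemma IsDualWeight.integrableOn {s : Set ℝ} (hs : MeasurableSet s) {ρ : ℝ → ℂ}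
    (h : IsDualWeight ν (s.indicator ρ)) (f : WeightedL2 ν) :
    IntegrableOn (fun y => ρ y * f y) s := by
  rw [← integrable_indicator_iff hs]
  refine (h.integrable_mul f).congr (Eventually.of_forall fun x => ?_)
  by_cases hx : x ∈ s <;> simp [hx]

lemma isPrimitive_exp (μ : ℂ) :
    IsPrimitive (fun x : ℝ => Complex.exp (μ * x)) (fun x : ℝ => μ * Complex.exp (μ * x)) := by
  refine IsPrimitive.of_hasDerivAt (fun x => ?_) (by fun_prop)
  have h1 : HasDerivAt (fun x : ℝ => μ * (x : ℂ)) μ x := by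
    simpa using (Complex.ofRealCLM.hasDerivAt (x := x)).const_mul μ
  exact h1.cexp.congr_deriv (by ring)

/-- A solution `w` of `w' = μ w + f` bounded by means of an exponential kernel gives a preimage. -/
lemma exists_sub_smul_antideriv_eq (hν : 0 < ν) {μ : ℂ} {δ : ℝ} (hδ : 0 < δ) {f : WeightedL2 ν}
    {W : ℝ → ℂ} (hW : IsPrimitive W fun y => Complex.exp (-(μ * y)) * f y)
    (hb : ∀ x : ℝ, ‖Complex.exp (μ * x) * W x‖ₑ ≤ ((1 : NNReal) : ENNReal) *
      ∫⁻ y, ENNReal.ofReal (Real.exp (ν * (y - x) - δ * |x - y|)) * ‖f y‖ₑ) :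
    ∃ g, (1 - μ • antideriv hν) g = f := by
  have hp := (isPrimitive_exp μ).mul hW
  obtain ⟨K, hK⟩ := exists_eLpNorm_le ν hδ
  have hmem : MemLp (fun x : ℝ => Complex.exp (μ * x) * W x) 2 (expWeight ν) :=
    ⟨aestronglyMeasurable_expWeight.2 hp.continuous.aestronglyMeasurable,
      lt_of_le_of_lt (hK f _ 1 f.aestronglyMeasurable hb)
        (ENNReal.mul_lt_top (by simp) (Lp.memLp f).2)⟩
  set w : WeightedL2 ν := hmem.toLp _ with hw
  have hw_ae := WeightedL2.coeFn_toLp hmem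
  have hwg : w = antideriv hν (f + μ • w) := by
    rw [← isWeakDeriv_iff hν]
    have h1 : IsPrimitive (fun x : ℝ => Complex.exp (μ * x) * W x) (f + μ • w : WeightedL2 ν) := by
      refine hp.congr ?_
      filter_upwards [WeightedL2.coeFn_add f (μ • w), WeightedL2.coeFn_smul μ w, hw_ae]
        with x h1 h2 h3
      have h4 : Complex.exp (μ * x) * Complex.exp (-(μ * x)) = 1 := by
        rw [← Complex.exp_add, add_neg_cancel, Complex.exp_zero]
      rw [h1, h2, h3]
      linear_combination f x * h4
    intro χ hχ
    rw [← h1.isWeakDeriv χ hχ]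
    refine integral_congr_ae ?_
    filter_upwards [hw_ae] with x hx
    rw [hx]
  refine ⟨f + μ • w, ?_⟩
  rw [sub_apply, smul_apply, one_apply_eq_self, ← hwg]
  abel

lemma exp_kernel_right {μ : ℂ} {x y : ℝ} (h : x < y) :
    ‖Complex.exp (μ * x) * Complex.exp (-(μ * y))‖ₑ =
      ENNReal.ofReal (Real.exp (ν * (y - x) - (μ.re + ν) * |x - y|)) := by
  rw [← ofReal_norm, ← Complex.exp_add, Complex.norm_exp, abs_of_neg (by linarith)]
  congr 2
  simp
  ring

lemma exp_kernel_left {μ : ℂ} {x y : ℝ} (h : y ≤ x) :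
    ‖Complex.exp (μ * x) * Complex.exp (-(μ * y))‖ₑ =
      ENNReal.ofReal (Real.exp (ν * (y - x) - (-ν - μ.re) * |x - y|)) := by
  rw [← ofReal_norm, ← Complex.exp_add, Complex.norm_exp, abs_of_nonneg (by linarith)]
  congr 2
  simp
  ring

lemma isUnit_one_sub_smul_antideriv (hν : 0 < ν) {μ : ℂ} (hμ : μ.re ≠ -ν) :
    IsUnit (1 - μ • antideriv hν) := by
  rw [ContinuousLinearMap.isUnit_iff_bijective]
  constructor
  · rw [injective_iff_map_eq_zero]
    intro g hg
    rw [sub_apply, smul_apply, one_apply_eq_self, sub_eq_zero] at hg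
    set v := antideriv hν g with hv
    have h1 : IsPrimitive (invDeriv g) (fun x => μ * invDeriv g x) := by
      refine (g.isPrimitive_invDeriv hν).congr ?_
      filter_upwards [WeightedL2.coeFn_smul μ v, antideriv_ae hν g] with x h1 h2
      conv_lhs => rw [hg]
      rw [h1, hv, h2]
    -- `v` is a multiple of `exp (μ x)`
    have h2 := (isPrimitive_exp (-μ)).mul h1
    have h3 : ∀ x : ℝ, Complex.exp (-(μ * x)) * invDeriv g x = invDeriv g 0 := by
      intro x
      have h4 := h2.sub_eq 0 x
      rw [intervalIntegral.integral_congr (g := fun _ => (0 : ℂ)) (fun y _ => by ring),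
        intervalIntegral.integral_zero] at h4
      simp only [Complex.ofReal_zero, mul_zero, Complex.exp_zero, one_mul] at h4
      rw [← sub_eq_zero, ← neg_mul]
      exact h4
    have h5 : invDeriv g 0 = 0 := by
      have key : ∀ s : Set ℝ, MeasurableSet s → volume s = ⊤ →
          IsDualWeight ν (s.indicator fun y => Complex.exp (-(μ * y))) → invDeriv g 0 = 0 := by
        intro s hs hs' hd
        have h6 := hd.integrableOn hs v
        have h7 : IntegrableOn (fun _ : ℝ => invDeriv g 0) s := by
          refine h6.congr_fun_ae ?_
          filter_upwards [ae_restrict_of_ae (antideriv_ae hν g)] with x hx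
          rw [hv, hx, h3]
        rw [integrableOn_const_iff] at h7
        simpa [hs'] using h7
      rcases lt_or_gt_of_ne hμ with h | h
      · exact key _ measurableSet_Iic (by simp) (isDualWeight_exp_Iic h 0)
      · exact key _ measurableSet_Ioi (by simp) (isDualWeight_exp_Ioi h 0)
    have h6 : v = 0 := by
      refine WeightedL2.ext ?_
      filter_upwards [antideriv_ae hν g, ae_expWeight_iff.1 (Lp.coeFn_zero ℂ 2 (expWeight ν))]
        with x hx hx'
      rw [hx', hv, hx, Pi.zero_apply]
      have := h3 x
      rw [h5] at this
      exact (mul_eq_zero.1 this).resolve_left (Complex.exp_ne_zero _)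
    rw [hg, h6, smul_zero]
  · intro f
    rcases lt_or_gt_of_ne hμ with h | h
    · have hint := fun a => (isDualWeight_exp_Iic h a).integrableOn measurableSet_Iic f
      refine exists_sub_smul_antideriv_eq hν (δ := -ν - μ.re) (by linarith)
        (W := fun x => ∫ y in Iic x, Complex.exp (-(μ * y)) * f y) ⟨fun a b => ?_, fun a b => ?_⟩
        fun x => ?_
      · rw [intervalIntegrable_iff]
        exact (hint (max a b)).mono_set fun y hy => hy.2
      · exact intervalIntegral.integral_Iic_sub_Iic (hint a) (hint b)
      · rw [ENNReal.coe_one, one_mul, ← integral_const_mul]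
        simp only [← mul_assoc]
        exact enorm_setIntegral_le measurableSet_Iic fun y hy => (exp_kernel_left hy).le
    · have hint := fun a => (isDualWeight_exp_Ioi h a).integrableOn measurableSet_Ioi f
      refine exists_sub_smul_antideriv_eq hν (δ := μ.re + ν) (by linarith)
        (W := fun x => -∫ y in Ioi x, Complex.exp (-(μ * y)) * f y) ⟨fun a b => ?_, fun a b => ?_⟩
        fun x => ?_
      · rw [intervalIntegrable_iff]
        exact (hint (min a b)).mono_set fun y hy => hy.1
      · rw [← intervalIntegral.integral_Ioi_sub_Ioi' (hint a) (hint b)]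
        ring
      · rw [ENNReal.coe_one, one_mul, mul_neg, enorm_neg, ← integral_const_mul]
        simp only [← mul_assoc]
        exact enorm_setIntegral_le measurableSet_Ioi fun y hy => (exp_kernel_right hy).le

lemma isUnit_one_sub_antideriv_sq (hν : 0 < ν) (hν1 : ν < 1) :
    IsUnit (1 - antideriv hν ^ 2) := by
  have h1 : IsUnit (1 - (1 : ℂ) • antideriv hν) :=
    isUnit_one_sub_smul_antideriv hν (by simp; linarith)
  have h2 : IsUnit (1 - (-1 : ℂ) • antideriv hν) :=
    isUnit_one_sub_smul_antideriv hν (by simp; linarith)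
  have h3 := h1.mul h2
  rw [one_smul, neg_one_smul, sub_neg_eq_add] at h3
  rwa [show 1 - antideriv hν ^ 2 = (1 - antideriv hν) * (1 + antideriv hν) by
    rw [mul_add, sub_mul, sub_mul, sq]; simp]

/-- The spectrum of `∂ₓ⁻¹` consists of `0` and inverses of points on the line `Re μ = -ν`. -/
lemma inv_re_of_mem_spectrum_antideriv (hν : 0 < ν) {s : ℂ}
    (hs : s ∈ _root_.spectrum ℂ (antideriv hν)) (hs0 : s ≠ 0) : (s⁻¹).re = -ν := by
  by_contra hne
  have h1 := isUnit_one_sub_smul_antideriv hν hne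
  refine hs ?_
  have h2 : algebraMap ℂ _ s - antideriv hν =
      algebraMap ℂ (WeightedL2 ν →L[ℂ] WeightedL2 ν) s * (1 - s⁻¹ • antideriv hν) := by
    rw [mul_sub, mul_one, Algebra.algebraMap_eq_smul_one, smul_mul_smul_comm, mul_inv_cancel₀ hs0,
      one_smul, one_mul]
  rw [_root_.spectrum.mem_resolventSet_iff, h2]
  exact ((isUnit_iff_ne_zero.2 hs0).map (algebraMap ℂ _)).mul h1

/-- The spectral problem for `J (L + η² ∂ₓ⁻²)` as a problem for bounded operators. -/
lemma isEncodedBy_linOp (hν : 0 < ν) (hν1 : ν < 1) (η : ℝ) (a b : ℝ →ᵇ ℝ) :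
    IsEncodedBy (linOp ν η a b) (antideriv hν) (1 - antideriv hν ^ 2)
      ((mulOp ν b - antideriv hν * mulOp ν a * antideriv hν) - (η : ℂ) ^ 2 • antideriv hν ^ 4) :=
  ⟨isUnit_one_sub_antideriv_sq hν hν1, antideriv_injective hν, linOp_iff hν η a b⟩

lemma mulOp_const (r : ℝ) : mulOp ν (BoundedContinuousFunction.const ℝ r) = (r : ℂ) • 1 := by
  ext1 f
  refine WeightedL2.ext ?_
  filter_upwards [mulOp_ae (BoundedContinuousFunction.const ℝ r) f, WeightedL2.coeFn_smul (r : ℂ) f]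
    with x h1 h2
  rw [h1, smul_apply, one_apply_eq_self, h2]
  rfl

/-- The dispersion relation on the line `Re μ = -ν`: the weight pushes it into the left
half-plane. -/
lemma dispersion_re_le {h k ε ν : ℝ} (hk : 0 < k) (hν : 0 < ν) (hν1 : ν < 1) (hε : 0 ≤ ε)
    {μ z : ℂ} (hμ : μ.re = -ν)
    (hz : z * ((μ ^ 2 - 1) * μ) = (h + 2 * k) * μ ^ 4 - h * μ ^ 2 - ε) :
    z.re ≤ -((h + 2 * k) * ν - 2 * k * ν / (1 - ν ^ 2)) := by
  set ξ := μ.im with hξ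
  have hμ' : μ = -ν + ξ * Complex.I := by
    apply Complex.ext <;> simp [hμ, hξ]
  set q : ℂ := μ ^ 2 - 1 with hq
  have hμ0 : μ ≠ 0 := fun h0 => by rw [h0, Complex.zero_re] at hμ; linarith
  have hqre : q.re = ν ^ 2 - ξ ^ 2 - 1 := by
    rw [hq, hμ']; simp [sq]
  have hqim : q.im = -(2 * ν * ξ) := by
    rw [hq, hμ']; simp [sq]; ring
  have hν2 : 0 < 1 - ν ^ 2 := by nlinarith
  have hD : (1 - ν ^ 2) ^ 2 ≤ Complex.normSq q := by
    rw [Complex.normSq_apply, hqre, hqim]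
    nlinarith [mul_nonneg hν2.le (sq_nonneg ξ), sq_nonneg (ξ ^ 2), sq_nonneg (ν * ξ)]
  have hD0 : 0 < Complex.normSq q := lt_of_lt_of_le (by positivity) hD
  have hq0 : q ≠ 0 := Complex.normSq_pos.1 hD0
  have hz' : z = ((h + 2 * k : ℝ) : ℂ) * μ + ((2 * k : ℝ) : ℂ) * (μ / q) - (ε : ℂ) * (1 / (q * μ)) := by
    field_simp
    push_cast
    have : μ ^ 2 = q + 1 := by rw [hq]; ring
    linear_combination hz + (h + 2 * k) * μ ^ 2 * this
  have h1 : (μ / q).re ≤ ν / (1 - ν ^ 2) := by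
    rw [Complex.div_re, hμ, hqre, hqim, ← hξ, ← add_div, div_le_div_iff₀ hD0 hν2]
    have : (1 - ν ^ 2) * (1 - ν ^ 2 - ξ ^ 2) ≤ Complex.normSq q :=
      le_trans (by nlinarith [mul_nonneg hν2.le (sq_nonneg ξ)]) hD
    nlinarith
  have h2 : 0 ≤ (1 / (q * μ)).re := by
    rw [Complex.div_re, Complex.one_re, Complex.one_im, Complex.mul_re, hμ, hqre, hqim, ← hξ]
    simp only [zero_mul, zero_div, add_zero, one_mul]
    refine div_nonneg ?_ (Complex.normSq_nonneg _)
    nlinarith [mul_nonneg hν.le (sq_nonneg ξ), mul_pos hν hν2]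
  rw [hz', Complex.sub_re, Complex.add_re, Complex.re_ofReal_mul, Complex.re_ofReal_mul,
    Complex.re_ofReal_mul, hμ]
  have h3 := mul_le_mul_of_nonneg_left h1 (by linarith : 0 ≤ 2 * k)
  rw [← mul_div_assoc] at h3
  nlinarith [mul_nonneg hε h2]

open Polynomial in
/-- The spectrum of the background operator lies in a left half-plane. -/
theorem re_le_of_mem_spectrum_backgroundOp {k c : ℝ} (hk : 0 < k) (hc : 3 * k < c) (hν : 0 < ν)
    (hν₀ : ν < Real.sqrt ((c - 3 * k) / (c - k))) (η : ℝ) :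
    ∃ b₀ : ℝ, 0 < b₀ ∧ ∀ z ∈ spectrum (backgroundOp k c ν η), z.re ≤ -b₀ := by
  have hck : 0 < c - k := by linarith
  have hνsq : ν ^ 2 * (c - k) < c - 3 * k := by
    rw [Real.lt_sqrt hν.le, lt_div_iff₀ hck] at hν₀
    exact hν₀
  have hν1 : ν < 1 := by
    by_contra! h1
    nlinarith [mul_nonneg (by nlinarith : 0 ≤ ν ^ 2 - 1) hck.le]
  have hν2 : 0 < 1 - ν ^ 2 := by nlinarith
  refine ⟨(c - k) * ν - 2 * k * ν / (1 - ν ^ 2), ?_, fun z hz => ?_⟩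
  · rw [sub_pos, div_lt_iff₀ hν2]
    nlinarith
  set S := antideriv hν with hS
  set q : ℂ[X] := C ((c - k : ℝ) : ℂ) - C ((c - 3 * k : ℝ) : ℂ) * X ^ 2
    - C ((η : ℂ) ^ 2) * X ^ 4 - C z * ((1 - X ^ 2) * X) with hq
  have hunit : ¬ IsUnit (aeval S q) := by
    intro hu
    refine hz (IsEncodedBy.mem_resolventSet
      (isEncodedBy_linOp hν hν1 η (BoundedContinuousFunction.const ℝ (c - 3 * k))
        (BoundedContinuousFunction.const ℝ (c - k))) ?_)
    convert hu using 1
    rw [mulOp_const, mulOp_const, hq]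
    simp only [map_sub, map_mul, map_pow, aeval_C, aeval_X, map_one,
      Algebra.algebraMap_eq_smul_one, smul_mul_assoc, one_mul, mul_smul_comm, mul_one, ← hS, ← sq]
    rw [_root_.smul_pow, one_pow, smul_mul_assoc, one_mul]
  have hq0 : q.eval 0 ≠ 0 := by
    simp [hq]
    exact_mod_cast hck.ne'
  have hq_ne : q ≠ 0 := fun h0 => hq0 (by rw [h0, eval_zero])
  have hroot : ∃ s ∈ _root_.spectrum ℂ S, q.eval s = 0 := by
    refine _root_.spectrum.exists_mem_of_not_isUnit_aeval_prod fun hu => hunit ?_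
    rw [(IsAlgClosed.splits q).eq_prod_roots, map_mul, aeval_C]
    exact ((isUnit_iff_ne_zero.2 (leadingCoeff_ne_zero.2 hq_ne)).map (algebraMap ℂ _)).mul hu
  obtain ⟨s, hs, hqs⟩ := hroot
  have hs0 : s ≠ 0 := fun h0 => hq0 (h0 ▸ hqs)
  have hre := inv_re_of_mem_spectrum_antideriv hν hs hs0
  have := dispersion_re_le (h := c - 3 * k) hk hν hν1 (sq_nonneg η) hre (z := z) ?_
  · rwa [show c - 3 * k + 2 * k = c - k by ring] at this
  · simp only [hq, eval_sub, eval_mul, eval_C, eval_pow, eval_X, eval_one] at hqs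
    field_simp
    push_cast at hqs ⊢
    linear_combination -hqs

end Resolvent

end

section

/-! ### The profile of a solitary wave -/

/-- Coordinates along a solitary wave `φ = k + s` with speed `c = h + 3 k`. With
`b = c - φ = h + 2 k - s` the profile equation is `b s'² = s² (h - s)`. The rate of decay
`r = -s' / s` increases from `-n` to `n`, where `n² = h / (h + 2 k)`, the function `q` is the
phase `∫ dx / b`, and the crest is at `x₀`. Every function of the argument below is a rational
function of `s`, `r` and `q`. -/
structure IsWaveChart (k h n : ℝ) (s r q : ℝ → ℝ) (x₀ : ℝ) : Prop where
  k_pos : 0 < k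
  h_pos : 0 < h
  n_pos : 0 < n
  n_sq : n ^ 2 * (h + 2 * k) = h
  s_pos : ∀ x, 0 < s x
  s_le : ∀ x, s x ≤ h
  r_sq : ∀ x, (h + 2 * k - s x) * r x ^ 2 = h - s x
  hasDerivAt_s : ∀ x, HasDerivAt s (-(r x * s x)) x
  hasDerivAt_r : ∀ x, HasDerivAt r (k * s x / (h + 2 * k - s x) ^ 2) x
  hasDerivAt_q : ∀ x, HasDerivAt q (1 / (h + 2 * k - s x)) x
  r_crest : r x₀ = 0
  q_crest : q x₀ = 0

/-- The derivative of a function with a limit at infinity tends to zero along some sequence. -/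
lemma exists_tendsto_deriv_zero {f f' : ℝ → ℝ} {l : ℝ} (hf : ∀ x, HasDerivAt f (f' x) x)
    (hl : Tendsto f atTop (𝓝 l)) :
    ∃ y : ℝ → ℝ, Tendsto y atTop atTop ∧ Tendsto (fun x => f' (y x)) atTop (𝓝 0) := by
  have h1 : ∀ x : ℝ, ∃ y > x, f' y = f (x + 1) - f x := by
    intro x
    obtain ⟨y, hy, hy'⟩ := exists_hasDerivAt_eq_slope f f' (by linarith : x < x + 1)
      (fun y _ => (hf y).continuousAt.continuousWithinAt) (fun y _ => hf y)
    exact ⟨y, hy.1, by rw [hy']; ring⟩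
  choose y hy hy' using h1
  refine ⟨y, tendsto_atTop_mono (fun x => (hy x).le) tendsto_id, ?_⟩
  simp only [hy']
  rw [← sub_self l]
  exact (hl.comp (tendsto_atTop_add_const_right _ _ tendsto_id)).sub hl

lemma exists_deriv_eq_zero_of_tendsto {f f' : ℝ → ℝ} {l : ℝ} (hf : ∀ x, HasDerivAt f (f' x) x)
    (h1 : Tendsto f atTop (𝓝 l)) (h2 : Tendsto f atBot (𝓝 l)) : ∃ x, f' x = 0 := by
  by_contra! hne
  have h3 : deriv f = f' := funext fun x => (hf x).deriv
  have hc : Continuous f := continuous_iff_continuousAt.2 fun x => (hf x).continuousAt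
  rcases hasDerivWithinAt_forall_lt_or_forall_gt_of_forall_ne (s := univ) convex_univ
    (fun x _ => (hf x).hasDerivWithinAt) (fun x _ => hne x) with h | h
  · have hm : StrictAnti f := strictAnti_of_deriv_neg fun x => by rw [h3]; exact h x trivial
    have := hm.antitone.le_of_tendsto h1 1
    have := hm.antitone.ge_of_tendsto h2 0
    have := hm (zero_lt_one' ℝ)
    linarith
  · have hm : StrictMono f := strictMono_of_deriv_pos fun x => by rw [h3]; exact h x trivial
    have := hm.monotone.ge_of_tendsto h1 1
    have := hm.monotone.le_of_tendsto h2 0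
    have := hm (zero_lt_one' ℝ)
    linarith

lemma exists_forall_eq_of_hasDerivAt_zero {f : ℝ → ℝ} (hf : ∀ x, HasDerivAt f 0 x) :
    ∃ K, ∀ x, f x = K :=
  ⟨f 0, fun x =>
    is_const_of_deriv_eq_zero (fun x => (hf x).differentiableAt) (fun x => (hf x).deriv) x 0⟩

/-- A function with `(s')² ≤ s²` which vanishes somewhere vanishes everywhere. -/
lemma eq_zero_of_sq_deriv_le {s s' : ℝ → ℝ} (hs : ∀ x, HasDerivAt s (s' x) x)
    (hle : ∀ x, s' x ^ 2 ≤ s x ^ 2) {x₁ : ℝ} (h0 : s x₁ = 0) (x : ℝ) : s x = 0 := by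
  have hE : ∀ (r x : ℝ), HasDerivAt (fun x => s x ^ 2 * Real.exp (r * x))
      ((2 * s x * s' x + r * s x ^ 2) * Real.exp (r * x)) x := by
    intro r x
    have h1 := ((hs x).pow 2).mul (((hasDerivAt_id x).const_mul r).exp)
    refine h1.congr_deriv ?_
    simp
    ring
  have h2 : ∀ x, |s x * s' x| ≤ s x ^ 2 := by
    intro x
    rw [abs_le]
    constructor <;> nlinarith [hle x, sq_nonneg (s x - s' x), sq_nonneg (s x + s' x)]
  have key : s x ^ 2 ≤ 0 := by
    rcases le_total x x₁ with h | h
    · have hm : Monotone fun x => s x ^ 2 * Real.exp (2 * x) := by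
        refine monotone_of_deriv_nonneg (fun x => (hE 2 x).differentiableAt) fun x => ?_
        rw [(hE 2 x).deriv]
        exact mul_nonneg (by nlinarith [abs_le.1 (h2 x)]) (Real.exp_pos _).le
      have := hm h
      simp only [h0] at this
      nlinarith [Real.exp_pos (2 * x)]
    · have hm : Antitone fun x => s x ^ 2 * Real.exp (-2 * x) := by
        refine antitone_of_deriv_nonpos (fun x => (hE (-2) x).differentiableAt) fun x => ?_
        rw [(hE (-2) x).deriv]
        exact mul_nonpos_of_nonpos_of_nonneg (by nlinarith [abs_le.1 (h2 x)]) (Real.exp_pos _).le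
      have := hm h
      simp only [h0] at this
      nlinarith [Real.exp_pos (-2 * x)]
  nlinarith [sq_nonneg (s x)]

section

variable {k c : ℝ} {φ : ℝ → ℝ}

lemma IsSolitaryWave.hasDerivAt_iteratedDeriv (hφ : IsSolitaryWave k c φ) (m : ℕ) (x : ℝ) :
    HasDerivAt (iteratedDeriv m φ) (iteratedDeriv (m + 1) φ x) x := by
  rw [iteratedDeriv_succ]
  exact (hφ.smooth.differentiable_iteratedDeriv m (by exact_mod_cast WithTop.coe_lt_top _)
    ).differentiableAt.hasDerivAt

/-- The first integrals of the profile equation. -/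
lemma IsSolitaryWave.first_integrals (hφ : IsSolitaryWave k c φ) (hk : 0 < k) (hc : 3 * k < c)
    (x : ℝ) :
    (c - φ x) * deriv φ x ^ 2 = (φ x - k) ^ 2 * (c - 2 * k - φ x) ∧
    (c - φ x) * iteratedDeriv 2 φ x =
      deriv φ x ^ 2 / 2 + (c - 3 * k) * (φ x - k) - 3 / 2 * (φ x - k) ^ 2 := by
  have d0 : ∀ x, HasDerivAt φ (deriv φ x) x := fun x => by
    have := hφ.hasDerivAt_iteratedDeriv 0 x
    rwa [iteratedDeriv_zero, zero_add, iteratedDeriv_one] at this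
  have d1 : ∀ x, HasDerivAt (deriv φ) (iteratedDeriv 2 φ x) x := fun x => by
    have := hφ.hasDerivAt_iteratedDeriv 1 x
    rwa [iteratedDeriv_one] at this
  have d2 := hφ.hasDerivAt_iteratedDeriv 2
  -- the two integration constants
  obtain ⟨K₁, hK₁⟩ : ∃ K, ∀ x, (c - φ x) * iteratedDeriv 2 φ x - deriv φ x ^ 2 / 2
      - (c - 3 * k) * (φ x - k) + 3 / 2 * (φ x - k) ^ 2 = K := by
    refine exists_forall_eq_of_hasDerivAt_zero fun x => ?_
    refine HasDerivAt.congr_deriv ((((((d0 x).const_sub c).mul (d2 x)).sub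
      (((d1 x).pow 2).div_const 2)).sub (((d0 x).sub_const k).const_mul (c - 3 * k))).add
      ((((d0 x).sub_const k).pow 2).const_mul (3 / 2))) ?_
    have := hφ.travelling x
    simp only [Nat.cast_ofNat, Nat.add_one_sub_one, pow_one]
    linear_combination this
  obtain ⟨K₂, hK₂⟩ : ∃ K, ∀ x, (c - φ x) * deriv φ x ^ 2 - (c - 3 * k) * (φ x - k) ^ 2
      + (φ x - k) ^ 3 - 2 * K₁ * (φ x - k) = K := by
    refine exists_forall_eq_of_hasDerivAt_zero fun x => ?_
    refine HasDerivAt.congr_deriv ((((((d0 x).const_sub c).mul ((d1 x).pow 2)).sub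
      ((((d0 x).sub_const k).pow 2).const_mul (c - 3 * k))).add
      (((d0 x).sub_const k).pow 3)).sub (((d0 x).sub_const k).const_mul (2 * K₁))) ?_
    simp only [Nat.cast_ofNat, Nat.add_one_sub_one, pow_one, Pi.pow_apply]
    linear_combination (2 * deriv φ x) * hK₁ x
  have hck : c - k ≠ 0 := by linarith
  have t0 : Tendsto (fun x => φ x - k) atTop (𝓝 0) := by
    simpa using hφ.tendsto_atTop.sub_const k
  have tb : Tendsto (fun x => c - φ x) atTop (𝓝 (c - k)) := hφ.tendsto_atTop.const_sub c
  have t1' : Tendsto (fun x => deriv φ x ^ 2) atTop (𝓝 (K₂ / (c - k))) := by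
    have h1 : Tendsto (fun x => (K₂ + (c - 3 * k) * (φ x - k) ^ 2 - (φ x - k) ^ 3
        + 2 * K₁ * (φ x - k)) / (c - φ x)) atTop (𝓝 ((K₂ + (c - 3 * k) * 0 ^ 2 - 0 ^ 3
        + 2 * K₁ * 0) / (c - k))) :=
      ((((t0.pow 2).const_mul _).const_add _).sub (t0.pow 3) |>.add (t0.const_mul _)).div tb hck
    simp only [ne_eq, OfNat.ofNat_ne_zero, not_false_eq_true, zero_pow, mul_zero, add_zero,
      sub_zero] at h1
    refine h1.congr' ?_
    filter_upwards [tb.eventually_ne hck] with x hx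
    rw [← hK₂ x]
    field_simp
    ring
  have hK₂0 : K₂ = 0 := by
    obtain ⟨y, hy, hy'⟩ := exists_tendsto_deriv_zero d0 hφ.tendsto_atTop
    have h4 := tendsto_nhds_unique (t1'.comp hy) (hy'.pow 2)
    rw [zero_pow two_ne_zero, div_eq_zero_iff] at h4
    exact h4.resolve_right hck
  rw [hK₂0, zero_div] at t1'
  have t1 : Tendsto (deriv φ) atTop (𝓝 0) := by
    have := (t1'.sqrt).congr fun x => Real.sqrt_sq_eq_abs _
    rw [Real.sqrt_zero] at this
    exact (tendsto_zero_iff_abs_tendsto_zero _).2 this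
  have hK₁0 : K₁ = 0 := by
    have h1 : Tendsto (iteratedDeriv 2 φ) atTop (𝓝 (K₁ / (c - k))) := by
      have h1 : Tendsto (fun x => (K₁ + deriv φ x ^ 2 / 2 + (c - 3 * k) * (φ x - k)
          - 3 / 2 * (φ x - k) ^ 2) / (c - φ x)) atTop (𝓝 ((K₁ + 0 / 2 + (c - 3 * k) * 0
          - 3 / 2 * 0 ^ 2) / (c - k))) :=
        ((((t1'.div_const 2).const_add _).add (t0.const_mul _)).sub
          ((t0.pow 2).const_mul _)).div tb hck
      simp only [ne_eq, OfNat.ofNat_ne_zero, not_false_eq_true, zero_pow, mul_zero, add_zero,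
        sub_zero, zero_div] at h1
      refine h1.congr' ?_
      filter_upwards [tb.eventually_ne hck] with x hx
      rw [← hK₁ x]
      field_simp
      ring
    obtain ⟨y, hy, hy'⟩ := exists_tendsto_deriv_zero d1 t1
    have h2 := tendsto_nhds_unique (h1.comp hy) hy'
    rw [div_eq_zero_iff] at h2
    exact h2.resolve_right hck
  have e1 := hK₁ x
  have e2 := hK₂ x
  rw [hK₁0] at e1 e2
  rw [hK₂0] at e2
  exact ⟨by linear_combination e2, by linear_combination e1⟩

/-- Every smooth solitary wave has a chart. -/
lemma IsSolitaryWave.exists_chart (hφ : IsSolitaryWave k c φ) (hk : 0 < k) (hc : 3 * k < c) :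
    ∃ (r q : ℝ → ℝ) (x₀ : ℝ), IsWaveChart k (c - 3 * k) (Real.sqrt ((c - 3 * k) / (c - k)))
      (fun x => φ x - k) r q x₀ := by
  have d0 : ∀ x, HasDerivAt φ (deriv φ x) x := fun x => by
    have := hφ.hasDerivAt_iteratedDeriv 0 x
    rwa [iteratedDeriv_zero, zero_add, iteratedDeriv_one] at this
  have d1 : ∀ x, HasDerivAt (deriv φ) (iteratedDeriv 2 φ x) x := fun x => by
    have := hφ.hasDerivAt_iteratedDeriv 1 x
    rwa [iteratedDeriv_one] at this
  have hcont : Continuous φ := hφ.smooth.continuous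
  set h := c - 3 * k with hh
  set s : ℝ → ℝ := fun x => φ x - k with hs
  have hscont : Continuous s := hcont.sub continuous_const
  have ds : ∀ x, HasDerivAt s (deriv φ x) x := fun x => (d0 x).sub_const k
  have hh0 : 0 < h := by linarith
  have e1 : ∀ x, (h + 2 * k - s x) * deriv φ x ^ 2 = s x ^ 2 * (h - s x) := fun x => by
    have := (hφ.first_integrals hk hc x).1
    simp only [hs, hh]
    linear_combination this
  have e2 : ∀ x, (h + 2 * k - s x) * iteratedDeriv 2 φ x =
      deriv φ x ^ 2 / 2 + h * s x - 3 / 2 * s x ^ 2 := fun x => by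
    have := (hφ.first_integrals hk hc x).2
    simp only [hs, hh]
    linear_combination this
  have t0 : Tendsto s atTop (𝓝 0) := by simpa using hφ.tendsto_atTop.sub_const k
  have t0' : Tendsto s atBot (𝓝 0) := by simpa using hφ.tendsto_atBot.sub_const k
  -- values between `h` and `h + 2 k` are excluded by the first integral
  have hle : ∀ x, s x ≤ h := by
    intro x
    by_contra! hx
    have hx2 : ∃ y, h < s y ∧ s y < h + 2 * k := by
      by_cases hx' : s x < h + 2 * k
      · exact ⟨x, hx, hx'⟩
      obtain ⟨z, hz⟩ := ((t0.eventually (gt_mem_nhds hh0)).exists)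
      obtain ⟨y, hy⟩ := mem_range_of_exists_le_of_exists_ge hscont (c := h + k)
        ⟨z, by linarith⟩ ⟨x, by linarith⟩
      exact ⟨y, by linarith, by linarith⟩
    obtain ⟨y, hy1, hy2⟩ := hx2
    have h1 := e1 y
    have h2 : 0 ≤ (h + 2 * k - s y) * deriv φ y ^ 2 := mul_nonneg (by linarith) (sq_nonneg _)
    have h3 : 0 < s y ^ 2 * (s y - h) := mul_pos (pow_pos (by linarith) 2) (by linarith)
    linarith
  have hsq : ∀ x, deriv φ x ^ 2 ≤ s x ^ 2 := by
    intro x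
    have h1 := e1 x
    have h2 := hle x
    by_contra! h3
    nlinarith [mul_lt_mul_of_pos_left h3 (by linarith : 0 < h + 2 * k - s x), sq_nonneg (s x)]
  have hne : ∀ x, s x ≠ 0 := by
    intro x hx
    obtain ⟨y, hy⟩ := hφ.nonconstant
    exact hy (sub_eq_zero.1 (eq_zero_of_sq_deriv_le ds hsq hx y))
  obtain ⟨x₀, hx₀⟩ := exists_deriv_eq_zero_of_tendsto ds t0 t0'
  have hs0 : s x₀ = h := by
    have h1 := e1 x₀
    rw [hx₀] at h1
    have h2 : s x₀ ^ 2 * (h - s x₀) = 0 := by rw [← h1]; ring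
    have := (mul_eq_zero.1 h2).resolve_left (pow_ne_zero 2 (hne x₀))
    linarith
  have hpos : ∀ x, 0 < s x := by
    intro x
    by_contra! hx
    obtain ⟨y, hy⟩ := mem_range_of_exists_le_of_exists_ge hscont (c := 0)
      ⟨x, hx⟩ ⟨x₀, by rw [hs0]; exact hh0.le⟩
    exact hne y hy
  have hb : ∀ x, 0 < h + 2 * k - s x := fun x => by linarith [hle x]
  set n := Real.sqrt (h / (c - k)) with hn
  have hck : 0 < c - k := by linarith
  have hn0 : 0 < n := Real.sqrt_pos.2 (div_pos hh0 hck)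
  have hnsq : n ^ 2 * (h + 2 * k) = h := by
    rw [hn, Real.sq_sqrt (div_pos hh0 hck).le, show h + 2 * k = c - k by rw [hh]; ring]
    field_simp
  have hint : Continuous fun x => 1 / (h + 2 * k - s x) :=
    continuous_const.div (by fun_prop) fun x => (hb x).ne'
  refine ⟨fun x => -deriv φ x / s x,
    fun x => ∫ y in x₀..x, 1 / (h + 2 * k - s y), x₀,
    hk, hh0, hn0, hnsq, hpos, hle, fun x => ?_, fun x => ?_, fun x => ?_, fun x => ?_, ?_, ?_⟩
  · have := hne x
    field_simp
    linear_combination e1 x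
  · have := hne x
    refine (ds x).congr_deriv ?_
    field_simp
  · have h1 := hne x
    have h2 := (hb x).ne'
    refine ((d1 x).neg.div (ds x) h1).congr_deriv ?_
    have h3 : deriv φ x ^ 2 = s x ^ 2 * (h - s x) / (h + 2 * k - s x) := by
      rw [eq_div_iff h2, ← e1 x]; ring
    have h4 : iteratedDeriv 2 φ x =
        (deriv φ x ^ 2 / 2 + h * s x - 3 / 2 * s x ^ 2) / (h + 2 * k - s x) := by
      rw [eq_div_iff h2, ← e2 x]; ring
    rw [h4, Pi.neg_apply]
    field_simp
    rw [h3]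
    field_simp
    ring
  · exact intervalIntegral.integral_hasDerivAt_right (hint.intervalIntegrable _ _)
      (hint.stronglyMeasurableAtFilter _ _) hint.continuousAt
  · simp [hx₀]
  · simp

end

end

section

/-! ### The kernel, the generalized kernel and the second solution -/

namespace IsWaveChart

section Formulas

variable (k h : ℝ) (s r q : ℝ → ℝ) (x₀ : ℝ)

/-- The reciprocal of `c - φ = h + 2 k - s`. -/
def u (x : ℝ) : ℝ := (h + 2 * k - s x)⁻¹

/-- The first derivative of the wave. -/
def d1 (x : ℝ) : ℝ := -(r x * s x)

/-- The second derivative of the wave. -/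
def d2 (x : ℝ) : ℝ := s x * (h - s x) * u k h s x - k * s x ^ 2 * u k h s x ^ 2

/-- The solution of `L v = s - s''` that is obtained by varying the speed of the wave: it spans
the generalized kernel modulo the kernel. -/
def gen (x : ℝ) : ℝ := s x * (k * q x * r x - 1) / h

/-- The derivative of `gen`. -/
def gen1 (x : ℝ) : ℝ :=
  (-(r x * s x) * (k * q x * r x - 1) + s x * k * (r x + k * q x * s x * u k h s x) * u k h s x) / h

/-- The auxiliary function in the second solution of `L v = 0`. -/
def aux (x : ℝ) : ℝ :=
  -∫ y in x₀..x, u k h s y * (h ^ 3 + 2 * k * (h ^ 2 + h * s y + s y ^ 2)) / (s y ^ 2 * h ^ 3)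

/-- A solution of `L v = 0` independent of the derivative of the wave. It grows at both ends. -/
def sol (x : ℝ) : ℝ := s x * (r x * aux k h s x₀ x + 2 / h ^ 3)

/-- The derivative of `sol`. -/
def sol1 (x : ℝ) : ℝ :=
  -(r x * s x) * (r x * aux k h s x₀ x + 2 / h ^ 3) + k * s x ^ 2 * u k h s x ^ 2 * aux k h s x₀ x
    - r x * u k h s x * (h ^ 3 + 2 * k * (h ^ 2 + h * s x + s x ^ 2)) / (s x * h ^ 3)

end Formulas

variable {k h n : ℝ} {s r q : ℝ → ℝ} {x₀ : ℝ}

section Basic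

variable (W : IsWaveChart k h n s r q x₀)
include W

lemma b_ge (x : ℝ) : 2 * k ≤ h + 2 * k - s x := by linarith [W.s_le x]

lemma b_pos (x : ℝ) : 0 < h + 2 * k - s x := by linarith [W.s_le x, W.k_pos]

lemma u_mul (x : ℝ) : u k h s x * (h + 2 * k - s x) = 1 := inv_mul_cancel₀ (W.b_pos x).ne'

lemma u_pos (x : ℝ) : 0 < u k h s x := inv_pos.2 (W.b_pos x)

lemma two_k_mul_u_le (x : ℝ) : 2 * k * u k h s x ≤ 1 := by
  have := W.u_mul x
  nlinarith [W.u_pos x, W.b_ge x]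

lemma one_le_mul_u (x : ℝ) : 1 ≤ (h + 2 * k) * u k h s x := by
  have := W.u_mul x
  nlinarith [W.u_pos x, W.s_pos x]

lemma r_sq' (x : ℝ) : r x ^ 2 = 1 - 2 * k * u k h s x := by
  have h1 := W.r_sq x
  have h2 := W.u_mul x
  linear_combination u k h s x * h1 + (1 - r x ^ 2) * h2

lemma n_sq' : (h + 2 * k) * (1 - n ^ 2) = 2 * k := by linear_combination -W.n_sq

lemma r_sq_lt (x : ℝ) : r x ^ 2 < n ^ 2 := by
  have h1 := W.r_sq' x
  have h2 := W.n_sq'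
  have h3 : 1 < (h + 2 * k) * u k h s x := by
    have := W.u_mul x
    nlinarith [W.u_pos x, W.s_pos x, mul_pos (W.u_pos x) (W.s_pos x)]
  have h4 : 0 < h + 2 * k := by linarith [W.h_pos, W.k_pos]
  have h5 : (h + 2 * k) * r x ^ 2 < (h + 2 * k) * n ^ 2 := by
    rw [h1]; nlinarith [W.k_pos]
  exact lt_of_mul_lt_mul_left h5 h4.le

lemma abs_r_lt (x : ℝ) : |r x| < n := abs_lt_of_sq_lt_sq (W.r_sq_lt x) W.n_pos.le

lemma hasDerivAt_r' (x : ℝ) : HasDerivAt r (k * s x * u k h s x ^ 2) x :=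
  (W.hasDerivAt_r x).congr_deriv (by rw [u, div_eq_mul_inv, inv_pow])

lemma hasDerivAt_q' (x : ℝ) : HasDerivAt q (u k h s x) x :=
  (W.hasDerivAt_q x).congr_deriv (one_div _)

lemma hasDerivAt_b (x : ℝ) : HasDerivAt (fun x => h + 2 * k - s x) (r x * s x) x :=
  ((W.hasDerivAt_s x).const_sub (h + 2 * k)).congr_deriv (neg_neg _)

lemma hasDerivAt_u (x : ℝ) : HasDerivAt (u k h s) (-(u k h s x ^ 2 * (r x * s x))) x := by
  refine ((W.hasDerivAt_b x).inv (W.b_pos x).ne').congr_deriv ?_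
  rw [u]
  field_simp

lemma continuous_s : Continuous s :=
  continuous_iff_continuousAt.2 fun x => (W.hasDerivAt_s x).continuousAt

lemma continuous_r : Continuous r :=
  continuous_iff_continuousAt.2 fun x => (W.hasDerivAt_r x).continuousAt

lemma continuous_q : Continuous q :=
  continuous_iff_continuousAt.2 fun x => (W.hasDerivAt_q x).continuousAt

lemma continuous_u : Continuous (u k h s) :=
  continuous_iff_continuousAt.2 fun x => (W.hasDerivAt_u x).continuousAt

lemma hasDerivAt_d1 (x : ℝ) : HasDerivAt (d1 s r) (d2 k h s x) x := by
  refine ((W.hasDerivAt_r' x).mul (W.hasDerivAt_s x)).neg.congr_deriv ?_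
  have h1 := W.u_mul x
  have h2 := W.r_sq' x
  rw [d2]
  generalize u k h s x = u at *
  grind

lemma hasDerivAt_b_mul_d2 (x : ℝ) : HasDerivAt (fun x => (h + 2 * k - s x) * d2 k h s x)
    ((h - 3 * s x + d2 k h s x) * d1 s r x) x := by
  have h0 : (fun x => (h + 2 * k - s x) * d2 k h s x) =
      fun x => s x * (h - s x) - k * s x ^ 2 * u k h s x := by
    funext x
    have h1 := W.u_mul x
    rw [d2]
    generalize u k h s x = u at *
    grind
  rw [h0]
  refine HasDerivAt.congr_deriv (((W.hasDerivAt_s x).mul ((W.hasDerivAt_s x).const_sub h)).sub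
    ((((W.hasDerivAt_s x).pow 2).const_mul k).mul (W.hasDerivAt_u x))) ?_
  have h1 := W.u_mul x
  simp only [d1, d2, Nat.cast_ofNat, Nat.add_one_sub_one, pow_one, Pi.pow_apply]
  generalize u k h s x = u at *
  grind

lemma hasDerivAt_gen (x : ℝ) : HasDerivAt (gen k h s r q) (gen1 k h s r q x) x := by
  refine HasDerivAt.congr_deriv (((W.hasDerivAt_s x).mul ((((W.hasDerivAt_q' x).const_mul k).mul
    (W.hasDerivAt_r' x)).sub_const 1)).div_const h) ?_
  simp only [gen1, Pi.mul_apply]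
  ring

/-- Varying the speed of the wave gives `L v = s - s''`. -/
lemma hasDerivAt_b_mul_gen1 (x : ℝ) :
    HasDerivAt (fun x => (h + 2 * k - s x) * gen1 k h s r q x)
    ((h - 3 * s x + d2 k h s x) * gen k h s r q x - (s x - d2 k h s x)) x := by
  have h0 : (fun x => (h + 2 * k - s x) * gen1 k h s r q x) = fun x =>
      (-(r x * s x) * (k * q x * r x - 1) * (h + 2 * k - s x)
        + s x * k * (r x + k * q x * s x * u k h s x)) / h := by
    funext x
    have h1 := W.u_mul x
    rw [gen1, ← mul_div_assoc]
    congr 1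
    generalize u k h s x = u at *
    grind
  rw [h0]
  have hs := W.hasDerivAt_s x
  have hr := W.hasDerivAt_r' x
  have hq := W.hasDerivAt_q' x
  have hu := W.hasDerivAt_u x
  have hb := W.hasDerivAt_b x
  refine HasDerivAt.congr_deriv ((((((hr.mul hs).neg.mul (((hq.const_mul k).mul hr).sub_const 1)).mul
    hb)).add ((hs.mul_const k).mul (hr.add (((hq.const_mul k).mul hs).mul hu)))).div_const h) ?_
  have h1 := W.u_mul x
  have h2 := W.r_sq' x
  have h3 := W.h_pos.ne'
  have h4 : gen k h s r q x * h = s x * (k * q x * r x - 1) := div_mul_cancel₀ _ h3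
  rw [div_eq_iff h3]
  simp only [d2, Pi.mul_apply, Pi.neg_apply, Pi.add_apply]
  generalize gen k h s r q x = g at *
  generalize u k h s x = u at *
  grind

lemma hasDerivAt_aux (x : ℝ) : HasDerivAt (aux k h s x₀)
    (-(u k h s x * (h ^ 3 + 2 * k * (h ^ 2 + h * s x + s x ^ 2)) / (s x ^ 2 * h ^ 3))) x := by
  have hc : Continuous fun y => u k h s y * (h ^ 3 + 2 * k * (h ^ 2 + h * s y + s y ^ 2))
      / (s y ^ 2 * h ^ 3) := by
    have := W.continuous_s
    have := W.continuous_u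
    refine Continuous.div (by fun_prop) (by fun_prop) fun y => ?_
    have := W.s_pos y
    have := W.h_pos
    positivity
  exact (intervalIntegral.integral_hasDerivAt_right (hc.intervalIntegrable _ _)
      (hc.stronglyMeasurableAtFilter _ _) hc.continuousAt).neg

lemma hasDerivAt_sol (x : ℝ) : HasDerivAt (sol k h s r x₀) (sol1 k h s r x₀ x) x := by
  refine HasDerivAt.congr_deriv ((W.hasDerivAt_s x).mul (((W.hasDerivAt_r' x).mul
    (W.hasDerivAt_aux x)).add_const (2 / h ^ 3))) ?_
  have h3 := W.h_pos.ne'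
  have h4 := (W.s_pos x).ne'
  rw [sol1]
  field_simp
  ring

lemma hasDerivAt_b_mul_sol1 (x : ℝ) :
    HasDerivAt (fun x => (h + 2 * k - s x) * sol1 k h s r x₀ x)
    ((h - 3 * s x + d2 k h s x) * sol k h s r x₀ x) x := by
  have h3 := W.h_pos.ne'
  have h0 : (fun x => (h + 2 * k - s x) * sol1 k h s r x₀ x) = fun x =>
      -(r x * s x) * (r x * aux k h s x₀ x + 2 / h ^ 3) * (h + 2 * k - s x)
      + k * s x ^ 2 * u k h s x * aux k h s x₀ x
      - r x * ((h ^ 3 + 2 * k * (h ^ 2 + h * s x + s x ^ 2)) / (s x * h ^ 3)) := by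
    funext x
    have h1 := W.u_mul x
    rw [sol1]
    generalize u k h s x = u at *
    linear_combination (k * s x ^ 2 * u * aux k h s x₀ x
      - r x * (h ^ 3 + 2 * k * (h ^ 2 + h * s x + s x ^ 2)) / (s x * h ^ 3)) * h1
  rw [h0]
  have h4 := (W.s_pos x).ne'
  have hs := W.hasDerivAt_s x
  have hr := W.hasDerivAt_r' x
  have hu := W.hasDerivAt_u x
  have hb := W.hasDerivAt_b x
  have ha := W.hasDerivAt_aux x
  refine HasDerivAt.congr_deriv (((((hr.mul hs).neg.mul ((hr.mul ha).add_const (2 / h ^ 3))).mul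
    hb).add ((((hs.pow 2).const_mul k).mul hu).mul ha)).sub (hr.mul
    (((((hs.const_mul h).const_add (h ^ 2)).add (hs.pow 2)).const_mul (2 * k)).const_add
      (h ^ 3) |>.div (hs.mul_const (h ^ 3)) (by positivity)))) ?_
  have h1 := W.u_mul x
  have h2 := W.r_sq' x
  simp only [sol, d2, Pi.mul_apply, Pi.neg_apply, Pi.add_apply, Pi.pow_apply,
    Nat.cast_ofNat, Nat.add_one_sub_one, pow_one]
  generalize aux k h s x₀ x = A at *
  generalize u k h s x = u at *
  generalize s x = s at *
  generalize r x = r at *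
  field_simp
  grind

/-- The Wronskian of the two solutions is constant. -/
lemma wronskian (x : ℝ) : (h + 2 * k - s x) *
    (d1 s r x * sol1 k h s r x₀ x - sol k h s r x₀ x * d2 k h s x) = 1 := by
  have h1 := W.u_mul x
  have h2 := W.r_sq' x
  have h3 := W.h_pos.ne'
  have h4 := (W.s_pos x).ne'
  simp only [d1, d2, sol, sol1]
  generalize aux k h s x₀ x = A at *
  generalize u k h s x = u at *
  generalize s x = s at *
  generalize r x = r at *
  field_simp
  grind

end Basic

end IsWaveChart

end

section

open Asymptotics

/-- The exponential `exp (-m |x|)`. -/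
def expAbs (m : ℝ) (x : ℝ) : ℝ := Real.exp (-(m * |x|))

lemma isBigO_one_mul {f g e : ℝ → ℝ} (hf : f =O[⊤] (1 : ℝ → ℝ)) (hg : g =O[⊤] e) :
    (fun x => f x * g x) =O[⊤] e := by
  simpa using hf.mul hg

lemma isBigO_const_one (a : ℝ) : (fun _ : ℝ => a) =O[⊤] (1 : ℝ → ℝ) :=
  isBigO_top.2 ⟨|a|, fun x => by simp⟩

namespace IsWaveChart

/-! ### Growth and decay along the wave -/

variable {k h n : ℝ} {s r q : ℝ → ℝ} {x₀ : ℝ} (W : IsWaveChart k h n s r q x₀)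
include W

lemma abs_q_le (x : ℝ) : |q x| ≤ (2 * k)⁻¹ * |x - x₀| := by
  have h1 := Convex.norm_image_sub_le_of_norm_hasDerivWithin_le (f := q) (f' := u k h s)
    (C := (2 * k)⁻¹) (s := univ) (fun x _ => (W.hasDerivAt_q' x).hasDerivWithinAt)
    (fun x _ => ?_) convex_univ (mem_univ x₀) (mem_univ x)
  · simpa [W.q_crest] using h1
  · rw [Real.norm_of_nonneg (W.u_pos x).le, u]
    exact inv_anti₀ (by linarith [W.k_pos]) (W.b_ge x)

lemma monotone_r : Monotone r :=
  monotone_of_deriv_nonneg (fun x => (W.hasDerivAt_r x).differentiableAt) fun x => by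
    rw [(W.hasDerivAt_r x).deriv]
    have := W.k_pos
    have := W.s_pos x
    positivity

/-- The distance of the rate of decay from its limit is controlled by the derivative of the rate. -/
lemma n_sub_abs_r_le (x : ℝ) : n - |r x| ≤ 2 / n * (k * s x * u k h s x ^ 2) := by
  have h1 := W.r_sq' x
  have h2 := W.n_sq'
  have h3 := W.one_le_mul_u x
  have h4 := W.abs_r_lt x
  have h5 := W.u_mul x
  have hk := W.k_pos
  have hn := W.n_pos
  have h6 : n * (n - |r x|) ≤ n ^ 2 - r x ^ 2 := by
    rw [← sq_abs (r x)]
    nlinarith [abs_nonneg (r x)]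
  have h7 : n ^ 2 - r x ^ 2 ≤ 2 * (k * s x * u k h s x ^ 2) := by
    have h8 : (h + 2 * k) * (n ^ 2 - r x ^ 2) = 2 * k * (u k h s x * s x) := by
      rw [h1]
      linear_combination -h2 + 2 * k * h5
    have h9 : 0 < h + 2 * k := by linarith [W.h_pos]
    refine le_of_mul_le_mul_left ?_ h9
    rw [h8]
    have : 0 ≤ 2 * k * (u k h s x * s x) := by
      have := W.u_pos x
      have := W.s_pos x
      positivity
    nlinarith
  rw [div_mul_eq_mul_div, le_div_iff₀ hn]
  linarith

lemma decay_of_exp_le {x y d : ℝ}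
    (hxy : s x * Real.exp (n * d - 2 / n * |r x|) ≤ s y * Real.exp (-(2 / n * |r y|))) :
    s x ≤ Real.exp 2 * Real.exp (-(n * d)) * s y := by
  have hn := W.n_pos
  have h1 : 2 / n * |r x| ≤ 2 := by
    rw [div_mul_eq_mul_div, div_le_iff₀ hn]
    linarith [W.abs_r_lt x]
  have h2 : Real.exp (-(2 / n * |r y|)) ≤ 1 := by
    rw [Real.exp_le_one_iff]
    have := abs_nonneg (r y)
    have : 0 ≤ 2 / n * |r y| := by positivity
    linarith
  have h3 : s x * Real.exp (n * d - 2) ≤ s y := by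
    calc s x * Real.exp (n * d - 2) ≤ s x * Real.exp (n * d - 2 / n * |r x|) :=
          mul_le_mul_of_nonneg_left (Real.exp_le_exp.2 (by linarith)) (W.s_pos x).le
      _ ≤ _ := hxy
      _ ≤ s y * 1 := mul_le_mul_of_nonneg_left h2 (W.s_pos y).le
      _ = s y := mul_one _
  calc s x = s x * Real.exp (n * d - 2) * (Real.exp 2 * Real.exp (-(n * d))) := by
        rw [mul_assoc, ← Real.exp_add, ← Real.exp_add]; ring_nf; simp
    _ ≤ s y * (Real.exp 2 * Real.exp (-(n * d))) :=
        mul_le_mul_of_nonneg_right h3 (by positivity)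
    _ = _ := by ring

/-- To the right of the crest the wave decays at the rate `n`. -/
lemma decay_right {x y : ℝ} (hy : x₀ ≤ y) (hxy : y ≤ x) :
    s x ≤ Real.exp 2 * Real.exp (-(n * |x - y|)) * s y := by
  have hr : ∀ z, x₀ ≤ z → 0 ≤ r z := fun z hz => W.r_crest ▸ W.monotone_r hz
  have hd : ∀ z, HasDerivAt (fun z => s z * Real.exp (n * z - 2 / n * r z))
      (s z * Real.exp (n * z - 2 / n * r z) * (n - r z - 2 / n * (k * s z * u k h s z ^ 2))) z := by
    intro z
    refine ((W.hasDerivAt_s z).mul (((hasDerivAt_id z).const_mul n).sub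
      ((W.hasDerivAt_r' z).const_mul (2 / n))).exp).congr_deriv ?_
    simp only [id, Pi.sub_apply]
    ring
  have hm : AntitoneOn (fun z => s z * Real.exp (n * z - 2 / n * r z)) (Ici x₀) := by
    refine antitoneOn_of_deriv_nonpos (convex_Ici x₀)
      (fun z _ => (hd z).continuousAt.continuousWithinAt)
      (fun z _ => (hd z).differentiableAt.differentiableWithinAt) fun z hz => ?_
    rw [interior_Ici] at hz
    rw [(hd z).deriv]
    refine mul_nonpos_of_nonneg_of_nonpos (mul_nonneg (W.s_pos z).le (Real.exp_pos _).le) ?_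
    have := W.n_sub_abs_r_le z
    rw [abs_of_nonneg (hr z (le_of_lt hz))] at this
    linarith
  have h1 : s x * Real.exp (n * x - 2 / n * r x) ≤ s y * Real.exp (n * y - 2 / n * r y) :=
    hm hy (hy.trans hxy : x₀ ≤ x) hxy
  rw [abs_of_nonneg (sub_nonneg.2 hxy)]
  refine W.decay_of_exp_le ?_
  rw [abs_of_nonneg (hr x (hy.trans hxy)), abs_of_nonneg (hr y hy)]
  have h2 := mul_le_mul_of_nonneg_right h1 (Real.exp_pos (-(n * y))).le
  rw [mul_assoc, mul_assoc, ← Real.exp_add, ← Real.exp_add] at h2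
  refine le_of_eq_of_le ?_ (h2.trans_eq ?_) <;> ring_nf

/-- To the left of the crest the wave decays at the rate `n`. -/
lemma decay_left {x y : ℝ} (hy : y ≤ x₀) (hxy : x ≤ y) :
    s x ≤ Real.exp 2 * Real.exp (-(n * |x - y|)) * s y := by
  have hr : ∀ z, z ≤ x₀ → r z ≤ 0 := fun z hz => W.r_crest ▸ W.monotone_r hz
  have hd : ∀ z, HasDerivAt (fun z => s z * Real.exp (2 / n * r z - n * z))
      (s z * Real.exp (2 / n * r z - n * z) * (2 / n * (k * s z * u k h s z ^ 2) - r z - n)) z := by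
    intro z
    refine ((W.hasDerivAt_s z).mul (((W.hasDerivAt_r' z).const_mul (2 / n)).sub
      ((hasDerivAt_id z).const_mul n)).exp).congr_deriv ?_
    simp only [id, Pi.sub_apply]
    ring
  have hm : MonotoneOn (fun z => s z * Real.exp (2 / n * r z - n * z)) (Iic x₀) := by
    refine monotoneOn_of_deriv_nonneg (convex_Iic x₀)
      (fun z _ => (hd z).continuousAt.continuousWithinAt)
      (fun z _ => (hd z).differentiableAt.differentiableWithinAt) fun z hz => ?_
    rw [interior_Iic] at hz
    rw [(hd z).deriv]
    refine mul_nonneg (mul_nonneg (W.s_pos z).le (Real.exp_pos _).le) ?_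
    have := W.n_sub_abs_r_le z
    rw [abs_of_nonpos (hr z (le_of_lt hz))] at this
    linarith
  have h1 : s x * Real.exp (2 / n * r x - n * x) ≤ s y * Real.exp (2 / n * r y - n * y) :=
    hm (hxy.trans hy : x ≤ x₀) hy hxy
  rw [abs_of_nonpos (sub_nonpos.2 hxy)]
  refine W.decay_of_exp_le ?_
  rw [abs_of_nonpos (hr x (hxy.trans hy)), abs_of_nonpos (hr y hy)]
  have h2 := mul_le_mul_of_nonneg_right h1 (Real.exp_pos (n * y)).le
  rw [mul_assoc, mul_assoc, ← Real.exp_add, ← Real.exp_add] at h2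
  refine le_of_eq_of_le ?_ (h2.trans_eq ?_) <;> ring_nf

lemma s_le_exp (x : ℝ) : s x ≤ Real.exp 2 * h * Real.exp (-(n * |x - x₀|)) := by
  have h1 : s x ≤ Real.exp 2 * Real.exp (-(n * |x - x₀|)) * s x₀ := by
    rcases le_total x x₀ with hx | hx
    · exact W.decay_left le_rfl hx
    · exact W.decay_right le_rfl hx
  refine h1.trans ?_
  rw [mul_right_comm]
  exact mul_le_mul_of_nonneg_right (mul_le_mul_of_nonneg_left (W.s_le _) (by positivity))
    (by positivity)

lemma isBigO_s_mul_one_add {m : ℝ} (hm0 : 0 ≤ m) (hm : m < n) :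
    (fun x => (1 + |q x|) * s x) =O[⊤] expAbs m := by
  have hk := W.k_pos
  have hh := W.h_pos
  set δ := n - m with hδ
  have hδ0 : 0 < δ := by linarith
  refine isBigO_top.2 ⟨Real.exp 2 * h * (1 + (2 * k)⁻¹ * δ⁻¹) * Real.exp (m * |x₀|), fun x => ?_⟩
  have hs := W.s_pos x
  set t := |x - x₀| with ht
  have ht0 : 0 ≤ t := abs_nonneg _
  rw [Real.norm_of_nonneg (by positivity), expAbs, Real.norm_of_nonneg (Real.exp_pos _).le]
  have h1 : 1 + |q x| ≤ (1 + (2 * k)⁻¹ * δ⁻¹) * Real.exp (δ * t) := by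
    have h2 := Real.add_one_le_exp (δ * t)
    have h3 : 1 ≤ Real.exp (δ * t) := Real.one_le_exp (by positivity)
    have h4 : t ≤ δ⁻¹ * Real.exp (δ * t) := by
      rw [inv_mul_eq_div, le_div_iff₀ hδ0]; linarith
    have h5 := mul_le_mul_of_nonneg_left h4 (by positivity : 0 ≤ (2 * k)⁻¹)
    have := W.abs_q_le x
    nlinarith
  have h6 : |x| - |x₀| ≤ t := abs_sub_abs_le_abs_sub x x₀
  calc (1 + |q x|) * s x ≤ ((1 + (2 * k)⁻¹ * δ⁻¹) * Real.exp (δ * t)) *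
        (Real.exp 2 * h * Real.exp (-(n * t))) :=
        mul_le_mul h1 (W.s_le_exp x) hs.le (by positivity)
    _ = Real.exp 2 * h * (1 + (2 * k)⁻¹ * δ⁻¹) * Real.exp (-(m * t)) := by
        rw [show -(m * t) = δ * t + -(n * t) by rw [hδ]; ring, Real.exp_add]; ring
    _ ≤ Real.exp 2 * h * (1 + (2 * k)⁻¹ * δ⁻¹) * Real.exp (m * |x₀| + -(m * |x|)) := by
        gcongr
        nlinarith
    _ = _ := by rw [Real.exp_add]; ring

lemma isBigO_s {m : ℝ} (hm0 : 0 ≤ m) (hm : m < n) : s =O[⊤] expAbs m := by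
  refine IsBigO.trans (isBigO_top.2 ⟨1, fun x => ?_⟩) (W.isBigO_s_mul_one_add hm0 hm)
  have := W.s_pos x
  rw [one_mul, Real.norm_of_nonneg this.le, Real.norm_of_nonneg (by positivity)]
  nlinarith [abs_nonneg (q x)]

lemma isBigO_q_mul_s {m : ℝ} (hm0 : 0 ≤ m) (hm : m < n) :
    (fun x => q x * s x) =O[⊤] expAbs m := by
  refine IsBigO.trans (isBigO_top.2 ⟨1, fun x => ?_⟩) (W.isBigO_s_mul_one_add hm0 hm)
  have := W.s_pos x
  rw [one_mul, norm_mul, Real.norm_of_nonneg this.le,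
    Real.norm_of_nonneg (by positivity : 0 ≤ (1 + |q x|) * s x), Real.norm_eq_abs]
  nlinarith [abs_nonneg (q x)]

lemma isBigO_s_one : s =O[⊤] (1 : ℝ → ℝ) := isBigO_top.2 ⟨h, fun x => by
  rw [Real.norm_of_nonneg (W.s_pos x).le]; simpa using W.s_le x⟩

lemma isBigO_r_one : r =O[⊤] (1 : ℝ → ℝ) := isBigO_top.2 ⟨n, fun x => by
  simpa using (W.abs_r_lt x).le⟩

lemma isBigO_u_one : u k h s =O[⊤] (1 : ℝ → ℝ) := isBigO_top.2 ⟨(2 * k)⁻¹, fun x => by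
  have := W.k_pos
  rw [Real.norm_of_nonneg (W.u_pos x).le, u]
  simpa using inv_anti₀ (by linarith : 0 < 2 * k) (W.b_ge x)⟩

lemma isBigO_b_one : (fun x => h + 2 * k - s x) =O[⊤] (1 : ℝ → ℝ) :=
  (isBigO_const_one _).sub W.isBigO_s_one

lemma isBigO_d1 {m : ℝ} (hm0 : 0 ≤ m) (hm : m < n) : d1 s r =O[⊤] expAbs m :=
  (isBigO_one_mul W.isBigO_r_one (W.isBigO_s hm0 hm)).neg_left

lemma isBigO_d2_coef :
    (fun x => (h - s x) * u k h s x - k * s x * u k h s x * u k h s x) =O[⊤] (1 : ℝ → ℝ) :=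
  (isBigO_one_mul ((isBigO_const_one h).sub W.isBigO_s_one) W.isBigO_u_one).sub
    (isBigO_one_mul (isBigO_one_mul (isBigO_one_mul (isBigO_const_one k) W.isBigO_s_one)
      W.isBigO_u_one) W.isBigO_u_one)

lemma isBigO_d2 {m : ℝ} (hm0 : 0 ≤ m) (hm : m < n) : d2 k h s =O[⊤] expAbs m :=
  (isBigO_one_mul W.isBigO_d2_coef (W.isBigO_s hm0 hm)).congr_left fun x => by rw [d2]; ring

lemma isBigO_gen {m : ℝ} (hm0 : 0 ≤ m) (hm : m < n) : gen k h s r q =O[⊤] expAbs m :=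
  ((isBigO_one_mul (isBigO_one_mul (isBigO_const_one (k / h)) W.isBigO_r_one)
    (W.isBigO_q_mul_s hm0 hm)).sub (isBigO_one_mul (isBigO_const_one (1 / h))
      (W.isBigO_s hm0 hm))).congr_left fun x => by rw [gen]; ring

lemma isBigO_gen1 {m : ℝ} (hm0 : 0 ≤ m) (hm : m < n) : gen1 k h s r q =O[⊤] expAbs m := by
  have hr := W.isBigO_r_one
  have hu := W.isBigO_u_one
  have h1 := (isBigO_one_mul (isBigO_one_mul (isBigO_const_one (1 / h))
    ((isBigO_one_mul (isBigO_const_one (k ^ 2)) (isBigO_one_mul W.isBigO_s_one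
      (isBigO_one_mul hu hu))).sub (isBigO_one_mul (isBigO_const_one k) (isBigO_one_mul hr hr))))
    (W.isBigO_q_mul_s hm0 hm)).add (isBigO_one_mul (isBigO_one_mul (isBigO_const_one (1 / h))
      (hr.add (isBigO_one_mul (isBigO_const_one k) (isBigO_one_mul hr hu)))) (W.isBigO_s hm0 hm))
  exact h1.congr_left fun x => by rw [gen1]; ring

/-- The growth of `aux`, which makes the second solution `O(1 / s)`: the bound holds at the crest and
is inherited from the derivatives. -/
lemma abs_aux_le (x : ℝ) :
    |aux k h s x₀ x| ≤ (h + 2 * k) * (h + 6 * k) / (h ^ 2 * k) * |r x| / s x ^ 2 := by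
  have hk := W.k_pos
  have hh := W.h_pos
  set K := (h + 2 * k) * (h + 6 * k) / (h ^ 2 * k) with hK
  have hK0 : 0 ≤ K := by positivity
  have hd : ∀ x, HasDerivAt (fun x => K * (r x / s x ^ 2))
      (K * ((k * s x * u k h s x ^ 2 + 2 * r x ^ 2) / s x ^ 2)) x := by
    intro x
    have hs := W.s_pos x
    refine (((W.hasDerivAt_r' x).div ((W.hasDerivAt_s x).pow 2) (pow_ne_zero 2 hs.ne')).const_mul
      K).congr_deriv ?_
    simp only [Pi.pow_apply]
    field_simp
    ring
  have hle : ∀ x, u k h s x * (h ^ 3 + 2 * k * (h ^ 2 + h * s x + s x ^ 2)) / (s x ^ 2 * h ^ 3) ≤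
      K * ((k * s x * u k h s x ^ 2 + 2 * r x ^ 2) / s x ^ 2) := by
    intro x
    have hs := W.s_pos x
    have hsh := W.s_le x
    have hu := W.u_pos x
    have h1 := W.one_le_mul_u x
    have h2 := W.two_k_mul_u_le x
    have h3 : r x ^ 2 = (h - s x) * u k h s x := by
      rw [W.r_sq']
      linear_combination -W.u_mul x
    rw [← mul_div_assoc, ← div_div, div_right_comm]
    refine div_le_div_of_nonneg_right ?_ (by positivity)
    have h4 : k * h * u k h s x ^ 2 ≤ k * s x * u k h s x ^ 2 + 2 * r x ^ 2 := by
      rw [h3]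
      have : 0 ≤ (h - s x) * u k h s x := mul_nonneg (by linarith) hu.le
      nlinarith
    refine le_trans ?_ (mul_le_mul_of_nonneg_left h4 hK0)
    have h5 : h ^ 3 + 2 * k * (h ^ 2 + h * s x + s x ^ 2) ≤ h ^ 2 * (h + 6 * k) := by
      have : h * s x ≤ h ^ 2 := by nlinarith
      have : s x ^ 2 ≤ h ^ 2 := by nlinarith
      nlinarith
    have h6 : K * (k * h * u k h s x ^ 2) =
        ((h + 2 * k) * u k h s x) * (u k h s x * (h ^ 2 * (h + 6 * k)) / h ^ 3) := by
      rw [hK]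
      field_simp
    rw [h6]
    calc _ ≤ u k h s x * (h ^ 2 * (h + 6 * k)) / h ^ 3 := by gcongr
      _ ≤ _ := le_mul_of_one_le_left (by positivity) h1
  have hpos : ∀ x, 0 ≤ u k h s x * (h ^ 3 + 2 * k * (h ^ 2 + h * s x + s x ^ 2))
      / (s x ^ 2 * h ^ 3) := by
    intro x
    have := W.s_pos x
    have := W.u_pos x
    positivity
  have hm1 : Monotone fun x => K * (r x / s x ^ 2) + aux k h s x₀ x := by
    have h0 := fun x => (hd x).add (W.hasDerivAt_aux x)
    refine monotone_of_deriv_nonneg (fun x => (h0 x).differentiableAt) fun x => ?_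
    refine le_of_le_of_eq ?_ (h0 x).deriv.symm
    linarith [hle x]
  have hm2 : Monotone fun x => K * (r x / s x ^ 2) - aux k h s x₀ x := by
    have h0 := fun x => (hd x).sub (W.hasDerivAt_aux x)
    refine monotone_of_deriv_nonneg (fun x => (h0 x).differentiableAt) fun x => ?_
    refine le_of_le_of_eq ?_ (h0 x).deriv.symm
    have : 0 ≤ K * ((k * s x * u k h s x ^ 2 + 2 * r x ^ 2) / s x ^ 2) := (hpos x).trans (hle x)
    linarith [hpos x]
  have ha : aux k h s x₀ x₀ = 0 := by simp [aux]
  rcases le_total x x₀ with hx | hx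
  · have h1 := hm1 hx
    have h2 := hm2 hx
    simp only [ha, W.r_crest, zero_div, mul_zero, add_zero, sub_zero] at h1 h2
    have hr : r x ≤ 0 := W.r_crest ▸ W.monotone_r hx
    rw [abs_of_nonpos hr, abs_le, mul_div_assoc, neg_div]
    constructor <;> linarith
  · have h1 := hm1 hx
    have h2 := hm2 hx
    simp only [ha, W.r_crest, zero_div, mul_zero, add_zero, sub_zero] at h1 h2
    have hr : 0 ≤ r x := W.r_crest ▸ W.monotone_r hx
    rw [abs_of_nonneg hr, abs_le, mul_div_assoc]
    constructor <;> linarith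

lemma isBigO_sq_mul_aux : (fun x => s x ^ 2 * aux k h s x₀ x) =O[⊤] (1 : ℝ → ℝ) := by
  refine isBigO_top.2 ⟨(h + 2 * k) * (h + 6 * k) / (h ^ 2 * k) * n, fun x => ?_⟩
  have hs := W.s_pos x
  have hk := W.k_pos
  have hh := W.h_pos
  rw [norm_mul, Real.norm_of_nonneg (by positivity), Real.norm_eq_abs, Pi.one_apply, norm_one,
    mul_one]
  calc _ ≤ s x ^ 2 * ((h + 2 * k) * (h + 6 * k) / (h ^ 2 * k) * |r x| / s x ^ 2) :=
        mul_le_mul_of_nonneg_left (W.abs_aux_le x) (by positivity)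
    _ = (h + 2 * k) * (h + 6 * k) / (h ^ 2 * k) * |r x| := by field_simp
    _ ≤ _ := mul_le_mul_of_nonneg_left (W.abs_r_lt x).le (by positivity)

lemma isBigO_s_mul_sol : (fun x => s x * sol k h s r x₀ x) =O[⊤] (1 : ℝ → ℝ) :=
  ((isBigO_one_mul W.isBigO_r_one W.isBigO_sq_mul_aux).add (isBigO_one_mul
    (isBigO_one_mul W.isBigO_s_one W.isBigO_s_one) (isBigO_const_one (2 / h ^ 3)))).congr_left
    fun x => by rw [sol]; ring

lemma isBigO_s_mul_sol1 : (fun x => s x * sol1 k h s r x₀ x) =O[⊤] (1 : ℝ → ℝ) := by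
  have hs := W.isBigO_s_one
  have hr := W.isBigO_r_one
  have hu := W.isBigO_u_one
  have ha := W.isBigO_sq_mul_aux
  have h1 := ((isBigO_one_mul (isBigO_one_mul hr hr) ha).neg_left.sub (isBigO_one_mul
    (isBigO_one_mul hr (isBigO_one_mul hs hs)) (isBigO_const_one (2 / h ^ 3)))).add
    ((isBigO_one_mul (isBigO_one_mul (isBigO_const_one k) (isBigO_one_mul hs
      (isBigO_one_mul hu hu))) ha).sub (isBigO_one_mul (isBigO_one_mul hr hu)
      (isBigO_one_mul ((isBigO_const_one (h ^ 3)).add (isBigO_one_mul (isBigO_const_one (2 * k))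
        (((isBigO_const_one (h ^ 2)).add (isBigO_one_mul (isBigO_const_one h) hs)).add
          (isBigO_one_mul hs hs)))) (isBigO_const_one (1 / h ^ 3)))))
  refine h1.congr_left fun x => ?_
  have := (W.s_pos x).ne'
  have := W.h_pos.ne'
  rw [sol1]
  field_simp
  ring

end IsWaveChart

end

section

/-! ### Pairings with exponentially decaying functions -/

open Asymptotics
open scoped BoundedContinuousFunction

lemma IsPrimitive.integral_eq_zero_of_integrable {F f : ℝ → ℂ} (h : IsPrimitive F f)
    (hF : Integrable F) (hf : Integrable f) : ∫ x, f x = 0 := by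
  have key : ∀ (l : Filter ℝ) (L : ℂ), Tendsto F l (𝓝 L) → (∀ s ∈ l, volume s = ⊤) → L = 0 :=
    fun l L hL hl => IntegrableAtFilter.eq_zero_of_tendsto ⟨univ, univ_mem, hF.integrableOn⟩ hl hL
  have e : ∀ x, F x = F 0 + ∫ y in (0 : ℝ)..x, f y := fun x => by rw [← h.sub_eq 0 x]; ring
  have ht : Tendsto F atTop (𝓝 (F 0 + ∫ y in Ioi 0, f y)) := by
    exact ((intervalIntegral_tendsto_integral_Ioi 0 hf.integrableOn tendsto_id).const_add
      (F 0)).congr fun x => (e x).symm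
  have hb : Tendsto F atBot (𝓝 (F 0 - ∫ y in Iic 0, f y)) := by
    have h1 := (intervalIntegral_tendsto_integral_Iic 0 hf.integrableOn tendsto_id).const_sub (F 0)
    refine h1.congr fun x => ?_
    rw [e x, intervalIntegral.integral_symm, id, sub_eq_add_neg, neg_neg]
  have h1 := key _ _ ht fun s hs => by
    obtain ⟨b, hb⟩ := mem_atTop_sets.1 hs
    exact top_le_iff.1 (Real.volume_Ici (a := b) ▸ measure_mono hb)
  have h2 := key _ _ hb fun s hs => by
    obtain ⟨b, hb⟩ := mem_atBot_sets.1 hs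
    exact top_le_iff.1 (Real.volume_Iic (a := b) ▸ measure_mono hb)
  rw [← setIntegral_univ, ← Iic_union_Ioi (a := (0 : ℝ)),
    setIntegral_union (Iic_disjoint_Ioi le_rfl) measurableSet_Ioi hf.integrableOn hf.integrableOn]
  linear_combination h1 - h2

lemma isPrimitive_ofReal {f f' : ℝ → ℝ} (h : ∀ x, HasDerivAt f (f' x) x) (hc : Continuous f') :
    IsPrimitive (fun x => (f x : ℂ)) fun x => (f' x : ℂ) :=
  IsPrimitive.of_hasDerivAt (fun x => (h x).ofReal_comp) (Complex.continuous_ofReal.comp hc)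

/-- A continuous function which decays faster than `exp (-ν |x|)`. -/
structure IsDecaying (ν : ℝ) (ρ : ℝ → ℝ) : Prop where
  continuous : Continuous ρ
  isBigO : ∃ m, ν < m ∧ ρ =O[⊤] expAbs m

/-- The integral of a product, as a functional of the complex factor. -/
def pair (ρ : ℝ → ℝ) (f : ℝ → ℂ) : ℂ := ∫ x, (ρ x : ℂ) * f x

variable {ν : ℝ} {ρ ρ' σ : ℝ → ℝ}

namespace IsDecaying

lemma exists_bound (h : IsDecaying ν ρ) :
    ∃ C m, 0 ≤ C ∧ ν < m ∧ ∀ x, |ρ x| ≤ C * Real.exp (-(m * |x|)) := by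
  obtain ⟨m, hm, hO⟩ := h.isBigO
  obtain ⟨C, hC, hb⟩ := hO.exists_nonneg
  refine ⟨C, m, hC, hm, fun x => ?_⟩
  have := isBigOWith_top.1 hb x
  rwa [Real.norm_eq_abs, expAbs, Real.norm_of_nonneg (Real.exp_pos _).le] at this

lemma aestronglyMeasurable (h : IsDecaying ν ρ) :
    AEStronglyMeasurable (fun x => (ρ x : ℂ)) volume :=
  (Complex.continuous_ofReal.comp h.continuous).aestronglyMeasurable

lemma isDualWeight (hν : 0 < ν) (h : IsDecaying ν ρ) : IsDualWeight ν fun x => (ρ x : ℂ) := by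
  obtain ⟨C, m, hC, hm, hb⟩ := h.exists_bound
  refine ⟨h.aestronglyMeasurable, C, m - ν, by linarith, fun x => ?_⟩
  rw [Complex.norm_real]
  refine (hb x).trans (mul_le_mul_of_nonneg_left (Real.exp_le_exp.2 ?_) hC)
  nlinarith [neg_abs_le x]

lemma memLp (hν : 0 < ν) (h : IsDecaying ν ρ) :
    MemLp (fun x => (ρ x : ℂ)) 2 (expWeight ν) := by
  obtain ⟨C, m, hC, hm, hb⟩ := h.exists_bound
  refine memLp_expWeight_of_le (C := C) (δ := m - ν) (by linarith) h.aestronglyMeasurable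
    fun x => ?_
  rw [Complex.norm_real]
  refine (hb x).trans (mul_le_mul_of_nonneg_left (Real.exp_le_exp.2 ?_) hC)
  nlinarith [le_abs_self x]

/-- The element of the weighted space given by a decaying function. -/
def toLp (hν : 0 < ν) (h : IsDecaying ν ρ) : WeightedL2 ν := (h.memLp hν).toLp _

lemma toLp_ae (hν : 0 < ν) (h : IsDecaying ν ρ) : h.toLp hν =ᵐ[volume] fun x => (ρ x : ℂ) :=
  WeightedL2.coeFn_toLp (h.memLp hν)

lemma integrable (hν : 0 < ν) (h : IsDecaying ν ρ) : Integrable ρ := by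
  obtain ⟨C, m, hC, hm, hb⟩ := h.exists_bound
  exact ((integrable_exp_neg_mul_abs (hν.trans hm)).const_mul C).mono'
    h.continuous.aestronglyMeasurable (Eventually.of_forall fun x => by
      simpa [neg_mul] using hb x)

lemma mul_bounded {f : ℝ → ℝ} (h : IsDecaying ν ρ) (hf : Continuous f)
    (hO : f =O[⊤] (1 : ℝ → ℝ)) : IsDecaying ν fun x => f x * ρ x := by
  obtain ⟨m, hm, hρ⟩ := h.isBigO
  exact ⟨hf.mul h.continuous, m, hm, isBigO_one_mul hO hρ⟩

lemma isBigO_one (hν : 0 < ν) (h : IsDecaying ν ρ) : ρ =O[⊤] (1 : ℝ → ℝ) := by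
  obtain ⟨m, hm, hρ⟩ := h.isBigO
  refine hρ.trans (isBigO_top.2 ⟨1, fun x => ?_⟩)
  rw [expAbs, Real.norm_of_nonneg (Real.exp_pos _).le]
  simpa using mul_nonneg (hν.trans hm).le (abs_nonneg x)

lemma mul (hν : 0 < ν) (h : IsDecaying ν ρ) (h' : IsDecaying ν σ) :
    IsDecaying ν fun x => ρ x * σ x :=
  h'.mul_bounded h.continuous (h.isBigO_one hν)

lemma sub (h : IsDecaying ν ρ) (h' : IsDecaying ν σ) : IsDecaying ν fun x => ρ x - σ x := by
  obtain ⟨m, hm, hρ⟩ := h.isBigO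
  obtain ⟨m', hm', hσ⟩ := h'.isBigO
  have hle : ∀ m₁ m₂ : ℝ, m₁ ≤ m₂ → expAbs m₂ =O[⊤] expAbs m₁ := fun m₁ m₂ h12 => by
    refine isBigO_top.2 ⟨1, fun x => ?_⟩
    rw [expAbs, expAbs, Real.norm_of_nonneg (Real.exp_pos _).le,
      Real.norm_of_nonneg (Real.exp_pos _).le, one_mul, Real.exp_le_exp]
    nlinarith [abs_nonneg x]
  exact ⟨h.continuous.sub h'.continuous, min m m', lt_min hm hm',
    (hρ.trans (hle _ _ (min_le_left _ _))).sub (hσ.trans (hle _ _ (min_le_right _ _)))⟩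

lemma tendsto_atTop (hν : 0 < ν) (h : IsDecaying ν ρ) : Tendsto ρ atTop (𝓝 0) := by
  obtain ⟨C, m, hC, hm, hb⟩ := h.exists_bound
  refine squeeze_zero_norm hb ?_
  have h1 : Tendsto (fun x : ℝ => m * |x|) atTop atTop :=
    tendsto_abs_atTop_atTop.const_mul_atTop (hν.trans hm)
  simpa using (Real.tendsto_exp_neg_atTop_nhds_zero.comp h1).const_mul C

lemma tendsto_atBot (hν : 0 < ν) (h : IsDecaying ν ρ) : Tendsto ρ atBot (𝓝 0) := by
  obtain ⟨C, m, hC, hm, hb⟩ := h.exists_bound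
  refine squeeze_zero_norm hb ?_
  have h1 : Tendsto (fun x : ℝ => m * |x|) atBot atTop :=
    tendsto_abs_atBot_atTop.const_mul_atTop (hν.trans hm)
  simpa using (Real.tendsto_exp_neg_atTop_nhds_zero.comp h1).const_mul C

lemma pairing_eq (hν : 0 < ν) (h : IsDecaying ν ρ) (f : WeightedL2 ν) :
    (h.isDualWeight hν).pairing f = pair ρ f :=
  (h.isDualWeight hν).pairing_apply f

lemma pair_sub (hν : 0 < ν) (h : IsDecaying ν ρ) (f g : WeightedL2 ν) :
    pair ρ ⇑(f - g) = pair ρ f - pair ρ g := by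
  rw [← h.pairing_eq hν, ← h.pairing_eq hν, ← h.pairing_eq hν, map_sub]

lemma pair_sub_left (hν : 0 < ν) (h : IsDecaying ν ρ) (h' : IsDecaying ν σ) (f : WeightedL2 ν) :
    pair (fun x => ρ x - σ x) f = pair ρ f - pair σ f := by
  rw [pair, pair, pair, ← integral_sub ((h.isDualWeight hν).integrable_mul f)
    ((h'.isDualWeight hν).integrable_mul f)]
  simp only [Complex.ofReal_sub, sub_mul]

lemma pair_toLp (hν : 0 < ν) (h : IsDecaying ν σ) :
    pair ρ (h.toLp hν) = ((∫ x, ρ x * σ x : ℝ) : ℂ) := by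
  rw [pair, ← integral_complex_ofReal]
  refine integral_congr_ae ?_
  filter_upwards [h.toLp_ae hν] with x hx
  rw [hx, Complex.ofReal_mul]

/-- Integration by parts. -/
lemma pair_antideriv (hν : 0 < ν) (h : IsDecaying ν ρ) (h' : IsDecaying ν ρ')
    (hd : ∀ x, HasDerivAt ρ (ρ' x) x) (f : WeightedL2 ν) :
    pair ρ' (antideriv hν f) = -pair ρ f := by
  have hp := (isPrimitive_ofReal hd h'.continuous).mul (f.isPrimitive_invDeriv hν)
  have ae := antideriv_ae hν f
  have i1 : Integrable fun x => (ρ' x : ℂ) * invDeriv f x :=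
    ((h'.isDualWeight hν).integrable_mul (antideriv hν f)).congr (by
      filter_upwards [ae] with x hx
      rw [hx])
  have i2 : Integrable fun x => (ρ x : ℂ) * invDeriv f x :=
    ((h.isDualWeight hν).integrable_mul (antideriv hν f)).congr (by
      filter_upwards [ae] with x hx
      rw [hx])
  have i3 := (h.isDualWeight hν).integrable_mul f
  have h1 := hp.integral_eq_zero_of_integrable i2 (i1.add i3)
  rw [integral_add i1 i3] at h1
  rw [pair, pair, ← add_eq_zero_iff_eq_neg, ← h1]
  congr 1
  refine integral_congr_ae ?_
  filter_upwards [ae] with x hx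
  rw [hx]

lemma antideriv_toLp (hν : 0 < ν) (h : IsDecaying ν ρ) (h' : IsDecaying ν ρ')
    (hd : ∀ x, HasDerivAt ρ (ρ' x) x) : antideriv hν (h'.toLp hν) = h.toLp hν := by
  symm
  rw [← isWeakDeriv_iff hν]
  intro χ hχ
  have h1 := (isPrimitive_ofReal hd h'.continuous).isWeakDeriv χ hχ
  have e1 : ∫ x, h.toLp hν x * deriv χ x = ∫ x, (ρ x : ℂ) * deriv χ x := by
    refine integral_congr_ae ?_
    filter_upwards [h.toLp_ae hν] with x hx
    rw [hx]
  have e2 : ∫ x, h'.toLp hν x * χ x = ∫ x, (ρ' x : ℂ) * χ x := by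
    refine integral_congr_ae ?_
    filter_upwards [h'.toLp_ae hν] with x hx
    rw [hx]
  rw [e1, e2, h1]

end IsDecaying

lemma pair_mulOp (b : ℝ →ᵇ ℝ) (f : WeightedL2 ν) :
    pair ρ (mulOp ν b f) = pair (fun x => b x * ρ x) f := by
  refine integral_congr_ae ?_
  filter_upwards [mulOp_ae b f] with x hx
  rw [hx, Complex.ofReal_mul]
  ring

/-! ### Complex conjugation -/

/-- Complex conjugation on the weighted space. -/
def conjOp (ν : ℝ) : WeightedL2 ν →ₛₗ[starRingEnd ℂ] WeightedL2 ν where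
  toFun f := star f
  map_add' f g := by
    refine WeightedL2.ext ?_
    filter_upwards [ae_expWeight_iff.1 (Lp.coeFn_star (f + g)), WeightedL2.coeFn_add f g,
      WeightedL2.coeFn_add (star f) (star g), ae_expWeight_iff.1 (Lp.coeFn_star f),
      ae_expWeight_iff.1 (Lp.coeFn_star g)] with x h1 h2 h3 h4 h5
    rw [h1, h3, h4, h5, Pi.star_apply, h2, Pi.star_apply, Pi.star_apply, star_add]
  map_smul' α f := by
    refine WeightedL2.ext ?_
    filter_upwards [ae_expWeight_iff.1 (Lp.coeFn_star (α • f)), WeightedL2.coeFn_smul α f,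
      WeightedL2.coeFn_smul (starRingEnd ℂ α) (star f), ae_expWeight_iff.1 (Lp.coeFn_star f)]
      with x h1 h2 h3 h4
    rw [h1, h3, h4, Pi.star_apply, h2, Pi.star_apply]
    simp

lemma conjOp_ae (f : WeightedL2 ν) :
    conjOp ν f =ᵐ[volume] fun x => starRingEnd ℂ (f x) :=
  ae_expWeight_iff.1 (Lp.coeFn_star f)

lemma antideriv_conjOp (hν : 0 < ν) (f : WeightedL2 ν) :
    antideriv hν (conjOp ν f) = conjOp ν (antideriv hν f) := by
  refine WeightedL2.ext ?_
  filter_upwards [antideriv_ae hν (conjOp ν f), conjOp_ae (antideriv hν f), antideriv_ae hν f]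
    with x h1 h2 h3
  rw [h1, h2, h3, invDeriv_congr (conjOp_ae f), invDeriv, invDeriv, map_neg, ← integral_conj]

lemma mulOp_conjOp (b : ℝ →ᵇ ℝ) (f : WeightedL2 ν) :
    mulOp ν b (conjOp ν f) = conjOp ν (mulOp ν b f) := by
  refine WeightedL2.ext ?_
  filter_upwards [mulOp_ae b (conjOp ν f), conjOp_ae (mulOp ν b f), mulOp_ae b f, conjOp_ae f]
    with x h1 h2 h3 h4
  rw [h1, h2, h3, h4, map_mul, Complex.conj_ofReal]

lemma pair_conjOp (f : WeightedL2 ν) : pair ρ (conjOp ν f) = starRingEnd ℂ (pair ρ f) := by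
  rw [pair, pair, ← integral_conj]
  refine integral_congr_ae ?_
  filter_upwards [conjOp_ae f] with x hx
  rw [hx, map_mul, Complex.conj_ofReal]

lemma IsDecaying.conjOp_toLp (hν : 0 < ν) (h : IsDecaying ν ρ) :
    conjOp ν (h.toLp hν) = h.toLp hν := by
  refine WeightedL2.ext ?_
  filter_upwards [conjOp_ae (h.toLp hν), h.toLp_ae hν] with x h1 h2
  rw [h1, h2, Complex.conj_ofReal]

end

section

/-! ### The operator at the origin of the spectral plane -/

open Asymptotics
open scoped BoundedContinuousFunction

variable {ν : ℝ}

/-- The value at the origin of the pencil for `J (a - ∂ₓ b ∂ₓ + η² ∂ₓ⁻²)`. -/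
def pencilOp (hν : 0 < ν) (a b : ℝ →ᵇ ℝ) : WeightedL2 ν →L[ℂ] WeightedL2 ν :=
  mulOp ν b - antideriv hν * mulOp ν a * antideriv hν

lemma pencilOp_apply (hν : 0 < ν) (a b : ℝ →ᵇ ℝ) (g : WeightedL2 ν) :
    pencilOp hν a b g = mulOp ν b g - antideriv hν (mulOp ν a (antideriv hν g)) := by
  simp only [pencilOp, sub_apply, mul_apply_eq_comp]

/-- `∂ₓ⁻¹ (1 - ∂ₓ⁻²)`, the coefficient of the spectral parameter. -/
def weightOp (hν : 0 < ν) : WeightedL2 ν →L[ℂ] WeightedL2 ν :=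
  (1 - antideriv hν ^ 2) * antideriv hν

lemma weightOp_apply (hν : 0 < ν) (g : WeightedL2 ν) : weightOp hν g =
    antideriv hν g - antideriv hν (antideriv hν (antideriv hν g)) := by
  simp only [weightOp, mul_apply_eq_comp, sub_apply, one_apply_eq_self, sq]

lemma eq_of_isPrimitive_zero {F f : ℝ → ℂ} (h : IsPrimitive F f) (hf : f =ᵐ[volume] 0) (x y : ℝ) :
    F x = F y := by
  rw [← sub_eq_zero, h.sub_eq, intervalIntegral.integral_zero_ae]
  filter_upwards [hf] with z hz _
  exact hz

lemma IsDecaying.of_forall_lt {n : ℝ} {f : ℝ → ℝ} (hν : 0 < ν) (hνn : ν < n) (hc : Continuous f)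
    (hO : ∀ m, 0 ≤ m → m < n → f =O[⊤] expAbs m) : IsDecaying ν f :=
  ⟨hc, (ν + n) / 2, by linarith, hO _ (by linarith) (by linarith)⟩

namespace IsWaveChart

variable {k h n : ℝ} {s r q : ℝ → ℝ} {x₀ : ℝ} (W : IsWaveChart k h n s r q x₀)
include W

lemma isDecaying_s (hν : 0 < ν) (hνn : ν < n) : IsDecaying ν s :=
  IsDecaying.of_forall_lt hν hνn W.continuous_s fun _ => W.isBigO_s

lemma continuous_d2 : Continuous (d2 k h s) := by
  have := W.continuous_s
  have := W.continuous_u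
  unfold d2
  fun_prop

lemma isDecaying_d1 (hν : 0 < ν) (hνn : ν < n) : IsDecaying ν (d1 s r) :=
  IsDecaying.of_forall_lt hν hνn
    (continuous_iff_continuousAt.2 fun x => (W.hasDerivAt_d1 x).continuousAt) fun _ => W.isBigO_d1

lemma isDecaying_d2 (hν : 0 < ν) (hνn : ν < n) : IsDecaying ν (d2 k h s) :=
  IsDecaying.of_forall_lt hν hνn W.continuous_d2 fun _ => W.isBigO_d2

lemma isDecaying_gen (hν : 0 < ν) (hνn : ν < n) : IsDecaying ν (gen k h s r q) :=
  IsDecaying.of_forall_lt hν hνn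
    (continuous_iff_continuousAt.2 fun x => (W.hasDerivAt_gen x).continuousAt) fun _ => W.isBigO_gen

lemma isDecaying_gen1 (hν : 0 < ν) (hνn : ν < n) : IsDecaying ν (gen1 k h s r q) := by
  refine IsDecaying.of_forall_lt hν hνn ?_ fun _ => W.isBigO_gen1
  have := W.continuous_s
  have := W.continuous_u
  have := W.continuous_r
  have := W.continuous_q
  unfold gen1
  fun_prop

lemma continuous_b : Continuous fun x => h + 2 * k - s x := continuous_const.sub W.continuous_s

lemma isDecaying_b_mul {ρ : ℝ → ℝ} (hρ : IsDecaying ν ρ) :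
    IsDecaying ν fun x => (h + 2 * k - s x) * ρ x :=
  hρ.mul_bounded W.continuous_b W.isBigO_b_one

lemma continuous_a : Continuous fun x => h - 3 * s x + d2 k h s x := by
  have := W.continuous_s
  have := W.continuous_d2
  fun_prop

lemma isBigO_a_one : (fun x => h - 3 * s x + d2 k h s x) =O[⊤] (1 : ℝ → ℝ) :=
  ((isBigO_const_one h).sub (isBigO_one_mul (isBigO_const_one 3) W.isBigO_s_one)).add
    ((isBigO_one_mul W.isBigO_d2_coef W.isBigO_s_one).congr_left fun x => by rw [d2]; ring)

lemma isDecaying_a_mul {ρ : ℝ → ℝ} (hρ : IsDecaying ν ρ) :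
    IsDecaying ν fun x => (h - 3 * s x + d2 k h s x) * ρ x :=
  hρ.mul_bounded W.continuous_a W.isBigO_a_one

lemma continuous_sol : Continuous (sol k h s r x₀) :=
  continuous_iff_continuousAt.2 fun x => (W.hasDerivAt_sol x).continuousAt

lemma continuous_sol1 : Continuous (sol1 k h s r x₀) := by
  have h1 : sol1 k h s r x₀ =
      fun x => u k h s x * ((h + 2 * k - s x) * sol1 k h s r x₀ x) := by
    funext x
    rw [← mul_assoc, W.u_mul, one_mul]
  rw [h1]
  exact W.continuous_u.mul
    (continuous_iff_continuousAt.2 fun x => (W.hasDerivAt_b_mul_sol1 x).continuousAt)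

lemma isPrimitive_d1 : IsPrimitive (fun x => (d1 s r x : ℂ)) fun x => (d2 k h s x : ℂ) :=
  isPrimitive_ofReal W.hasDerivAt_d1 W.continuous_d2

lemma isPrimitive_b_mul_d2 : IsPrimitive (fun x => (((h + 2 * k - s x) * d2 k h s x : ℝ) : ℂ))
    fun x => (((h - 3 * s x + d2 k h s x) * d1 s r x : ℝ) : ℂ) :=
  isPrimitive_ofReal W.hasDerivAt_b_mul_d2 (W.continuous_a.mul
    (continuous_iff_continuousAt.2 fun x => (W.hasDerivAt_d1 x).continuousAt))

lemma isPrimitive_sol : IsPrimitive (fun x => (sol k h s r x₀ x : ℂ))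
    fun x => (sol1 k h s r x₀ x : ℂ) :=
  isPrimitive_ofReal W.hasDerivAt_sol W.continuous_sol1

lemma isPrimitive_b_mul_sol1 :
    IsPrimitive (fun x => (((h + 2 * k - s x) * sol1 k h s r x₀ x : ℝ) : ℂ))
    fun x => (((h - 3 * s x + d2 k h s x) * sol k h s r x₀ x : ℝ) : ℂ) :=
  isPrimitive_ofReal W.hasDerivAt_b_mul_sol1 (W.continuous_a.mul W.continuous_sol)

/-! ### The kernel -/

variable {a b : ℝ →ᵇ ℝ} (ha : ∀ x, a x = h - 3 * s x + d2 k h s x)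
  (hb : ∀ x, b x = h + 2 * k - s x)
include ha hb

/-- By the Wronskian with a decaying and with a growing solution of `L v = 0`, the kernel is spanned
by the second derivative of the wave. -/
lemma exists_eq_smul_of_pencilOp_eq_zero (hν : 0 < ν) (hνn : ν < n) {g : WeightedL2 ν}
    (hg : pencilOp hν a b g = 0) : ∃ α : ℂ, g = α • (W.isDecaying_d2 hν hνn).toLp hν := by
  rw [pencilOp_apply, sub_eq_zero] at hg
  set S := antideriv hν with hS
  set p : WeightedL2 ν := mulOp ν a (S g) with hp
  have hV := g.isPrimitive_invDeriv hν
  have hP := p.isPrimitive_invDeriv hν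
  have hSg : S g =ᵐ[volume] invDeriv g := antideriv_ae hν g
  have hSp : S p =ᵐ[volume] invDeriv p := antideriv_ae hν p
  have hpae : p =ᵐ[volume] fun x => (a x : ℂ) * invDeriv g x := by
    filter_upwards [mulOp_ae a (S g), hSg] with x h1 h2
    rw [h1, h2]
  have hgae : ∀ᵐ x, (b x : ℂ) * g x = invDeriv p x := by
    have h1 := mulOp_ae b g
    rw [hg] at h1
    filter_upwards [h1, hSp] with x h2 h3
    rw [← h2, h3]
  -- the Wronskian with the derivative of the wave vanishes
  have hw := ((W.isPrimitive_d1).mul hP).add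
    ((((isPrimitive_ofReal (f := fun _ => (-1 : ℝ)) (f' := fun _ => 0)
      (fun x => hasDerivAt_const x _) continuous_const)).mul W.isPrimitive_b_mul_d2).mul hV)
  have hw0 : ∀ x, (d1 s r x : ℂ) * invDeriv p x
      - ((h + 2 * k - s x) * d2 k h s x : ℝ) * invDeriv g x = 0 := by
    have hconst := eq_of_isPrimitive_zero hw (by
      filter_upwards [hpae, hgae] with x h1 h2
      simp only [h1, ← h2, ha, hb, Pi.zero_apply]
      push_cast
      ring)
    have hd1 := ((W.isDecaying_d1 hν hνn).isDualWeight hν).integrable_mul (S p)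
    have hd2 := ((W.isDecaying_b_mul (W.isDecaying_d2 hν hνn)).isDualWeight hν).integrable_mul (S g)
    intro x
    have hint : Integrable fun _ : ℝ => (d1 s r x : ℂ) * invDeriv p x
        - ((h + 2 * k - s x) * d2 k h s x : ℝ) * invDeriv g x := by
      refine (hd1.sub hd2).congr ?_
      filter_upwards [hSg, hSp] with y h1 h2
      have := hconst y x
      simp only [Pi.sub_apply, h1, h2]
      push_cast at this ⊢
      linear_combination this
    rw [integrable_const_iff] at hint
    exact hint.resolve_right fun h1 => by simp [isFiniteMeasure_iff] at h1
  have hw' := ((W.isPrimitive_sol).mul hP).add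
    ((((isPrimitive_ofReal (f := fun _ => (-1 : ℝ)) (f' := fun _ => 0)
      (fun x => hasDerivAt_const x _) continuous_const)).mul W.isPrimitive_b_mul_sol1).mul hV)
  have hconst := eq_of_isPrimitive_zero hw' (by
    filter_upwards [hpae, hgae] with x h1 h2
    simp only [h1, ← h2, ha, hb, Pi.zero_apply]
    push_cast
    ring)
  set K : ℂ := (sol k h s r x₀ 0 : ℂ) * invDeriv p 0
      - ((h + 2 * k - s 0) * sol1 k h s r x₀ 0 : ℝ) * invDeriv g 0 with hK
  have hVeq : ∀ x, invDeriv g x = -K * d1 s r x := by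
    intro x
    have h1 := hconst x 0
    have h2 : (((h + 2 * k - s x) *
      (d1 s r x * sol1 k h s r x₀ x - sol k h s r x₀ x * d2 k h s x) : ℝ) : ℂ) = 1 := by
      rw [W.wronskian x, Complex.ofReal_one]
    have h3 := hw0 x
    push_cast at h1 h2 h3 hK
    rw [hK]
    linear_combination (-invDeriv g x) * h2 + (sol k h s r x₀ x) * h3 - (d1 s r x : ℂ) * h1
  refine ⟨-K, antideriv_injective hν ?_⟩
  rw [map_smul, (W.isDecaying_d1 hν hνn).antideriv_toLp hν _ W.hasDerivAt_d1]
  refine WeightedL2.ext ?_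
  filter_upwards [hSg, WeightedL2.coeFn_smul (-K) ((W.isDecaying_d1 hν hνn).toLp hν),
    (W.isDecaying_d1 hν hνn).toLp_ae hν] with x h1 h2 h3
  rw [h1, h2, h3, hVeq]

/-! ### The range -/

omit ha hb in
/-- The ratio of two values of the wave on the same side of the crest. -/
lemma s_div_le (hν : 0 < ν) {x y : ℝ} (hxy : x₀ ≤ y ∧ y ≤ x ∨ x ≤ y ∧ y ≤ x₀) (z : ℝ)
    (hz : z = ν * (y - x) ∨ z = ν * (x - y)) :
    s x / s y ≤ Real.exp 2 * Real.exp (z - (n - ν) * |x - y|) := by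
  rw [div_le_iff₀ (W.s_pos y)]
  have h1 : s x ≤ Real.exp 2 * Real.exp (-(n * |x - y|)) * s y := by
    rcases hxy with ⟨h1, h2⟩ | ⟨h1, h2⟩
    · exact W.decay_right h1 h2
    · exact W.decay_left h2 h1
  refine h1.trans (mul_le_mul_of_nonneg_right (mul_le_mul_of_nonneg_left (Real.exp_le_exp.2 ?_)
    (Real.exp_pos _).le) (W.s_pos y).le)
  rcases hz with rfl | rfl <;> nlinarith [neg_abs_le (x - y), le_abs_self (x - y)]

omit ha hb in
/-- The kernels in the variation of constants formula are dominated by an exponential kernel. -/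
lemma exists_variation_le (hν : 0 < ν) {α β : ℝ → ℝ} (hα : α =O[⊤] s)
    (hβ : (fun x => s x * β x) =O[⊤] (1 : ℝ → ℝ)) (hνn : ν < n) :
    ∃ c : NNReal, ∀ f : WeightedL2 ν, pair (d2 k h s) f = 0 → ∀ x,
      ‖(∫ y in x₀..x, (sol1 k h s r x₀ y : ℂ) * f y) * α x
        + (∫ y in Ioi x, (d2 k h s y : ℂ) * f y) * β x‖ₑ ≤
      c * ∫⁻ y, ENNReal.ofReal (Real.exp (ν * (y - x) - (n - ν) * |x - y|)) * ‖f y‖ₑ := by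
  obtain ⟨A, hA, hA'⟩ := hα.exists_nonneg
  obtain ⟨B, hB, hB'⟩ := hβ.exists_nonneg
  obtain ⟨A₂, hA₂, hA₂'⟩ := ((isBigO_one_mul W.isBigO_d2_coef (isBigO_refl s ⊤)).congr_left
    (f₂ := d2 k h s) fun x => by rw [d2]; ring).exists_nonneg
  obtain ⟨B₂, hB₂, hB₂'⟩ := (W.isBigO_s_mul_sol1).exists_nonneg
  have bA : ∀ x, |α x| ≤ A * s x := fun x => by
    simpa [abs_of_pos (W.s_pos x)] using isBigOWith_top.1 hA' x
  have bA₂ : ∀ x, |d2 k h s x| ≤ A₂ * s x := fun x => by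
    simpa [abs_of_pos (W.s_pos x)] using isBigOWith_top.1 hA₂' x
  have bB : ∀ x, |β x| ≤ B / s x := fun x => by
    have := isBigOWith_top.1 hB' x
    rw [le_div_iff₀ (W.s_pos x)]
    simpa [abs_of_pos (W.s_pos x), mul_comm, abs_mul] using this
  have bB₂ : ∀ x, |sol1 k h s r x₀ x| ≤ B₂ / s x := fun x => by
    have := isBigOWith_top.1 hB₂' x
    rw [le_div_iff₀ (W.s_pos x)]
    simpa [abs_of_pos (W.s_pos x), mul_comm, abs_mul] using this
  set c₁ := A * B₂ * Real.exp 2 with hc₁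
  set c₂ := A₂ * B * Real.exp 2 with hc₂
  have hc₁0 : 0 ≤ c₁ := by positivity
  have hc₂0 : 0 ≤ c₂ := by positivity
  refine ⟨c₁.toNNReal + c₂.toNNReal, fun f hf x => ?_⟩
  set Kx : ℝ → ℝ := fun y => Real.exp (ν * (y - x) - (n - ν) * |x - y|) with hKx
  have hlin : ∀ c : ℝ, 0 ≤ c → ∫⁻ y, ENNReal.ofReal (c * Kx y) * ‖f y‖ₑ =
      (c.toNNReal : ENNReal) * ∫⁻ y, ENNReal.ofReal (Kx y) * ‖f y‖ₑ := by
    intro c hc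
    rw [← lintegral_const_mul' _ _ ENNReal.coe_ne_top]
    refine lintegral_congr fun y => ?_
    rw [ENNReal.ofReal_mul hc, mul_assoc]
    rfl
  have hen : ∀ p : ℝ, ‖(p : ℂ)‖ₑ = ENNReal.ofReal |p| := fun p => by
    rw [← ofReal_norm, Complex.norm_real, Real.norm_eq_abs]
  -- the term with the decaying solution
  have e1 : ‖(∫ y in x₀..x, (sol1 k h s r x₀ y : ℂ) * f y) * α x‖ₑ ≤
      ∫⁻ y, ENNReal.ofReal (c₁ * Kx y) * ‖f y‖ₑ := by
    have h1 : ‖(∫ y in x₀..x, (sol1 k h s r x₀ y : ℂ) * f y) * α x‖ₑ =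
        ‖∫ y in uIoc x₀ x, ((α x * sol1 k h s r x₀ y : ℝ) : ℂ) * f y‖ₑ := by
      rw [enorm_mul, ← ofReal_norm, intervalIntegral.norm_intervalIntegral_eq, ofReal_norm,
        ← enorm_mul, mul_comm, ← integral_const_mul]
      simp only [Complex.ofReal_mul, mul_assoc]
    rw [h1]
    refine enorm_setIntegral_le measurableSet_uIoc fun y hy => ?_
    rw [hen]
    refine ENNReal.ofReal_le_ofReal ?_
    have hxy : x₀ ≤ y ∧ y ≤ x ∨ x ≤ y ∧ y ≤ x₀ := by
      rcases mem_uIoc.1 hy with h2 | h2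
      · exact Or.inl ⟨h2.1.le, h2.2⟩
      · exact Or.inr ⟨h2.1.le, h2.2⟩
    have h2 := W.s_div_le hν hxy _ (Or.inl rfl)
    rw [abs_mul]
    calc |α x| * |sol1 k h s r x₀ y| ≤ (A * s x) * (B₂ / s y) :=
          mul_le_mul (bA x) (bB₂ y) (abs_nonneg _) (mul_nonneg hA (W.s_pos x).le)
      _ = A * B₂ * (s x / s y) := by ring
      _ ≤ A * B₂ * (Real.exp 2 * Kx y) := mul_le_mul_of_nonneg_left h2 (by positivity)
      _ = c₁ * Kx y := by rw [hc₁]; ring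
  -- the term with the growing solution
  have e2 : ‖(∫ y in Ioi x, (d2 k h s y : ℂ) * f y) * β x‖ₑ ≤
      ∫⁻ y, ENNReal.ofReal (c₂ * Kx y) * ‖f y‖ₑ := by
    have hker : ∀ y, (x₀ ≤ x ∧ x ≤ y ∨ y ≤ x ∧ x ≤ x₀) →
        ‖((β x * d2 k h s y : ℝ) : ℂ)‖ₑ ≤ ENNReal.ofReal (c₂ * Kx y) := by
      intro y hxy
      rw [hen]
      refine ENNReal.ofReal_le_ofReal ?_
      have h2 := W.s_div_le hν hxy (ν * (y - x)) (Or.inr rfl)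
      rw [abs_sub_comm y x] at h2
      rw [abs_mul]
      calc |β x| * |d2 k h s y| ≤ (B / s x) * (A₂ * s y) :=
            mul_le_mul (bB x) (bA₂ y) (abs_nonneg _) (div_nonneg hB (W.s_pos x).le)
        _ = A₂ * B * (s y / s x) := by ring
        _ ≤ A₂ * B * (Real.exp 2 * Kx y) := mul_le_mul_of_nonneg_left h2 (by positivity)
        _ = c₂ * Kx y := by rw [hc₂]; ring
    rcases le_total x₀ x with hx | hx
    · rw [mul_comm, ← integral_const_mul]
      simp only [← mul_assoc, ← Complex.ofReal_mul]
      exact enorm_setIntegral_le measurableSet_Ioi fun y hy =>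
        hker y (Or.inl ⟨hx, le_of_lt hy⟩)
    · -- the integral over the whole line vanishes
      have hi := ((W.isDecaying_d2 hν hνn).isDualWeight hν).integrable_mul f
      have h3 : ∫ y in Ioi x, (d2 k h s y : ℂ) * f y = -∫ y in Iic x, (d2 k h s y : ℂ) * f y := by
        rw [← add_eq_zero_iff_eq_neg, add_comm, ← setIntegral_union (Iic_disjoint_Ioi le_rfl)
          measurableSet_Ioi hi.integrableOn hi.integrableOn, Iic_union_Ioi, setIntegral_univ]
        exact hf
      rw [h3, neg_mul, enorm_neg, mul_comm, ← integral_const_mul]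
      simp only [← mul_assoc, ← Complex.ofReal_mul]
      exact enorm_setIntegral_le measurableSet_Iic fun y hy => hker y (Or.inr ⟨hy, hx⟩)
  refine (enorm_add_le _ _).trans ((add_le_add e1 e2).trans ?_)
  rw [hlin c₁ hc₁0, hlin c₂ hc₂0, ENNReal.coe_add, add_mul]

end IsWaveChart

end

section

open Asymptotics
open scoped BoundedContinuousFunction

variable {ν : ℝ}

/-- A bounded continuous function. -/
def bddFun (f : ℝ → ℝ) (hc : Continuous f) (hO : f =O[⊤] (1 : ℝ → ℝ)) : ℝ →ᵇ ℝ :=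
  BoundedContinuousFunction.ofNormedAddCommGroup f hc (isBigO_top.1 hO).choose fun x => by
    simpa using (isBigO_top.1 hO).choose_spec x

lemma antideriv_eq_of_isPrimitive (hν : 0 < ν) {V : ℝ → ℂ} {v g : WeightedL2 ν}
    (hv : v =ᵐ[volume] V) (h : IsPrimitive V g) : antideriv hν g = v := by
  symm
  rw [← isWeakDeriv_iff hν]
  intro χ hχ
  rw [← h.isWeakDeriv χ hχ]
  refine integral_congr_ae ?_
  filter_upwards [hv] with x hx
  rw [hx]

namespace IsWaveChart

variable {k h n : ℝ} {s r q : ℝ → ℝ} {x₀ : ℝ} (W : IsWaveChart k h n s r q x₀)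
  {a b : ℝ →ᵇ ℝ} (ha : ∀ x, a x = h - 3 * s x + d2 k h s x)
  (hb : ∀ x, b x = h + 2 * k - s x)
include W ha hb

/-- Variation of constants: the range contains the kernel of the pairing with the second derivative
of the wave. -/
lemma exists_pencilOp_eq (hν : 0 < ν) (hνn : ν < n) {f : WeightedL2 ν}
    (hf : pair (d2 k h s) f = 0) : ∃ g, pencilOp hν a b g = f := by
  set c₁ : ℝ → ℂ := fun x => ∫ y in x₀..x, (sol1 k h s r x₀ y : ℂ) * f y with hc₁
  set c₂ : ℝ → ℂ := fun x => ∫ y in Ioi x, (d2 k h s y : ℂ) * f y with hc₂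
  have hfi : ∀ x y, IntervalIntegrable f volume x y :=
    (f.isPrimitive_invDeriv hν).intervalIntegrable
  have p₁ : IsPrimitive c₁ fun x => (sol1 k h s r x₀ x : ℂ) * f x := by
    have hi : ∀ x y, IntervalIntegrable (fun x => (sol1 k h s r x₀ x : ℂ) * f x) volume x y :=
      fun x y => (hfi x y).continuousOn_mul
        (Complex.continuous_ofReal.comp W.continuous_sol1).continuousOn
    exact ⟨hi, fun x y => intervalIntegral.integral_interval_sub_left (hi _ _) (hi _ _)⟩
  have p₂ : IsPrimitive c₂ fun x => -((d2 k h s x : ℂ) * f x) := by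
    have hi := ((W.isDecaying_d2 hν hνn).isDualWeight hν).integrable_mul f
    refine ⟨fun x y => hi.neg.intervalIntegrable, fun x y => ?_⟩
    rw [intervalIntegral.integral_neg,
      ← intervalIntegral.integral_Ioi_sub_Ioi' hi.integrableOn hi.integrableOn, neg_sub]
  have pV := (p₁.mul W.isPrimitive_d1).add (p₂.mul W.isPrimitive_sol)
  have pQ := (p₁.mul W.isPrimitive_b_mul_d2).add (p₂.mul W.isPrimitive_b_mul_sol1)
  obtain ⟨K, hK⟩ := exists_eLpNorm_le ν (sub_pos.2 hνn)
  have hmem : ∀ {α β : ℝ → ℝ}, α =O[⊤] s → (fun x => s x * β x) =O[⊤] (1 : ℝ → ℝ) →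
      Continuous (fun x => c₁ x * α x + c₂ x * β x) →
      MemLp (fun x => c₁ x * α x + c₂ x * β x) 2 (expWeight ν) := by
    intro α β hα hβ hcont
    obtain ⟨c, hc⟩ := W.exists_variation_le hν hα hβ hνn
    refine ⟨aestronglyMeasurable_expWeight.2 hcont.aestronglyMeasurable, ?_⟩
    exact lt_of_le_of_lt (hK f _ c f.aestronglyMeasurable (hc f hf))
      (ENNReal.mul_lt_top (by rw [← ENNReal.coe_mul]; exact ENNReal.coe_lt_top) (Lp.memLp f).2)
  have hs : s =O[⊤] s := isBigO_refl s ⊤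
  have mV : MemLp (fun x => c₁ x * d1 s r x + c₂ x * sol k h s r x₀ x) 2 (expWeight ν) :=
    hmem (isBigO_one_mul W.isBigO_r_one hs).neg_left W.isBigO_s_mul_sol pV.continuous
  have mQ : MemLp (fun x => c₁ x * ((h + 2 * k - s x) * d2 k h s x : ℝ)
      + c₂ x * ((h + 2 * k - s x) * sol1 k h s r x₀ x : ℝ)) 2 (expWeight ν) := by
    refine hmem (isBigO_one_mul W.isBigO_b_one ?_) ?_ pQ.continuous
    · exact (isBigO_one_mul W.isBigO_d2_coef hs).congr_left fun x => by rw [d2]; ring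
    · exact (isBigO_one_mul W.isBigO_b_one W.isBigO_s_mul_sol1).congr_left fun x => by ring
  set v : WeightedL2 ν := mV.toLp _ with hv
  set p : WeightedL2 ν := mQ.toLp _ with hp
  have aeV := WeightedL2.coeFn_toLp mV
  have aeQ := WeightedL2.coeFn_toLp mQ
  set w := bddFun (u k h s) W.continuous_u W.isBigO_u_one with hw
  set g := mulOp ν w (f + p) with hg
  have aeg : ∀ᵐ x, g x = (u k h s x : ℂ) * (f x + p x) := by
    filter_upwards [mulOp_ae w (f + p), WeightedL2.coeFn_add f p] with x h1 h2
    rw [h1, h2]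
    rfl
  have e1 : antideriv hν g = v := by
    refine antideriv_eq_of_isPrimitive hν aeV (pV.congr ?_)
    filter_upwards [aeg, aeQ] with x h1 h2
    have h3 : ((u k h s x * (h + 2 * k - s x) : ℝ) : ℂ) = 1 := by
      rw [W.u_mul, Complex.ofReal_one]
    have h4 : (((h + 2 * k - s x) *
      (d1 s r x * sol1 k h s r x₀ x - sol k h s r x₀ x * d2 k h s x) : ℝ) : ℂ) = 1 := by
      rw [W.wronskian x, Complex.ofReal_one]
    rw [h1, hp, h2]
    push_cast at h3 h4 ⊢
    linear_combination (u k h s x * f x) * h4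
      - (c₁ x * d2 k h s x + c₂ x * sol1 k h s r x₀ x
        + f x * (d1 s r x * sol1 k h s r x₀ x - sol k h s r x₀ x * d2 k h s x)) * h3
  have e2 : antideriv hν (mulOp ν a v) = p := by
    refine antideriv_eq_of_isPrimitive hν aeQ (pQ.congr ?_)
    filter_upwards [mulOp_ae a v, aeV] with x h1 h2
    rw [h1, hv, h2, ha]
    push_cast
    ring
  refine ⟨g, ?_⟩
  rw [pencilOp_apply, e1, e2, sub_eq_iff_eq_add]
  refine WeightedL2.ext ?_
  filter_upwards [mulOp_ae b g, aeg, WeightedL2.coeFn_add f p] with x h1 h2 h3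
  rw [h1, h2, h3, hb, ← mul_assoc, ← Complex.ofReal_mul, mul_comm (h + 2 * k - s x), W.u_mul,
    Complex.ofReal_one, one_mul]

/-! ### The transposed Jordan chain -/

lemma pair_d2_pencilOp (hν : 0 < ν) (hνn : ν < n) (g : WeightedL2 ν) :
    pair (d2 k h s) (pencilOp hν a b g) = 0 := by
  have hd1 := W.isDecaying_d1 hν hνn
  have hd2 := W.isDecaying_d2 hν hνn
  have e : (fun x => a x * d1 s r x) = fun x => (h - 3 * s x + d2 k h s x) * d1 s r x := by
    simp only [ha]
  have e' : (fun x => b x * d2 k h s x) = fun x => (h + 2 * k - s x) * d2 k h s x := by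
    simp only [hb]
  rw [pencilOp_apply, hd2.pair_sub hν, hd1.pair_antideriv hν hd2 W.hasDerivAt_d1, pair_mulOp,
    pair_mulOp, e, e', (W.isDecaying_b_mul hd2).pair_antideriv hν (W.isDecaying_a_mul hd1)
      W.hasDerivAt_b_mul_d2]
  ring

lemma pair_gen1_pencilOp (hν : 0 < ν) (hνn : ν < n) (g : WeightedL2 ν) :
    -pair (gen1 k h s r q) (pencilOp hν a b g) = pair (d2 k h s) (weightOp hν g) := by
  have hs := W.isDecaying_s hν hνn
  have hd1 := W.isDecaying_d1 hν hνn
  have hd2 := W.isDecaying_d2 hν hνn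
  have hg := W.isDecaying_gen hν hνn
  have hg1 := W.isDecaying_gen1 hν hνn
  have e : (fun x => a x * gen k h s r q x) =
      fun x => (h - 3 * s x + d2 k h s x) * gen k h s r q x := by
    simp only [ha]
  have e' : (fun x => b x * gen1 k h s r q x) = fun x => (h + 2 * k - s x) * gen1 k h s r q x := by
    simp only [hb]
  have h1 := (W.isDecaying_b_mul hg1).pair_antideriv hν ((W.isDecaying_a_mul hg).sub (hs.sub hd2))
    W.hasDerivAt_b_mul_gen1 g
  rw [(W.isDecaying_a_mul hg).pair_sub_left hν (hs.sub hd2), hs.pair_sub_left hν hd2] at h1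
  rw [pencilOp_apply, weightOp_apply, hg1.pair_sub hν, hd2.pair_sub hν,
    hg.pair_antideriv hν hg1 W.hasDerivAt_gen, hd1.pair_antideriv hν hd2 W.hasDerivAt_d1
      (antideriv hν _), hs.pair_antideriv hν hd1 W.hasDerivAt_s, pair_mulOp,
    pair_mulOp, e, e']
  linear_combination -h1

end IsWaveChart

end

section

open Asymptotics
open scoped BoundedContinuousFunction

variable {ν : ℝ}

/-! ### The coefficients of the bifurcation equation -/

/-- Integration by parts for two antiderivatives. -/
lemma IsDecaying.pair_antideriv_add_pair_antideriv {ρ σ : ℝ → ℝ} (hν : 0 < ν)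
    (h : IsDecaying ν ρ) (h' : IsDecaying ν σ) :
    pair ρ (antideriv hν (h'.toLp hν)) + pair σ (antideriv hν (h.toLp hν)) =
      ((-((∫ x, ρ x) * ∫ x, σ x) : ℝ) : ℂ) := by
  -- the antiderivative vanishing at infinity
  have key : ∀ {f : ℝ → ℝ} (hf : IsDecaying ν f), ∃ R : ℝ → ℝ, (∀ x, HasDerivAt R (f x) x) ∧
      Tendsto R atTop (𝓝 0) ∧ Tendsto R atBot (𝓝 (-∫ x, f x)) ∧
      R =O[⊤] (1 : ℝ → ℝ) ∧ antideriv hν (hf.toLp hν) =ᵐ[volume] fun x => (R x : ℂ) := by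
    intro f hf
    have hi := hf.integrable hν
    have hR : ∀ x, HasDerivAt (fun x => (∫ y in (0 : ℝ)..x, f y) - ∫ y in Ioi (0 : ℝ), f y)
        (f x) x := fun x =>
      (intervalIntegral.integral_hasDerivAt_right (hf.continuous.intervalIntegrable _ _)
        (hf.continuous.stronglyMeasurableAtFilter _ _) hf.continuous.continuousAt).sub_const _
    have hRx : ∀ x, (∫ y in (0 : ℝ)..x, f y) - ∫ y in Ioi (0 : ℝ), f y = -∫ y in Ioi x, f y := by
      intro x
      rw [← intervalIntegral.integral_Ioi_sub_Ioi' hi.integrableOn hi.integrableOn]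
      ring
    refine ⟨_, hR, ?_, ?_, ?_, ?_⟩
    · have h1 := (intervalIntegral_tendsto_integral_Ioi 0 hi.integrableOn tendsto_id).sub_const
        (∫ y in Ioi (0 : ℝ), f y)
      rwa [sub_self] at h1
    · have h1 := ((intervalIntegral_tendsto_integral_Iic 0 hi.integrableOn
        tendsto_id).neg.sub_const (∫ y in Ioi (0 : ℝ), f y))
      have h2 : -(∫ y in Iic (0 : ℝ), f y) - ∫ y in Ioi (0 : ℝ), f y = -∫ x, f x := by
        rw [← neg_add', ← setIntegral_union (Iic_disjoint_Ioi le_rfl) measurableSet_Ioi hi.integrableOn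
            hi.integrableOn, Iic_union_Ioi, setIntegral_univ]
      rw [h2] at h1
      refine h1.congr fun x => ?_
      rw [id, intervalIntegral.integral_symm, neg_neg]
    · refine isBigO_top.2 ⟨∫ y, ‖f y‖, fun x => ?_⟩
      rw [hRx, norm_neg, Pi.one_apply, norm_one, mul_one]
      exact (norm_integral_le_integral_norm _).trans
        (setIntegral_le_integral hi.norm (Eventually.of_forall fun _ => norm_nonneg _))
    · filter_upwards [antideriv_ae hν (hf.toLp hν)] with x hx
      rw [hx, invDeriv_congr (hf.toLp_ae hν), invDeriv, hRx, Complex.ofReal_neg,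
        integral_complex_ofReal]
  obtain ⟨R, dR, R1, R2, R3, R4⟩ := key h
  obtain ⟨Q, dQ, Q1, Q2, Q3, Q4⟩ := key h'
  have cR : Continuous R := continuous_iff_continuousAt.2 fun x => (dR x).continuousAt
  have cQ : Continuous Q := continuous_iff_continuousAt.2 fun x => (dQ x).continuousAt
  have e1 : pair ρ (antideriv hν (h'.toLp hν)) = ((∫ x, ρ x * Q x : ℝ) : ℂ) := by
    rw [pair, ← integral_complex_ofReal]
    refine integral_congr_ae ?_
    filter_upwards [Q4] with x hx
    rw [hx, Complex.ofReal_mul]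
  have e2 : pair σ (antideriv hν (h.toLp hν)) = ((∫ x, R x * σ x : ℝ) : ℂ) := by
    rw [pair, ← integral_complex_ofReal]
    refine integral_congr_ae ?_
    filter_upwards [R4] with x hx
    rw [hx, Complex.ofReal_mul, mul_comm]
  have i1 : Integrable fun x => ρ x * Q x :=
    ((h.mul_bounded cQ Q3).integrable hν).congr (Eventually.of_forall fun x => mul_comm _ _)
  have i2 : Integrable fun x => R x * σ x := (h'.mul_bounded cR R3).integrable hν
  rw [e1, e2, ← Complex.ofReal_add, ← integral_add i1 i2]
  congr 1
  rw [integral_of_hasDerivAt_of_tendsto (fun x => (dR x).mul (dQ x)) (i1.add i2) (R2.mul Q2)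
    (R1.mul Q1)]
  ring

lemma integral_pos_of_continuous {f : ℝ → ℝ} (hf : Continuous f) (hi : Integrable f)
    (h0 : ∀ x, 0 ≤ f x) {x : ℝ} (hx : f x ≠ 0) : 0 < ∫ x, f x := by
  rw [integral_pos_iff_support_of_nonneg h0 hi]
  exact (hf.isOpen_support).measure_pos volume ⟨x, hx⟩

namespace IsWaveChart

variable {k h n : ℝ} {s r q : ℝ → ℝ} {x₀ : ℝ} (W : IsWaveChart k h n s r q x₀)
include W

lemma tendsto_u {l : Filter ℝ} (hs : Tendsto s l (𝓝 0)) :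
    Tendsto (u k h s) l (𝓝 (h + 2 * k)⁻¹) := by
  have h1 := hs.const_sub (h + 2 * k)
  rw [sub_zero] at h1
  exact h1.inv₀ (by linarith [W.h_pos, W.k_pos])

lemma tendsto_abs_r {l : Filter ℝ} (hs : Tendsto s l (𝓝 0)) :
    Tendsto (fun x => |r x|) l (𝓝 n) := by
  have h1 := ((W.tendsto_u hs).const_mul (2 * k)).const_sub 1
  have h0 : h + 2 * k ≠ 0 := by linarith [W.h_pos, W.k_pos]
  have h2 : 1 - 2 * k * (h + 2 * k)⁻¹ = n ^ 2 := by
    field_simp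
    linear_combination -W.n_sq
  rw [h2] at h1
  have h3 := h1.sqrt
  rw [Real.sqrt_sq W.n_pos.le] at h3
  refine h3.congr fun x => ?_
  rw [← W.r_sq', Real.sqrt_sq_eq_abs]

lemma tendsto_r_atTop (hν : 0 < ν) (hνn : ν < n) : Tendsto r atTop (𝓝 n) := by
  refine (W.tendsto_abs_r ((W.isDecaying_s hν hνn).tendsto_atTop hν)).congr' ?_
  filter_upwards [eventually_ge_atTop x₀] with x hx
  exact abs_of_nonneg (W.r_crest ▸ W.monotone_r hx)

lemma tendsto_r_atBot (hν : 0 < ν) (hνn : ν < n) : Tendsto r atBot (𝓝 (-n)) := by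
  refine (W.tendsto_abs_r ((W.isDecaying_s hν hνn).tendsto_atBot hν)).neg.congr' ?_
  filter_upwards [eventually_le_atBot x₀] with x hx
  rw [abs_of_nonpos (W.r_crest ▸ W.monotone_r hx), neg_neg]

lemma isDecaying_q_mul_s (hν : 0 < ν) (hνn : ν < n) : IsDecaying ν fun x => q x * s x :=
  IsDecaying.of_forall_lt hν hνn (W.continuous_q.mul W.continuous_s) fun _ => W.isBigO_q_mul_s

/-- The integral of a derivative of `r f + q s g` when `f` tends to a constant and `g` is
bounded. -/
lemma integral_eq_of_hasDerivAt (hν : 0 < ν) (hνn : ν < n) {f g F : ℝ → ℝ} {l : ℝ}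
    (hf : Tendsto f atTop (𝓝 l)) (hf' : Tendsto f atBot (𝓝 l)) (hg : Continuous g)
    (hg' : g =O[⊤] (1 : ℝ → ℝ))
    (hF : ∀ x, HasDerivAt (fun x => r x * f x + g x * (q x * s x)) (F x) x)
    (hi : Integrable F) : ∫ x, F x = 2 * n * l := by
  have hd := (W.isDecaying_q_mul_s hν hνn).mul_bounded hg hg'
  rw [integral_of_hasDerivAt_of_tendsto hF hi
    (((W.tendsto_r_atBot hν hνn).mul hf').add (hd.tendsto_atBot hν))
    (((W.tendsto_r_atTop hν hνn).mul hf).add (hd.tendsto_atTop hν))]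
  ring

/-- The total mass of the generalized eigenfunction. -/
lemma integral_gen (hν : 0 < ν) (hνn : ν < n) : ∫ x, gen k h s r q x = -(2 / n) := by
  have hn := W.n_pos
  have hh := W.h_pos
  have hs := W.isDecaying_s hν hνn
  have h1 := W.integral_eq_of_hasDerivAt hν hνn (f := fun x => -(h + 2 * k - s x) / h)
    (g := fun _ => -(k / h)) (F := gen k h s r q) (l := -(h + 2 * k - 0) / h)
    ((((hs.tendsto_atTop hν).const_sub _).neg).div_const h)
    ((((hs.tendsto_atBot hν).const_sub _).neg).div_const h) continuous_const
    (isBigO_const_one _) (fun x => ?_) ((W.isDecaying_gen hν hνn).integrable hν)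
  · rw [h1, sub_zero]
    have := W.n_sq
    field_simp
    linear_combination -this
  · refine HasDerivAt.congr_deriv (((W.hasDerivAt_r' x).mul ((W.hasDerivAt_b x).neg.div_const
      h)).add (((W.hasDerivAt_q' x).mul (W.hasDerivAt_s x)).const_mul (-(k / h)))) ?_
    have h1 := W.u_mul x
    have h2 := W.r_sq' x
    simp only [gen, Pi.neg_apply]
    generalize u k h s x = u at *
    generalize s x = s at *
    generalize r x = r at *
    field_simp
    grind

/-- The second derivative at the origin of the determinant of the pencil, which is essentially the
derivative of the momentum of the wave with respect to the speed. -/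
lemma integral_gen_mul (hν : 0 < ν) (hνn : ν < n) :
    ∫ x, gen k h s r q x * (d2 k h s x - s x) = 2 * h / n := by
  have hn := W.n_pos
  have hh := W.h_pos
  have hs := W.isDecaying_s hν hνn
  have h1 := W.integral_eq_of_hasDerivAt hν hνn
    (f := fun x => k / h * s x + (h + 2 * k))
    (g := fun x => k / h * k * s x * u k h s x)
    (F := fun x => gen k h s r q x * (d2 k h s x - s x)) (l := k / h * 0 + (h + 2 * k))
    (((hs.tendsto_atTop hν).const_mul _).add_const _)
    (((hs.tendsto_atBot hν).const_mul _).add_const _)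
    ((continuous_const.mul W.continuous_s).mul W.continuous_u)
    (isBigO_one_mul (isBigO_one_mul (isBigO_const_one _) W.isBigO_s_one) W.isBigO_u_one)
    (fun x => ?_) (((W.isDecaying_gen hν hνn).mul hν
      ((W.isDecaying_d2 hν hνn).sub hs)).integrable hν)
  · rw [h1, mul_zero, zero_add]
    have := W.n_sq
    field_simp
    linear_combination this
  · refine HasDerivAt.congr_deriv (((W.hasDerivAt_r' x).mul (((W.hasDerivAt_s x).const_mul
      (k / h)).add_const (h + 2 * k))).add ((((W.hasDerivAt_s x).const_mul (k / h * k)).mul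
      (W.hasDerivAt_u x)).mul ((W.hasDerivAt_q' x).mul (W.hasDerivAt_s x)))) ?_
    have h1 := W.u_mul x
    have h2 := W.r_sq' x
    simp only [gen, d2, Pi.mul_apply]
    generalize u k h s x = u at *
    generalize s x = s at *
    generalize r x = r at *
    field_simp
    grind

lemma integral_d2_sq_pos (hν : 0 < ν) (hνn : ν < n) : 0 < ∫ x, d2 k h s x * d2 k h s x := by
  have hd2 := W.isDecaying_d2 hν hνn
  refine integral_pos_of_continuous (hd2.continuous.mul hd2.continuous)
    ((hd2.mul hν hd2).integrable hν) (fun x => mul_self_nonneg _) (x := x₀) ?_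
  have h1 := W.r_sq x₀
  rw [W.r_crest] at h1
  have h2 : s x₀ = h := by linarith
  have := W.k_pos
  have := W.u_pos x₀
  have := W.h_pos
  have h3 : d2 k h s x₀ = -(k * h ^ 2 * u k h s x₀ ^ 2) := by rw [d2, h2]; ring
  rw [h3]
  exact mul_self_ne_zero.2 (neg_ne_zero.2 (by positivity))

/-- The data of the bifurcation problem. The chains consist of derivatives: `g₀, g₁` are `φ''` and
`gen'`, because `v = ∂ₓ⁻¹ g`, and `l₀, l₁` are the pairings with `φ''` and `-gen'`, since `∂ₓ⁻¹` is
skew for the pairing and the pencil at the origin is symmetric. The factor makes `l₀ g₀ = 1`. -/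
def bifurcationData (hν : 0 < ν) (hνn : ν < n) (a b : ℝ →ᵇ ℝ)
    (ha : ∀ x, a x = h - 3 * s x + d2 k h s x) (hb : ∀ x, b x = h + 2 * k - s x) :
    BifurcationData (WeightedL2 ν) where
  P₀ := pencilOp hν a b
  N := weightOp hν
  M := antideriv hν ^ 4
  g₀ := (W.isDecaying_d2 hν hνn).toLp hν
  g₁ := (W.isDecaying_gen1 hν hνn).toLp hν
  l₀ := ((∫ x, d2 k h s x * d2 k h s x : ℝ) : ℂ)⁻¹ •
    ((W.isDecaying_d2 hν hνn).isDualWeight hν).pairing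
  l₁ := ((∫ x, d2 k h s x * d2 k h s x : ℝ) : ℂ)⁻¹ •
    -((W.isDecaying_gen1 hν hνn).isDualWeight hν).pairing
  map_g₀ := by
    have hd1 := W.isDecaying_d1 hν hνn
    have hd2 := W.isDecaying_d2 hν hνn
    rw [pencilOp_apply, hd1.antideriv_toLp hν hd2 W.hasDerivAt_d1, sub_eq_zero]
    symm
    refine antideriv_eq_of_isPrimitive hν ?_ (W.isPrimitive_b_mul_d2.congr ?_)
    · filter_upwards [mulOp_ae b (hd2.toLp hν), hd2.toLp_ae hν] with x h1 h2
      rw [h1, h2, hb, Complex.ofReal_mul]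
    · filter_upwards [mulOp_ae a (hd1.toLp hν), hd1.toLp_ae hν] with x h1 h2
      rw [h1, h2, ha, Complex.ofReal_mul]
  map_g₁ := by
    have hs := W.isDecaying_s hν hνn
    have hd1 := W.isDecaying_d1 hν hνn
    have hd2 := W.isDecaying_d2 hν hνn
    have hg := W.isDecaying_gen hν hνn
    have hg1 := W.isDecaying_gen1 hν hνn
    rw [pencilOp_apply, weightOp_apply, hg.antideriv_toLp hν hg1 W.hasDerivAt_gen,
      hd1.antideriv_toLp hν hd2 W.hasDerivAt_d1, hs.antideriv_toLp hν hd1 W.hasDerivAt_s,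
      sub_eq_sub_iff_sub_eq_sub, ← map_sub]
    symm
    have hp := isPrimitive_ofReal (fun x => (W.hasDerivAt_b_mul_gen1 x).sub (W.hasDerivAt_d1 x))
      (((W.isDecaying_a_mul hg).sub (hs.sub hd2)).sub hd2).continuous
    refine antideriv_eq_of_isPrimitive hν ?_ (hp.congr ?_)
    · filter_upwards [WeightedL2.coeFn_sub (mulOp ν b (hg1.toLp hν)) (hd1.toLp hν),
        mulOp_ae b (hg1.toLp hν), hg1.toLp_ae hν, hd1.toLp_ae hν] with x h1 h2 h3 h4
      rw [h1, h2, h3, h4, hb, Pi.sub_apply]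
      push_cast
      ring
    · filter_upwards [WeightedL2.coeFn_sub (mulOp ν a (hg.toLp hν)) (hs.toLp hν),
        mulOp_ae a (hg.toLp hν), hg.toLp_ae hν, hs.toLp_ae hν] with x h1 h2 h3 h4
      rw [h1, h2, h3, h4, ha]
      push_cast
      ring
  ker g hg := W.exists_eq_smul_of_pencilOp_eq_zero ha hb hν hνn hg
  range f hf := by
    refine W.exists_pencilOp_eq ha hb hν hνn ?_
    rw [smul_apply, smul_eq_mul, (W.isDecaying_d2 hν hνn).pairing_eq hν] at hf
    refine (mul_eq_zero.1 hf).resolve_left (inv_ne_zero ?_)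
    exact_mod_cast (W.integral_d2_sq_pos hν hνn).ne'
  l₀_map g := by
    rw [smul_apply, smul_eq_mul, (W.isDecaying_d2 hν hνn).pairing_eq hν,
      W.pair_d2_pencilOp ha hb hν hνn, mul_zero]
  l₁_map g := by
    rw [smul_apply, smul_apply, neg_apply, (W.isDecaying_gen1 hν hνn).pairing_eq hν,
      (W.isDecaying_d2 hν hνn).pairing_eq hν,
      W.pair_gen1_pencilOp ha hb hν hνn]
  l₀_g₀ := by
    rw [smul_apply, smul_eq_mul, (W.isDecaying_d2 hν hνn).pairing_eq hν, IsDecaying.pair_toLp]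
    refine inv_mul_cancel₀ ?_
    exact_mod_cast (W.integral_d2_sq_pos hν hνn).ne'

/-- The multiplicity of the eigenvalue `0` and the two branches, from the abstract bifurcation
theorem. Up to the factor `(∫ φ''²)⁻¹` the coefficients are `A₀ = ∫ s²`, `B₀ = 2 h / n`,
`A₁ = (2 / n) ∫ s` and `B₁ = 2 / n²`, so that the sign condition `A₀ B₁ < A₁ B₀` reads
`∫ s² < 2 h ∫ s`. -/
theorem exists_branches (hν : 0 < ν) (hν1 : ν < 1) (hνn : ν < n) {a b : ℝ →ᵇ ℝ}
    (ha : ∀ x, a x = h - 3 * s x + d2 k h s x) (hb : ∀ x, b x = h + 2 * k - s x) :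
    HasAlgMultiplicity (linOp ν 0 a b) 0 2 ∧
      ∃ η₀ : ℝ, 0 < η₀ ∧ ∃ zp zm : ℝ → ℂ,
        ContinuousOn zp (Set.Ioo (-η₀) η₀) ∧ ContinuousOn zm (Set.Ioo (-η₀) η₀) ∧
        zp 0 = 0 ∧ zm 0 = 0 ∧
        ∀ η ∈ Set.Ioo (-η₀) η₀, η ≠ 0 →
          IsSimpleEigenvalue (linOp ν η a b) (zp η) ∧ IsSimpleEigenvalue (linOp ν η a b) (zm η) ∧
          (zp η).re = (zm η).re ∧ (zp η).re < 0 ∧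
          (zp η).im = -(zm η).im ∧ 0 < (zp η).im := by
  have hs := W.isDecaying_s hν hνn
  have hd1 := W.isDecaying_d1 hν hνn
  have hd2 := W.isDecaying_d2 hν hνn
  have hg := W.isDecaying_gen hν hνn
  have hg1 := W.isDecaying_gen1 hν hνn
  have hn := W.n_pos
  have hh := W.h_pos
  have hτ := W.integral_d2_sq_pos hν hνn
  set τ : ℝ := ∫ x, d2 k h s x * d2 k h s x with hτ_def
  set d := W.bifurcationData hν hνn a b ha hb with hd
  have hl₀ : ∀ f, d.l₀ f = (τ : ℂ)⁻¹ * pair (d2 k h s) f := fun f => by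
    rw [← hd2.pairing_eq hν]; rfl
  have hl₁ : ∀ f, d.l₁ f = (τ : ℂ)⁻¹ * -pair (gen1 k h s r q) f := fun f => by
    rw [← hg1.pairing_eq hν]; rfl
  have hM : ∀ g, d.M g = antideriv hν (antideriv hν (antideriv hν (antideriv hν g))) :=
    fun g => rfl
  have hN : ∀ g, d.N g = antideriv hν g - antideriv hν (antideriv hν (antideriv hν g)) :=
    weightOp_apply hν
  have S0 : antideriv hν d.g₀ = hd1.toLp hν := hd1.antideriv_toLp hν hd2 W.hasDerivAt_d1
  have S1 : antideriv hν (hd1.toLp hν) = hs.toLp hν := hs.antideriv_toLp hν hd1 W.hasDerivAt_s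
  have S2 : antideriv hν d.g₁ = hg.toLp hν := hg.antideriv_toLp hν hg1 W.hasDerivAt_gen
  have P1 := fun f => hd1.pair_antideriv hν hd2 W.hasDerivAt_d1 f
  have P2 := fun f => hs.pair_antideriv hν hd1 W.hasDerivAt_s f
  have P3 := fun f => hg.pair_antideriv hν hg1 W.hasDerivAt_gen f
  have hreal : d.IsReal (conjOp ν) := by
    refine ⟨fun g => ?_, fun g => ?_, fun g => ?_, fun g => ?_, fun g => ?_, hd2.conjOp_toLp hν⟩
    · change pencilOp hν a b _ = conjOp ν (pencilOp hν a b g)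
      rw [pencilOp_apply, pencilOp_apply, map_sub]
      simp only [antideriv_conjOp, mulOp_conjOp]
    · rw [hN, hN, map_sub]
      simp only [antideriv_conjOp]
    · rw [hM, hM]
      simp only [antideriv_conjOp]
    · rw [hl₀, hl₀, pair_conjOp, map_mul, map_inv₀, Complex.conj_ofReal]
    · rw [hl₁, hl₁, pair_conjOp, map_mul, map_inv₀, Complex.conj_ofReal, map_neg]
  have hi₀ : 0 < ∫ x, s x :=
    integral_pos_of_continuous hs.continuous (hs.integrable hν) (fun x => (W.s_pos x).le)
      (x := x₀) (W.s_pos x₀).ne'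
  have hi₁ : 0 < ∫ x, s x * s x :=
    integral_pos_of_continuous (hs.continuous.mul hs.continuous) ((hs.mul hν hs).integrable hν)
      (fun x => mul_self_nonneg _) (x := x₀) (mul_self_ne_zero.2 (W.s_pos x₀).ne')
  have hi₂ : ∫ x, s x * s x ≤ h * ∫ x, s x := by
    rw [← integral_const_mul]
    exact integral_mono ((hs.mul hν hs).integrable hν) ((hs.integrable hν).const_mul h)
      fun x => mul_le_mul_of_nonneg_right (W.s_le x) (W.s_pos x).le
  refine d.exists_branches (fun η => isEncodedBy_linOp hν hν1 η a b) rfl hreal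
    (A₀ := τ⁻¹ * ∫ x, s x * s x) (B₀ := τ⁻¹ * (2 * h / n)) (A₁ := τ⁻¹ * (2 / n * ∫ x, s x))
    (B₁ := τ⁻¹ * (2 / n ^ 2)) ?_ ?_ ?_ ?_ (by positivity) (by positivity) ?_
  · rw [hl₀, hM, S0, S1, P1, P2, neg_neg, hs.pair_toLp hν]
    push_cast
    ring
  · rw [hl₁, hN, hg1.pair_sub hν, P3, S0, S1, P3, hs.pair_toLp hν, ← W.integral_gen_mul hν hνn]
    have h1 : pair (gen k h s r q) d.g₀ = ((∫ x, gen k h s r q x * d2 k h s x : ℝ) : ℂ) :=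
      hd2.pair_toLp hν
    have h2 : ∫ x, gen k h s r q x * (d2 k h s x - s x) =
        (∫ x, gen k h s r q x * d2 k h s x) - ∫ x, gen k h s r q x * s x := by
      rw [← integral_sub ((hg.mul hν hd2).integrable hν) ((hg.mul hν hs).integrable hν)]
      simp only [mul_sub]
    rw [h1, h2]
    push_cast
    ring
  · have h1 := hs.pair_antideriv_add_pair_antideriv hν hg
    rw [W.integral_gen hν hνn] at h1
    rw [hl₀, hl₁, hM, hM, S0, S1, S2, P1, P2, P3, neg_neg, neg_neg, ← mul_add, h1]
    push_cast
    ring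
  · have h1 := hg.pair_antideriv_add_pair_antideriv hν hg
    rw [W.integral_gen hν hνn] at h1
    -- the integral of `v v'` vanishes
    have h2 : pair (gen1 k h s r q) (hg.toLp hν) = 0 := by
      have h3 : pair (gen1 k h s r q) (hg.toLp hν) = -pair (gen1 k h s r q) (hg.toLp hν) := by
        conv_lhs => rw [← S2, P3]
        rw [hg.pair_toLp hν]
        have h4 : pair (gen k h s r q) d.g₁ =
            ((∫ x, gen k h s r q x * gen1 k h s r q x : ℝ) : ℂ) := hg1.pair_toLp hν
        rw [h4]
        simp only [mul_comm]
      linear_combination h3 / 2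
    rw [hl₁, hN, hg1.pair_sub hν, S2, h2, P3]
    push_cast at h1 ⊢
    linear_combination -(τ : ℂ)⁻¹ / 2 * h1
  · have h1 : τ⁻¹ * (2 / n * ∫ x, s x) * (τ⁻¹ * (2 * h / n))
        - (τ⁻¹ * ∫ x, s x * s x) * (τ⁻¹ * (2 / n ^ 2)) =
        τ⁻¹ ^ 2 * (2 / n ^ 2) * (2 * (h * ∫ x, s x) - ∫ x, s x * s x) := by
      field_simp
    have h2 : 0 < 2 * (h * ∫ x, s x) - ∫ x, s x * s x := by
      have := mul_pos hh hi₀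
      linarith
    have h3 : 0 < τ⁻¹ ^ 2 * (2 / n ^ 2) * (2 * (h * ∫ x, s x) - ∫ x, s x * s x) := by positivity
    linarith

/-- The kernel of the linearized operator is spanned by the derivative of the wave. -/
theorem linOp_zero_iff (hν : 0 < ν) (hνn : ν < n) {a b : ℝ →ᵇ ℝ}
    (ha : ∀ x, a x = h - 3 * s x + d2 k h s x) (hb : ∀ x, b x = h + 2 * k - s x)
    (v : WeightedL2 ν) : linOp ν 0 a b v 0 ↔ ∃ α : ℂ, ∀ᵐ x : ℝ, v x = α * (d1 s r x : ℂ) := by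
  have hd1 := W.isDecaying_d1 hν hνn
  have hd2 := W.isDecaying_d2 hν hνn
  have S0 := hd1.antideriv_toLp hν hd2 W.hasDerivAt_d1
  have h0 := (W.bifurcationData hν hνn a b ha hb).map_g₀
  have hP : ∀ g, (mulOp ν b - antideriv hν * mulOp ν a * antideriv hν
      - ((0 : ℝ) : ℂ) ^ 2 • antideriv hν ^ 4) g = pencilOp hν a b g := by
    intro g
    simp [pencilOp]
  rw [linOp_iff hν]
  simp only [hP, map_zero]
  constructor
  · rintro ⟨g, rfl, hg⟩
    obtain ⟨α, rfl⟩ := W.exists_eq_smul_of_pencilOp_eq_zero ha hb hν hνn hg.symm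
    refine ⟨α, ?_⟩
    rw [map_smul, S0]
    filter_upwards [WeightedL2.coeFn_smul α (hd1.toLp hν), hd1.toLp_ae hν] with x h1 h2
    rw [h1, h2]
  · rintro ⟨α, hα⟩
    refine ⟨α • hd2.toLp hν, ?_, ?_⟩
    · rw [map_smul, S0]
      refine WeightedL2.ext ?_
      filter_upwards [hα, WeightedL2.coeFn_smul α (hd1.toLp hν), hd1.toLp_ae hν] with x h1 h2 h3
      rw [h1, h2, h3]
    · rw [map_smul]
      have h1 : pencilOp hν a b (hd2.toLp hν) = 0 := h0
      rw [h1, smul_zero]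

end IsWaveChart

end

end CHKP

end

theorem theorem1 (k c ν : ℝ) (hk : 0 < k) (hc : 3 * k < c) (hν : 0 < ν)
    (hν₀ : ν < Real.sqrt ((c - 3 * k) / (c - k))) :
    (∀ η : ℝ, ∃ b₀ : ℝ, 0 < b₀ ∧
      ∀ z ∈ CHKP.spectrum (CHKP.backgroundOp k c ν η), z.re ≤ -b₀) ∧
    ∀ φ : ℝ → ℝ, CHKP.IsSolitaryWave k c φ →
      CHKP.HasAlgMultiplicity (CHKP.waveOp c ν 0 φ) 0 2 ∧
      (∀ v : CHKP.WeightedL2 ν, CHKP.waveOp c ν 0 φ v 0 ↔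
        ∃ α : ℂ, ∀ᵐ x : ℝ, v x = α * ((deriv φ x : ℝ) : ℂ)) ∧
      ∃ η₀ : ℝ, 0 < η₀ ∧ ∃ zp zm : ℝ → ℂ,
        ContinuousOn zp (Set.Ioo (-η₀) η₀) ∧ ContinuousOn zm (Set.Ioo (-η₀) η₀) ∧
        zp 0 = 0 ∧ zm 0 = 0 ∧
        ∀ η ∈ Set.Ioo (-η₀) η₀, η ≠ 0 →
          CHKP.IsSimpleEigenvalue (CHKP.waveOp c ν η φ) (zp η) ∧
          CHKP.IsSimpleEigenvalue (CHKP.waveOp c ν η φ) (zm η) ∧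
          (zp η).re = (zm η).re ∧ (zp η).re < 0 ∧
          (zp η).im = -(zm η).im ∧ 0 < (zp η).im := by
  refine ⟨CHKP.re_le_of_mem_spectrum_backgroundOp hk hc hν hν₀, fun φ hφ => ?_⟩
  have hν1 : ν < 1 := hν₀.trans_le (Real.sqrt_le_one.2 (by
    rw [div_le_one (by linarith)]
    linarith))
  obtain ⟨r, q, x₀, W⟩ := hφ.exists_chart hk hc
  set s : ℝ → ℝ := fun x => φ x - k with hs
  have h1 : deriv φ = CHKP.IsWaveChart.d1 s r := by
    have h2 : φ = fun x => s x + k := by simp [hs]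
    funext x
    rw [h2]
    exact ((W.hasDerivAt_s x).add_const k).deriv
  have h2 : iteratedDeriv 2 φ = CHKP.IsWaveChart.d2 k (c - 3 * k) s := by
    funext x
    rw [iteratedDeriv_succ, iteratedDeriv_one, h1]
    exact (W.hasDerivAt_d1 x).deriv
  set a := CHKP.bddFun _ W.continuous_a W.isBigO_a_one
  set b := CHKP.bddFun _ W.continuous_b W.isBigO_b_one
  have hwave : ∀ η, CHKP.waveOp c ν η φ = CHKP.linOp ν η a b := by
    intro η
    have ha : (fun x => c - 3 * φ x + iteratedDeriv 2 φ x) = a := by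
      funext x
      change _ = c - 3 * k - 3 * (φ x - k) + CHKP.IsWaveChart.d2 k (c - 3 * k) s x
      rw [h2]
      ring
    have hb : (fun x => c - φ x) = b := by
      funext x
      change _ = c - 3 * k + 2 * k - (φ x - k)
      ring
    rw [CHKP.waveOp, ha, hb]
  simp only [hwave, h1]
  obtain ⟨h3, h4⟩ := W.exists_branches hν hν1 hν₀ (a := a) (b := b) (fun _ => rfl) fun _ => rfl
  exact ⟨h3, W.linOp_zero_iff hν hν₀ (fun _ => rfl) fun _ => rfl, h4⟩
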